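/- Let $(\mathcal C,\otimes,K,c)$ be a symmetric monoidal category (written as if it were strict) in which idempotents split. Algebras are associative and unitary, with multiplication $\mu$ and unit $\eta$; coalgebras are coassociative and counitary, with comultiplication $\Delta$ and counit $\epsilon$. For an object $X$ we also write $X$ for $\mathrm{id}_X$. For a coalgebra $X$, an object $B$ with a product $\mu_B$, and $a,b\colon X\to B$, put $a*b:=\mu_B\circ(a\otimes b)\circ\Delta_X$. Let $H$ be a weak bialgebra in $\mathcal C$: an algebra and coalgebra such that * $\Delta\circ\mu=(\mu\otimes\mu)\circ(H\otimes c\otimes H)\circ(\Delta\otimes\Delta)$, * $\epsilon\circ\mu\circ(\mu\otimes H)=(\epsilon\circ\mu\otimes\epsilon\circ\mu)\circ(H\otimes\Delta\otimes H)=(\epsilon\circ\mu\otimes\epsilon\circ\mu)\circ(H\otimes c\circ\Delta\otimes H)$, * $(\Delta\otimes H)\circ\Delta\circ\eta=(H\otimes\mu\otimes H)\circ(\Delta\circ\eta\otimes\Delta\circ\eta)=(H\otimes\mu\circ c\otimes H)\circ(\Delta\circ\eta\otimes\Delta\circ\eta)$. Set $\Pi^L:=(\epsilon\circ\mu\otimes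 H)\circ(H\otimes c)\circ(\Delta\circ\eta\otimes H)$ and $\Pi^R:=(H\otimes\epsilon\circ\mu)\circ(c\otimes H)\circ(H\otimes\Delta\circ\eta)$. Assume that $H$ is a weak Hopf algebra, i.e. that it has an antipode $S\colon H\to H$: $\mathrm{id}*S=\Pi^L$, $S*\mathrm{id}=\Pi^R$ and $S*\mathrm{id}*S=S$. Let $A$ be an algebra which is a left weak $H$-module algebra via $\rho\colon H\otimes A\to A$, that is, * $\rho\circ(\eta\otimes A)=\mathrm{id}_A$, * $\rho\circ(H\otimes\mu_A)=\mu_A\circ(\rho\otimes\rho)\circ(H\otimes c\otimes A)\circ(\Delta\otimes A\otimes A)$, * $\rho\circ(\mu\otimes\eta_A)=\rho\circ(H\otimes\rho)\circ(H\otimes H\otimes\eta_A)$, * $\rho\circ(\Pi^L\otimes A)=\mu_A\circ(\rho\otimes A)\circ(H\otimes\eta_A\otimes A)$. Put $\chi_\rho:=(\rho\otimes H)\circ(H\otimes c)\circ(\Delta\otimes A)\colon H\otimes A\to A\otimes H$, let $\nabla_\rho:=(\mu_A\otimes H)\circ(A\otimes\chi_\rho)\circ(A\otimes H\otimes\eta_A)$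 (an idempotent of $A\otimes H$), $\nu:=\nabla_\rho\circ(\eta_A\otimes\eta)$, $u_1:=\rho\circ(H\otimes\eta_A)$ and $u_2:=u_1\circ\mu$. For $f\colon H\otimes H\to A$ put $\mathcal F_f:=(f\otimes\mu)\circ\Delta_{H\otimes H}$, where $\Delta_{H\otimes H}:=(H\otimes c\otimes H)\circ(\Delta\otimes\Delta)$. Assume that $f$ satisfies 1. $f=\mu_A\circ(A\otimes\rho)\circ(f\otimes\mu\otimes A)\circ(\Delta_{H\otimes H}\otimes\eta_A)$, 2. $\mu_A\circ(A\otimes\rho)\circ(\mathcal F_f\otimes A)=\mu_A\circ(A\otimes f)\circ(\chi_\rho\otimes H)\circ(H\otimes\chi_\rho)$ (twisted module condition) and $\mu_A\circ(A\otimes f)\circ(\chi_\rho\otimes H)\circ(H\otimes\mathcal F_f)=\mu_A\circ(A\otimes f)\circ(\mathcal F_f\otimes H)$ (cocycle condition), 3. $u_1=\mu_A\circ(\rho\otimes f)\circ(H\otimes c\otimes H)\circ(\Delta\otimes\nu)$, 4. $u_1=\mu_A\circ(A\otimes f)\circ(\nu\otimes H)$, 5. $(\mu_A\otimes H)\circ(A\otimes\chi_\rho)\circ(\nu\otimes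 A)=(\mu_A\otimes H)\circ(A\otimes\nu)$. Let $\imath\colon E\to A\otimes H$ and $p\colon A\otimes H\to E$ split $\nabla_\rho$, so that $\imath\circ p=\nabla_\rho$ and $p\circ\imath=\mathrm{id}_E$. Let $E$ have the product $$\mu_E:=p\circ(\mu_A\otimes H)\circ(\mu_A\otimes\mathcal F_f)\circ(A\otimes\chi_\rho\otimes H)\circ(\imath\otimes\imath)$$ ($E$ is the unitary crossed product of $A$ by $H$ associated with $\rho$ and $f$), and put $\jmath_\nu:=p\circ(\mu_A\otimes H)\circ(A\otimes\nu)\colon A\to E$ and $\gamma:=p\circ(\eta_A\otimes H)\colon H\to E$. Assume that $f$ is invertible, i.e. $f*u_2=f$ and there is $g\colon H\otimes H\to A$ with $f*g=g*f=u_2$; let $f^{-1}$ be the unique such $g$ that also satisfies $g*u_2=g$. Set $$Q:=(f^{-1}\otimes H)\circ(H\otimes c)\circ(\Delta\otimes H)\circ(S\otimes H)\circ\Delta\colon H\to A\otimes H,\qquad \gamma^{-1}:=\mu_E\circ(\jmath_\nu\otimes\gamma)\circ Q\colon H\to E .$$ Then $$\gamma^{-1}*\gamma=\gamma\circ\Pi^R\qquad\text{and}\qquad\gamma*\gamma^{-1}=\gamma\circ\Pi^L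 .$$ -/

import Mathlib

open CategoryTheory MonoidalCategory
open scoped MonObj ComonObj

universe v u

/-
Conventions.  Everything takes place in a symmetric monoidal category `C`, not assumed strict.
Composition is written in diagrammatic order: `f ≫ g` is `g ∘ f`.  The composition `f ⊗≫ g`
inserts between `f` and `g` the canonical coherence isomorphism (associators and unitors only);
in a strict category it is `f ≫ g`.  A (unitary, associative) algebra in `C` is a `MonObj`, with
multiplication `μ[A]` and unit `η[A]`; a (counitary, coassociative) coalgebra is a `ComonObj`, with
comultiplication `Δ[H]` and counit `ε[H]`; the symmetry is `β_ X Y`.  The coalgebra structure of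
`H ⊗ H` is the usual one, `Δ[H ⊗ H] = (Δ ⊗ Δ) ≫ tensorμ H H H H`, where
`tensorμ W X Y Z : (W ⊗ X) ⊗ (Y ⊗ Z) ⟶ (W ⊗ Y) ⊗ (X ⊗ Z)` is the symmetry `W ⊗ β_ X Y ⊗ Z` of the
two middle factors.
-/

namespace WeakCrossed

/-! ### Convolution and regular maps -/

section Convolution

variable {C : Type u} [Category.{v} C] [MonoidalCategory C]

/-- Convolution product of `a, b : X ⟶ B`, for a coalgebra `X` and a product `m` on `B`. -/
def conv {X B : C} [ComonObj X] (m : B ⊗ B ⟶ B) (a b : X ⟶ B) : X ⟶ B :=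
  Δ[X] ≫ (a ⊗ₘ b) ≫ m

/-- Relative to `w : X ⟶ A`, the map `g` is regular: `g * w = g` and there exists `g'` with
`g * g' = g' * g = w`. -/
def IsRegular {X A : C} [ComonObj X] [MonObj A] (w g : X ⟶ A) : Prop :=
  conv μ[A] g w = g ∧ ∃ g' : X ⟶ A, conv μ[A] g g' = w ∧ conv μ[A] g' g = w

/-- `g'` is the inverse of `g` in the group of regular maps (with identity element `w`). -/
structure IsRegularInverse {X A : C} [ComonObj X] [MonObj A] (w g g' : X ⟶ A) : Prop where
  mul_inv : conv μ[A] g g' = w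
  inv_mul : conv μ[A] g' g = w
  inv_mul_one : conv μ[A] g' w = g'

/-- The inverse `g⁻¹` of a regular map `g`, normalized by `g⁻¹ * w = g⁻¹`: it is obtained from any
`g'` with `g * g' = g' * g = w` as `g' * w`. -/
noncomputable def regularInverse {X A : C} [ComonObj X] [MonObj A] (w g : X ⟶ A)
    (hg : IsRegular w g) : X ⟶ A :=
  conv μ[A] hg.2.choose w

theorem conv_assoc {X A : C} [ComonObj X] [MonObj A] (a b c : X ⟶ A) :
    conv μ[A] (conv μ[A] a b) c = conv μ[A] a (conv μ[A] b c) := by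
  have h : ∀ p q : X ⟶ A, conv μ[A] p q = Δ[X] ≫ p ▷ X ≫ A ◁ q ≫ μ[A] := fun p q => by
    rw [conv, MonoidalCategory.tensorHom_def, Category.assoc]
  simp only [h]
  exact mul_assoc (G := Conv X A) a b c

/-- If `w` is idempotent, then `regularInverse w g hg` is the inverse of `g`. -/
theorem regularInverse_spec {X A : C} [ComonObj X] [MonObj A] {w g : X ⟶ A}
    (hw : conv μ[A] w w = w) (hg : IsRegular w g) :
    IsRegularInverse w g (regularInverse w g hg) := by
  obtain ⟨h1, h2⟩ := hg.2.choose_spec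
  have h3 : conv μ[A] w g = g := by
    conv_lhs => rw [← h1]
    rw [conv_assoc, h2, hg.1]
  refine ⟨?_, ?_, ?_⟩
  · rw [regularInverse, ← conv_assoc, h1, hw]
  · rw [regularInverse, conv_assoc, h3, h2]
  · rw [regularInverse, conv_assoc, hw]

/-- The inverse of a regular map is unique. -/
theorem IsRegularInverse.unique {X A : C} [ComonObj X] [MonObj A] {w g a b : X ⟶ A}
    (ha : IsRegularInverse w g a) (hb : IsRegularInverse w g b) : a = b := by
  have h : conv μ[A] w b = b := by
    conv_lhs => rw [← hb.inv_mul]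
    rw [conv_assoc, hb.mul_inv, hb.inv_mul_one]
  rw [← ha.inv_mul_one, ← hb.mul_inv, ← conv_assoc, ha.inv_mul, h]

end Convolution

/-! ### Split idempotents -/

/-- A splitting of an endomorphism `e` of `X` (which is then idempotent): an object `obj` with
maps `incl : obj ⟶ X` and `proj : X ⟶ obj` such that `incl ∘ proj = e` and `proj ∘ incl = id`. -/
structure Splitting {C : Type u} [Category.{v} C] {X : C} (e : X ⟶ X) where
  obj : C
  incl : obj ⟶ X
  proj : X ⟶ obj
  proj_incl : proj ≫ incl = e
  incl_proj : incl ≫ proj = 𝟙 obj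

/-! ### Crossed products of an algebra `A` by an object `V` -/

section CrossedProducts

variable {C : Type u} [Category.{v} C] [MonoidalCategory C] {A V : C} [MonObj A]

/-- `∇_χ = (μ_A ⊗ V) ∘ (A ⊗ χ) ∘ (A ⊗ V ⊗ η_A)`. -/
def nabla (χ : V ⊗ A ⟶ A ⊗ V) : A ⊗ V ⟶ A ⊗ V :=
  (ρ_ (A ⊗ V)).inv ≫ (A ⊗ V) ◁ η[A] ⊗≫ A ◁ χ ⊗≫ μ[A] ▷ V

/-- The product `(μ_A ⊗ V) ∘ (μ_A ⊗ F) ∘ (A ⊗ χ ⊗ V)` of `A ⊗ V`. -/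
def mulTensor (χ : V ⊗ A ⟶ A ⊗ V) (F : V ⊗ V ⟶ A ⊗ V) : (A ⊗ V) ⊗ (A ⊗ V) ⟶ A ⊗ V :=
  𝟙 ((A ⊗ V) ⊗ (A ⊗ V)) ⊗≫ A ◁ (χ ▷ V) ⊗≫ (μ[A] ⊗ₘ F) ⊗≫ μ[A] ▷ V

variable {χ : V ⊗ A ⟶ A ⊗ V} (s : Splitting (nabla χ))

/-- The product `μ_E = p_χ ∘ μ_{A ⊗ V} ∘ (ι_χ ⊗ ι_χ)` of `E = ∇_χ(A ⊗ V)`. -/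
def mulE (F : V ⊗ V ⟶ A ⊗ V) : s.obj ⊗ s.obj ⟶ s.obj :=
  (s.incl ⊗ₘ s.incl) ≫ mulTensor χ F ≫ s.proj

/-- `j_ν = p_χ ∘ (μ_A ⊗ V) ∘ (A ⊗ ν) : A ⟶ E`. -/
def jMap (ν : 𝟙_ C ⟶ A ⊗ V) : A ⟶ s.obj :=
  ((ρ_ A).inv ≫ A ◁ ν ⊗≫ μ[A] ▷ V) ≫ s.proj

/-- `γ = p_χ ∘ (η_A ⊗ V) : V ⟶ E`. -/
def gammaMap : V ⟶ s.obj :=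
  (λ_ V).inv ≫ η[A] ▷ V ≫ s.proj

end CrossedProducts

variable {C : Type u} [Category.{v} C] [MonoidalCategory C] [SymmetricCategory C]

/-! ### Weak bialgebras and weak Hopf algebras -/

section WeakHopf

variable (H : C) [MonObj H] [ComonObj H]

/-- The algebra and coalgebra structures of `H` make it a weak bialgebra.  In Sweedler notation the
axioms are `Δ(xy) = x₁y₁ ⊗ x₂y₂`, `ε(xyz) = ε(xy₁)ε(y₂z) = ε(xy₂)ε(y₁z)` and
`1₁ ⊗ 1₂ ⊗ 1₃ = 1₁ ⊗ 1₂1₁' ⊗ 1₂' = 1₁ ⊗ 1₁'1₂ ⊗ 1₂'`. -/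
structure IsWeakBialgebra : Prop where
  mul_comul : μ[H] ≫ Δ[H] = (Δ[H] ⊗ₘ Δ[H]) ≫ tensorμ H H H H ≫ (μ[H] ⊗ₘ μ[H])
  counit_mul_mul : μ[H] ▷ H ≫ μ[H] ≫ ε[H] =
    ((H ◁ Δ[H]) ▷ H ⊗≫ ((μ[H] ≫ ε[H]) ⊗ₘ (μ[H] ≫ ε[H]))) ≫ (λ_ (𝟙_ C)).hom
  counit_mul_mul_cop : μ[H] ▷ H ≫ μ[H] ≫ ε[H] =
    ((H ◁ (Δ[H] ≫ (β_ H H).hom)) ▷ H ⊗≫ ((μ[H] ≫ ε[H]) ⊗ₘ (μ[H] ≫ ε[H]))) ≫ (λ_ (𝟙_ C)).hom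
  comul_comul_one : η[H] ≫ Δ[H] ≫ Δ[H] ▷ H =
    (λ_ (𝟙_ C)).inv ≫ ((η[H] ≫ Δ[H]) ⊗ₘ (η[H] ≫ Δ[H])) ⊗≫ (H ◁ μ[H]) ▷ H ⊗≫ 𝟙 ((H ⊗ H) ⊗ H)
  comul_comul_one_op : η[H] ≫ Δ[H] ≫ Δ[H] ▷ H =
    (λ_ (𝟙_ C)).inv ≫ ((η[H] ≫ Δ[H]) ⊗ₘ (η[H] ≫ Δ[H])) ⊗≫
      (H ◁ ((β_ H H).hom ≫ μ[H])) ▷ H ⊗≫ 𝟙 ((H ⊗ H) ⊗ H)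

/-- `Π^L = (ε ∘ μ ⊗ H) ∘ (H ⊗ c) ∘ (Δ ∘ η ⊗ H)`, that is, `Π^L(h) = ε(1₁h)1₂`. -/
def PiL : H ⟶ H :=
  (λ_ H).inv ≫ (η[H] ≫ Δ[H]) ▷ H ⊗≫ H ◁ (β_ H H).hom ⊗≫ (μ[H] ≫ ε[H]) ▷ H ≫ (λ_ H).hom

/-- `Π^R = (H ⊗ ε ∘ μ) ∘ (c ⊗ H) ∘ (H ⊗ Δ ∘ η)`, that is, `Π^R(h) = 1₁ε(h1₂)`. -/
def PiR : H ⟶ H :=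
  (ρ_ H).inv ≫ H ◁ (η[H] ≫ Δ[H]) ⊗≫ (β_ H H).hom ▷ H ⊗≫ H ◁ (μ[H] ≫ ε[H]) ≫ (ρ_ H).hom

variable {H}

/-- `S` is an antipode of the weak bialgebra `H`: `id * S = Π^L`, `S * id = Π^R` and
`S * id * S = S`.  A weak Hopf algebra is a weak bialgebra with an antipode. -/
structure IsAntipode (S : H ⟶ H) : Prop where
  id_conv : Δ[H] ≫ H ◁ S ≫ μ[H] = PiL H
  conv_id : Δ[H] ≫ S ▷ H ≫ μ[H] = PiR H
  conv_id_conv : Δ[H] ≫ Δ[H] ▷ H ≫ ((S ⊗ₘ 𝟙 H) ⊗ₘ S) ≫ μ[H] ▷ H ≫ μ[H] = S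

end WeakHopf

/-! ### Weak module algebras and crossed products of `A` by `H` -/

section WeakAction

variable {H A : C} [MonObj H] [ComonObj H] [MonObj A]

/-- `u₁ = ρ ∘ (H ⊗ η_A)`. -/
def u1 (ρ : H ⊗ A ⟶ A) : H ⟶ A := (ρ_ H).inv ≫ H ◁ η[A] ≫ ρ

/-- `u₂ = u₁ ∘ μ_H`. -/
def u2 (ρ : H ⊗ A ⟶ A) : H ⊗ H ⟶ A := μ[H] ≫ u1 ρ

/-- `A` is a left weak `H`-module algebra via the weak left action `ρ`.  In Sweedler notation:
`1·a = a`, `h·(ab) = (h₁·a)(h₂·b)`, `(hk)·1 = h·(k·1)` and `Π^L(h)·a = (h·1)a`. -/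
structure IsWeakModuleAlgebra (ρ : H ⊗ A ⟶ A) : Prop where
  one_act : (λ_ A).inv ≫ η[H] ▷ A ≫ ρ = 𝟙 A
  act_mul : H ◁ μ[A] ≫ ρ =
    Δ[H] ▷ (A ⊗ A) ≫ tensorμ H H A A ≫ (ρ ⊗ₘ ρ) ≫ μ[A]
  mul_act_one : u2 ρ = H ◁ u1 ρ ≫ ρ
  piL_act : PiL H ▷ A ≫ ρ = u1 ρ ▷ A ≫ μ[A]

/-- `χ_ρ = (ρ ⊗ H) ∘ (H ⊗ c) ∘ (Δ ⊗ A)`. -/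
def chi (ρ : H ⊗ A ⟶ A) : H ⊗ A ⟶ A ⊗ H :=
  Δ[H] ▷ A ⊗≫ H ◁ (β_ H A).hom ⊗≫ ρ ▷ H

/-- `F_f = (f ⊗ μ_H) ∘ Δ_{H ⊗ H}`. -/
def calF (f : H ⊗ H ⟶ A) : H ⊗ H ⟶ A ⊗ H :=
  Δ[H ⊗ H] ≫ (f ⊗ₘ μ[H])

/-- `ν = ∇_ρ ∘ (η_A ⊗ η_H)`, where `∇_ρ = ∇_{χ_ρ}`. -/
def nu (ρ : H ⊗ A ⟶ A) : 𝟙_ C ⟶ A ⊗ H :=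
  (λ_ (𝟙_ C)).inv ≫ (η[A] ⊗ₘ η[H]) ≫ nabla (chi ρ)

/-- The conditions on `ρ` and `f` under which the algebra `E = ∇_ρ(A ⊗ H)` is called the unitary
crossed product of `A` by `H` associated with `ρ` and `f`. -/
structure IsUnitaryCrossedProduct (ρ : H ⊗ A ⟶ A) (f : H ⊗ H ⟶ A) : Prop where
  /-- `f = μ_A ∘ (A ⊗ ρ) ∘ (f ⊗ μ ⊗ A) ∘ (Δ_{H ⊗ H} ⊗ η_A)` -/
  f_eq : f = ((ρ_ (H ⊗ H)).inv ≫ (Δ[H ⊗ H] ⊗ₘ η[A]) ≫ (f ⊗ₘ μ[H]) ▷ A ⊗≫ A ◁ ρ) ≫ μ[A]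
  /-- `μ_A ∘ (A ⊗ ρ) ∘ (F_f ⊗ A) = μ_A ∘ (A ⊗ f) ∘ (χ_ρ ⊗ H) ∘ (H ⊗ χ_ρ)` -/
  twisted_module : (calF f ▷ A ⊗≫ A ◁ ρ) ≫ μ[A] =
    (𝟙 ((H ⊗ H) ⊗ A) ⊗≫ H ◁ chi ρ ⊗≫ chi ρ ▷ H ⊗≫ A ◁ f) ≫ μ[A]
  /-- `μ_A ∘ (A ⊗ f) ∘ (χ_ρ ⊗ H) ∘ (H ⊗ F_f) = μ_A ∘ (A ⊗ f) ∘ (F_f ⊗ H)` -/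
  cocycle : (𝟙 ((H ⊗ H) ⊗ H) ⊗≫ H ◁ calF f ⊗≫ chi ρ ▷ H ⊗≫ A ◁ f) ≫ μ[A] =
    (calF f ▷ H ⊗≫ A ◁ f) ≫ μ[A]
  /-- `ρ ∘ (H ⊗ η_A) = μ_A ∘ (ρ ⊗ f) ∘ (H ⊗ c ⊗ H) ∘ (Δ ⊗ ν)` -/
  preunit_left : u1 ρ =
    (ρ_ H).inv ≫ (Δ[H] ⊗ₘ nu ρ) ≫ tensorμ H H A H ≫ (ρ ⊗ₘ f) ≫ μ[A]
  /-- `ρ ∘ (H ⊗ η_A) = μ_A ∘ (A ⊗ f) ∘ (ν ⊗ H)` -/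
  preunit_right : u1 ρ = ((λ_ H).inv ≫ nu ρ ▷ H ⊗≫ A ◁ f) ≫ μ[A]
  /-- `(μ_A ⊗ H) ∘ (A ⊗ χ_ρ) ∘ (ν ⊗ A) = (μ_A ⊗ H) ∘ (A ⊗ ν)` -/
  preunit_comm : (λ_ A).inv ≫ nu ρ ▷ A ⊗≫ A ◁ chi ρ ⊗≫ μ[A] ▷ H =
    (ρ_ A).inv ≫ A ◁ nu ρ ⊗≫ μ[A] ▷ H

/-- The cocycle `f` is invertible: it is regular with respect to `u₂`. -/
def IsInvertibleCocycle (ρ : H ⊗ A ⟶ A) (f : H ⊗ H ⟶ A) : Prop :=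
  IsRegular (u2 ρ) f

/-- The map `u₁` is idempotent for the convolution product. -/
theorem u1_idem {ρ : H ⊗ A ⟶ A} (hρ : IsWeakModuleAlgebra ρ) :
    conv μ[A] (u1 ρ) (u1 ρ) = u1 ρ := by
  have h2 := congrArg
    (fun t => (ρ_ H).inv ≫ H ◁ ((λ_ (𝟙_ C)).inv ≫ (η[A] ⊗ₘ η[A])) ≫ t) hρ.act_mul
  have e1 : (ρ_ H).inv ≫ H ◁ ((λ_ (𝟙_ C)).inv ≫ (η[A] ⊗ₘ η[A])) ≫ H ◁ μ[A] ≫ ρ = u1 ρ := by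
    rw [← MonoidalCategory.whiskerLeft_comp_assoc]
    simp [u1, MonoidalCategory.tensorHom_def]
  have e3 : H ◁ ((λ_ (𝟙_ C)).inv ≫ (η[A] ⊗ₘ η[A])) ≫ Δ[H] ▷ (A ⊗ A) =
      Δ[H] ▷ 𝟙_ C ≫ (H ⊗ H) ◁ (λ_ (𝟙_ C)).inv ≫ ((𝟙 H ⊗ₘ 𝟙 H) ⊗ₘ (η[A] ⊗ₘ η[A])) := by
    rw [MonoidalCategory.whisker_exchange]; simp
  simp only [e1] at h2
  conv_rhs => rw [h2, reassoc_of% e3, tensorμ_natural_assoc]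
  have e4 : (H ⊗ H) ◁ (λ_ (𝟙_ C)).inv ≫ tensorμ H H (𝟙_ C) (𝟙_ C) =
      (ρ_ _).hom ≫ ((ρ_ H).inv ⊗ₘ (ρ_ H).inv) := by
    simp [tensorμ]
    monoidal
  conv_rhs => rw [reassoc_of% e4]
  rw [conv]
  simp [u1]

/-- The map `u₂` is idempotent for the convolution product; hence inverses relative to `u₂` are
well defined and unique. -/
theorem u2_idem (hH : IsWeakBialgebra H) {ρ : H ⊗ A ⟶ A} (hρ : IsWeakModuleAlgebra ρ) :
    conv μ[A] (u2 ρ) (u2 ρ) = u2 ρ := by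
  conv_rhs => rw [u2, ← u1_idem hρ, WeakCrossed.conv, ← Category.assoc, hH.mul_comul]
  simp [conv, u2]

/-- The normalized inverse of an invertible cocycle is the inverse for the convolution product. -/
theorem IsInvertibleCocycle.inverse_spec (hH : IsWeakBialgebra H) {ρ : H ⊗ A ⟶ A}
    (hρ : IsWeakModuleAlgebra ρ) {f : H ⊗ H ⟶ A} (hf : IsInvertibleCocycle ρ f) :
    IsRegularInverse (u2 ρ) f (regularInverse (u2 ρ) f hf) :=
  regularInverse_spec (u2_idem hH hρ) hf

/-- For `g = f⁻¹`: `Q = (g ⊗ H) ∘ (H ⊗ c) ∘ (Δ ⊗ H) ∘ (S ⊗ H) ∘ Δ`. -/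
def mapQ (S : H ⟶ H) (g : H ⊗ H ⟶ A) : H ⟶ A ⊗ H :=
  Δ[H] ≫ S ▷ H ≫ Δ[H] ▷ H ⊗≫ H ◁ (β_ H H).hom ⊗≫ g ▷ H

/-- `γ⁻¹ = μ_E ∘ (j_ν ⊗ γ) ∘ Q`, with `Q` formed from the antipode `S` and the inverse `f⁻¹`. -/
noncomputable def gammaInv {ρ : H ⊗ A ⟶ A} (s : Splitting (nabla (chi ρ))) (S : H ⟶ H)
    (f : H ⊗ H ⟶ A) (hf : IsInvertibleCocycle ρ f) : H ⟶ s.obj :=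
  mapQ S (regularInverse (u2 ρ) f hf) ≫ (jMap s (nu ρ) ⊗ₘ gammaMap s) ≫ mulE s (calF f)

end WeakAction

end WeakCrossed

/-! Write g for f⁻¹, p for the projection onto E, and use Sweedler notation. In E one has j(a)γ(h) =
p(a ⊗ h), hence γ⁻¹(h) = p(g(S(h₁)₁, h₂) ⊗ S(h₁)₂). Multiplying by γ on the right gives p(g(S(h₁)₁,
h₂)f(S(h₁)₂, h₃) ⊗ S(h₁)₃h₄). Here g * f = u₂, so this is p(u₁(c₁) ⊗ c₂) with c = S(h₁)h₂ = Π^R(h),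
and p(u₁(c₁) ⊗ c₂) = γ(c).

In the other order γ(h₁) acts on the value of g. The identity (h₁·g(k₁, l))f(h₂, k₂) = f(h₁,
k₁l₁)g(h₂k₂, l₂) (`act_inv_mul_coc`), which combines the cocycle and twisted module conditions,
removes this action. Since S reverses the comultiplication (`comul_anti`), what remains is f(h₁,
Π^R(h₃))g(c₁, h₄) ⊗ c₂ with c = Π^L(h₂). On such arguments f and g reduce to u₁ of the product
(`coc_piR_snd`, `inv_comul_piL`). Exchanging Π^R with Π^L (`piR_piL_comm`) and absorbing both leaves
u₁(h₁)u₁(1₁h₂) ⊗ 1₂. The preunit condition, as 1₁·a ⊗ 1₂ = a u₁(1₁) ⊗ 1₂, turns this into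
u₁(h)u₁(1₁) ⊗ 1₂ = u₁(c₁) ⊗ c₂, now with c = Π^L(h).

Such calculations are made rigorous in a nonstrict symmetric monoidal category by treating a string
diagram as a list of operations on named wires. If all names differ, symmetric coherence shows that
the list determines its morphism, whatever the order of the operations (`Denotes.unique`). Replacing
a renamed left hand side of a valid rule by its right hand side is therefore sound, and each derived
identity is a finite list of rule applications verified by computation (`Rule.Holds.of_check`). -/

namespace StringDiagram

/-! ### Tensor products of named wires and their coherence isomorphisms -/

/-- A bracketed tensor product of wires; a wire has a sort and a name. -/
inductive Wires (κ : Type) : Type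
  | leaf (a : κ × ℕ) : Wires κ
  | unit : Wires κ
  | tensor (Γ Λ : Wires κ) : Wires κ

variable {κ : Type}

namespace Wires

/-- The wires of a bracketed tensor product, from left to right. -/
def flat : Wires κ → List (κ × ℕ)
  | leaf a => [a]
  | unit => []
  | tensor Γ Λ => Γ.flat ++ Λ.flat

/-- The tensor product of a list of wires, bracketed to the right. -/
def ofList : List (κ × ℕ) → Wires κ
  | [] => unit
  | a :: l => tensor (leaf a) (ofList l)

@[simp] theorem flat_ofList (l : List (κ × ℕ)) : (ofList l).flat = l := by
  induction l with
  | nil => rfl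
  | cons a l ih => simp [ofList, flat, ih]

variable {C : Type u} [Category.{v} C] [MonoidalCategory C] (ob : κ → C)

/-- The object of `C` that a tensor product of wires stands for. -/
def obj : Wires κ → C
  | leaf a => ob a.1
  | unit => 𝟙_ C
  | tensor Γ Λ => Γ.obj ⊗ Λ.obj

end Wires

open Wires

variable {C : Type u} [Category.{v} C] [MonoidalCategory C] [SymmetricCategory C] (ob : κ → C)

/-- The coherence isomorphisms of the symmetric monoidal structure, with the permutation of wires
that they induce. -/
inductive Coh : (Γ Γ' : Wires κ) → (Γ.obj ob ⟶ Γ'.obj ob) → Prop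
  | id (Γ) : Coh Γ Γ (𝟙 _)
  | comp {Γ Γ' Γ'' φ ψ} : Coh Γ Γ' φ → Coh Γ' Γ'' ψ → Coh Γ Γ'' (φ ≫ ψ)
  | whiskerLeft (x) {Γ Γ' φ} : Coh Γ Γ' φ → Coh (tensor x Γ) (tensor x Γ') (x.obj ob ◁ φ)
  | whiskerRight (x) {Γ Γ' φ} : Coh Γ Γ' φ → Coh (tensor Γ x) (tensor Γ' x) (φ ▷ x.obj ob)
  | assoc_hom (x y z) : Coh (tensor (tensor x y) z) (tensor x (tensor y z)) (α_ _ _ _).hom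
  | assoc_inv (x y z) : Coh (tensor x (tensor y z)) (tensor (tensor x y) z) (α_ _ _ _).inv
  | left_hom (x) : Coh (tensor unit x) x (λ_ _).hom
  | left_inv (x) : Coh x (tensor unit x) (λ_ _).inv
  | right_hom (x) : Coh (tensor x unit) x (ρ_ _).hom
  | right_inv (x) : Coh x (tensor x unit) (ρ_ _).inv
  | braid (x y) : Coh (tensor x y) (tensor y x) (β_ _ _).hom

/-- `Extract a Γ R θ`: the isomorphism `θ` moves the wire `a` of `Γ` to the front, and `R` is what
remains. -/
inductive Extract (a : κ × ℕ) : (Γ R : Wires κ) → (Γ.obj ob ⟶ ob a.1 ⊗ R.obj ob) → Prop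
  | leaf : Extract a (leaf a) unit (ρ_ (ob a.1)).inv
  | left {Γ R θ} (Λ) : Extract a Γ R θ →
      Extract a (tensor Γ Λ) (tensor R Λ) (θ ▷ Λ.obj ob ≫ (α_ _ _ _).hom)
  | right {Λ R θ} (Γ) : Extract a Λ R θ →
      Extract a (tensor Γ Λ) (tensor Γ R) (Γ.obj ob ◁ θ ≫ (α_ _ _ _).inv ≫
        (β_ (Γ.obj ob) (ob a.1)).hom ▷ R.obj ob ≫ (α_ _ _ _).hom)

/-- A tensor product without wires is isomorphic to the unit object. -/
inductive Trivial : (Γ : Wires κ) → (Γ.obj ob ⟶ 𝟙_ C) → Prop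
  | unit : Trivial unit (𝟙 _)
  | tensor {Γ Λ u v} : Trivial Γ u → Trivial Λ v →
      Trivial (tensor Γ Λ) ((u ⊗ₘ v) ≫ (λ_ (𝟙_ C)).hom)

variable {ob}

/-! ### Coherence for wires with distinct names -/

namespace Coh

theorem flat_perm {Γ Γ' : Wires κ} {φ} (h : Coh ob Γ Γ' φ) : Γ.flat.Perm Γ'.flat := by
  induction h with
  | id => exact .refl _
  | comp _ _ h1 h2 => exact h1.trans h2
  | whiskerLeft _ _ h => exact h.append_left _
  | whiskerRight _ _ h => exact h.append_right _
  | braid => exact List.perm_append_comm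
  | _ => simp [flat]

theorem exists_inv {Γ Γ' : Wires κ} {φ} (h : Coh ob Γ Γ' φ) :
    ∃ ψ, Coh ob Γ' Γ ψ ∧ φ ≫ ψ = 𝟙 _ ∧ ψ ≫ φ = 𝟙 _ := by
  induction h with
  | id => exact ⟨_, .id _, by simp, by simp⟩
  | comp _ _ h1 h2 =>
    obtain ⟨ψ1, c1, e1, e1'⟩ := h1
    obtain ⟨ψ2, c2, e2, e2'⟩ := h2
    exact ⟨_, c2.comp c1, by simp [reassoc_of% e2, e1], by simp [reassoc_of% e1', e2']⟩
  | whiskerLeft _ _ h =>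
    obtain ⟨ψ, c, e, e'⟩ := h
    refine ⟨_, .whiskerLeft _ c, ?_, ?_⟩ <;> dsimp only [obj] <;>
      rw [← MonoidalCategory.whiskerLeft_comp] <;> simp [e, e']
  | whiskerRight _ _ h =>
    obtain ⟨ψ, c, e, e'⟩ := h
    refine ⟨_, .whiskerRight _ c, ?_, ?_⟩ <;> dsimp only [obj] <;>
      rw [← MonoidalCategory.comp_whiskerRight] <;> simp [e, e']
  | assoc_hom => exact ⟨_, .assoc_inv _ _ _, by simp [obj], by simp [obj]⟩
  | assoc_inv => exact ⟨_, .assoc_hom _ _ _, by simp [obj], by simp [obj]⟩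
  | left_hom => exact ⟨_, .left_inv _, by simp [obj], by simp [obj]⟩
  | left_inv => exact ⟨_, .left_hom _, by simp [obj], by simp [obj]⟩
  | right_hom => exact ⟨_, .right_inv _, by simp [obj], by simp [obj]⟩
  | right_inv => exact ⟨_, .right_hom _, by simp [obj], by simp [obj]⟩
  | braid => exact ⟨_, .braid _ _, by simp [obj], by simp [obj]⟩

/-- Base case of coherence: contracting all units absorbs any coherence isomorphism between products
without wires. For the braiding this uses that the unit object braids trivially with itself. -/
theorem exists_trivial {Γ Γ' : Wires κ} {φ} (h : Coh ob Γ Γ' φ) {u'} (hu : Trivial ob Γ' u') :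
    ∃ u, Trivial ob Γ u ∧ φ ≫ u' = u := by
  induction h with
  | id => exact ⟨_, hu, by simp⟩
  | comp _ _ h1 h2 =>
    obtain ⟨u2, t2, e2⟩ := h2 hu
    obtain ⟨u1, t1, e1⟩ := h1 t2
    exact ⟨_, t1, by rw [Category.assoc, e2, e1]⟩
  | whiskerLeft _ _ h =>
    cases hu with
    | tensor t1 t2 =>
      obtain ⟨u, t, e⟩ := h t2
      exact ⟨_, .tensor t1 t, by dsimp only [obj]; simp [← e, MonoidalCategory.tensorHom_def']⟩
  | whiskerRight _ _ h =>
    cases hu with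
    | tensor t1 t2 =>
      obtain ⟨u, t, e⟩ := h t1
      exact ⟨_, .tensor t t2, by dsimp only [obj]; simp [← e, MonoidalCategory.tensorHom_def]⟩
  | assoc_hom =>
    cases hu with
    | tensor t1 t2 =>
      cases t2 with
      | tensor t2 t3 =>
        exact ⟨_, .tensor (.tensor t1 t2) t3, by
          dsimp only [obj]
          simp [MonoidalCategory.tensorHom_def]⟩
  | assoc_inv =>
    cases hu with
    | tensor t1 t2 =>
      cases t1 with
      | tensor t0 t1 =>
        exact ⟨_, .tensor t0 (.tensor t1 t2), by
          dsimp only [obj]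
          simp [MonoidalCategory.tensorHom_def]⟩
  | left_hom => exact ⟨_, .tensor .unit hu, by
          dsimp only [obj]
          simp [MonoidalCategory.tensorHom_def]⟩
  | left_inv =>
    cases hu with
    | tensor t1 t2 =>
      cases t1
      exact ⟨_, t2, by
          dsimp only [obj]
          simp [MonoidalCategory.tensorHom_def]⟩
  | right_hom =>
    exact ⟨_, .tensor hu .unit, by
      dsimp only [obj]; simp [unitors_equal]⟩
  | right_inv =>
    cases hu with
    | tensor t1 t2 =>
      cases t2
      exact ⟨_, t1, by dsimp only [obj]; simp [MonoidalCategory.tensorHom_def, unitors_equal]⟩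
  | braid =>
    cases hu with
    | tensor t1 t2 =>
      exact ⟨_, .tensor t2 t1, by
        dsimp only [obj]
        rw [← BraidedCategory.braiding_naturality_assoc]
        simp [unitors_equal, unitors_inv_equal]⟩

/-- Inductive step of coherence: pulling a wire to the front commutes with coherence isomorphisms
and leaves one on the remaining wires. It suffices to check the generators; the hexagon identities
enter when the wire crosses a tensor product. -/
theorem exists_extract {Γ Γ' : Wires κ} {φ} (h : Coh ob Γ Γ' φ) {a R'} {θ'}
    (hθ : Extract ob a Γ' R' θ') :
    ∃ R θ φ', Extract ob a Γ R θ ∧ Coh ob R R' φ' ∧ φ ≫ θ' = θ ≫ ob a.1 ◁ φ' := by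
  induction h generalizing R' with
  | id => exact ⟨_, _, _, hθ, .id _, by simp⟩
  | comp _ _ h1 h2 =>
    obtain ⟨R2, θ2, φ2, t2, c2, e2⟩ := h2 hθ
    obtain ⟨R1, θ1, φ1, t1, c1, e1⟩ := h1 t2
    exact ⟨_, _, _, t1, c1.comp c2, by simp [e2, reassoc_of% e1]⟩
  | whiskerLeft x hc h =>
    cases hθ with
    | left _ t => exact ⟨_, _, _, t.left _, hc.whiskerLeft _, by
        simp only [obj]; rw [whisker_exchange_assoc]; simp⟩
    | right _ t =>
      obtain ⟨R, θ, φ', t', c, e⟩ := h t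
      refine ⟨_, _, _, t'.right _, c.whiskerLeft _, ?_⟩
      simp only [obj, ← MonoidalCategory.whiskerLeft_comp_assoc, e]
      simp only [MonoidalCategory.whiskerLeft_comp, Category.assoc]
      rw [associator_inv_naturality_right_assoc, whisker_exchange_assoc,
        associator_naturality_right]
  | whiskerRight x hc h =>
    cases hθ with
    | left _ t =>
      obtain ⟨R, θ, φ', t', c, e⟩ := h t
      refine ⟨_, _, _, t'.left _, c.whiskerRight _, ?_⟩
      simp only [obj, ← MonoidalCategory.comp_whiskerRight_assoc, e]
      simp
    | right _ t => exact ⟨_, _, _, t.right _, hc.whiskerRight _, by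
        simp only [obj, Category.assoc]
        rw [← whisker_exchange_assoc, associator_inv_naturality_left_assoc,
          ← comp_whiskerRight_assoc, BraidedCategory.braiding_naturality_left]
        simp⟩
  | assoc_hom x y z =>
    cases hθ with
    | left _ t => exact ⟨_, _, _, (t.left _).left _, .assoc_hom _ _ _, by
        simp only [obj]; monoidal⟩
    | right _ t =>
      cases t with
      | left _ t => exact ⟨_, _, _, (t.right _).left _, .assoc_hom _ _ _, by
          simp only [obj]; monoidal⟩
      | right _ t => exact ⟨_, _, _, t.right _, .assoc_hom _ _ _, by
          simp only [obj, BraidedCategory.braiding_tensor_left_hom]; monoidal⟩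
  | assoc_inv x y z =>
    cases hθ with
    | right _ t => exact ⟨_, _, _, (t.right _).right _, .assoc_inv _ _ _, by
          simp only [obj, BraidedCategory.braiding_tensor_left_hom]; monoidal⟩
    | left _ t =>
      cases t with
      | left _ t => exact ⟨_, _, _, t.left _, .assoc_inv _ _ _, by
          simp only [obj]; monoidal⟩
      | right _ t => exact ⟨_, _, _, (t.left _).right _, .assoc_inv _ _ _, by
          simp only [obj]; monoidal⟩
  | left_hom x => exact ⟨_, _, _, hθ.right _, .left_hom _, by
      simp only [obj, braiding_tensorUnit_left]; monoidal⟩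
  | left_inv x =>
    cases hθ with
    | left _ t => cases t
    | right _ t => exact ⟨_, _, _, t, .left_inv _, by
      simp only [obj, braiding_tensorUnit_left]; monoidal⟩
  | right_hom x => exact ⟨_, _, _, hθ.left _, .right_hom _, by
      simp only [obj]; monoidal⟩
  | right_inv x =>
    cases hθ with
    | left _ t => exact ⟨_, _, _, t, .right_inv _, by
      simp only [obj]; monoidal⟩
    | right _ t => cases t
  | braid x y =>
    cases hθ with
    | left _ t => exact ⟨_, _, _, t.right _, .braid _ _, by
        simp only [obj, Category.assoc]
        rw [← BraidedCategory.braiding_naturality_right_assoc,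
          BraidedCategory.braiding_tensor_right_hom]
        simp⟩
    | right _ t => exact ⟨_, _, _, t.left _, .braid _ _, by
        simp only [obj, Category.assoc]
        rw [← BraidedCategory.braiding_naturality_left_assoc,
          BraidedCategory.braiding_tensor_left_hom]
        simp [← comp_whiskerRight_assoc]⟩

end Coh

omit [SymmetricCategory C] in
theorem Trivial.unique {Γ : Wires κ} {φ ψ} (h : Trivial ob Γ φ) (h' : Trivial ob Γ ψ) : φ = ψ := by
  induction h with
  | unit => cases h'; rfl
  | tensor _ _ h1 h2 =>
    cases h' with
    | tensor t1 t2 => rw [h1 t1, h2 t2]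

omit [SymmetricCategory C] in
theorem Trivial.isIso {Γ : Wires κ} {φ} (h : Trivial ob Γ φ) : IsIso φ := by
  induction h with
  | unit => exact inferInstanceAs (IsIso (𝟙 _))
  | tensor _ _ h1 h2 => dsimp only [obj] at *; infer_instance

omit [SymmetricCategory C] in
theorem exists_trivial : {Γ : Wires κ} → Γ.flat = [] → ∃ φ, Trivial ob Γ φ
  | .leaf a, h => by simp [flat] at h
  | .unit, _ => ⟨_, .unit⟩
  | .tensor Γ Λ, h => by
    simp only [flat, List.append_eq_nil_iff] at h
    obtain ⟨u, hu⟩ := exists_trivial h.1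
    obtain ⟨v, hv⟩ := exists_trivial h.2
    exact ⟨_, .tensor hu hv⟩

namespace Extract

theorem isIso {a} {Γ R : Wires κ} {θ} (h : Extract ob a Γ R θ) : IsIso θ := by
  induction h with
  | leaf => exact inferInstanceAs (IsIso (ρ_ _).inv)
  | left => dsimp only [obj] at *; infer_instance
  | right => dsimp only [obj] at *; infer_instance

theorem flat_perm {a} {Γ R : Wires κ} {θ} (h : Extract ob a Γ R θ) :
    Γ.flat.Perm (a :: R.flat) := by
  induction h with
  | leaf => simp [flat]
  | left Λ _ h => simpa [flat] using h.append_right Λ.flat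
  | right Γ _ h =>
    simp only [flat]
    exact (h.append_left Γ.flat).trans List.perm_middle

theorem exists_of_mem {a} : {Γ : Wires κ} → a ∈ Γ.flat → ∃ R θ, Extract ob a Γ R θ
  | .leaf b, h => by
    simp only [flat, List.mem_singleton] at h
    subst h
    exact ⟨_, _, .leaf⟩
  | .unit, h => by simp [flat] at h
  | .tensor Γ Λ, h => by
    simp only [flat, List.mem_append] at h
    rcases h with h | h
    · obtain ⟨R, θ, h⟩ := exists_of_mem h
      exact ⟨_, _, h.left _⟩
    · obtain ⟨R, θ, h⟩ := exists_of_mem h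
      exact ⟨_, _, h.right _⟩

/-- When names are distinct, only one factor of each tensor product can contain `a`, so every choice
in the extraction is forced. The equality is heterogeneous because the target of `θ` depends on `R`.
-/
theorem unique {a} {Γ R R' : Wires κ} {θ θ'} (hn : Γ.flat.Nodup) (h : Extract ob a Γ R θ)
    (h' : Extract ob a Γ R' θ') : R = R' ∧ HEq θ θ' := by
  induction h generalizing R' with
  | leaf => cases h'; exact ⟨rfl, HEq.rfl⟩
  | left Λ h ih =>
    simp only [flat, List.nodup_append] at hn
    cases h' with
    | left _ h' =>
      obtain ⟨rfl, e⟩ := ih hn.1 h'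
      cases e
      exact ⟨rfl, HEq.rfl⟩
    | right _ h' =>
      exact absurd rfl (hn.2.2 a (h.flat_perm.symm.subset (by simp)) a
        (h'.flat_perm.symm.subset (by simp)))
  | right Λ h ih =>
    simp only [flat, List.nodup_append] at hn
    cases h' with
    | right _ h' =>
      obtain ⟨rfl, e⟩ := ih hn.2.1 h'
      cases e
      exact ⟨rfl, HEq.rfl⟩
    | left _ h' =>
      exact absurd rfl (hn.2.2 a (h'.flat_perm.symm.subset (by simp)) a
        (h.flat_perm.symm.subset (by simp)))

end Extract

namespace Coh

/-- Coherence: if all wires have different names, a coherence isomorphism is determined by its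
source and its target. -/
theorem unique {Γ Γ' : Wires κ} {φ ψ} (hn : Γ.flat.Nodup) (h : Coh ob Γ Γ' φ)
    (h' : Coh ob Γ Γ' ψ) : φ = ψ := by
  generalize hl : Γ'.flat.length = n
  induction n generalizing Γ Γ' with
  | zero =>
    obtain ⟨u', hu'⟩ := StringDiagram.exists_trivial (ob := ob) (List.length_eq_zero_iff.1 hl)
    obtain ⟨u, hu, e⟩ := h.exists_trivial hu'
    obtain ⟨w, hw, e'⟩ := h'.exists_trivial hu'
    have := hu'.isIso
    rw [← cancel_mono u', e, e', hu.unique hw]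
  | succ n ih =>
    obtain ⟨a, ha⟩ : ∃ a, a ∈ Γ'.flat := List.exists_mem_of_length_pos (by omega)
    obtain ⟨R', θ', t'⟩ := Extract.exists_of_mem (ob := ob) ha
    obtain ⟨R, θ, φ', t, c, e⟩ := h.exists_extract t'
    obtain ⟨R2, θ2, ψ', t2, c2, e2⟩ := h'.exists_extract t'
    -- Both pulled-back extractions of `a` from `Γ` coincide, so only the coherence isomorphisms of
    -- the remainders, with one wire less, are left to compare.
    obtain ⟨rfl, e3⟩ := t.unique hn t2
    cases e3
    have hn' : R.flat.Nodup := (List.nodup_cons.1 ((t.flat_perm.nodup_iff).1 hn)).2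
    have hl' : R'.flat.length = n := by
      have := t'.flat_perm.length_eq
      simp only [List.length_cons] at this
      omega
    have := t'.isIso
    rw [← cancel_mono θ', e, e2, ih hn' c c2 hl']

end Coh
end StringDiagram

/-! ### Programs on named wires and the morphisms they compute -/

namespace StringDiagram
open Wires

variable {κ : Type}

namespace Wires

/-- Rename the wires, keeping their sorts. -/
def map (σ : ℕ → ℕ) : Wires κ → Wires κ
  | leaf a => leaf (a.1, σ a.2)
  | unit => unit
  | tensor Γ Λ => tensor (Γ.map σ) (Λ.map σ)

/-- Rename a list of wires. -/
abbrev mapList (σ : ℕ → ℕ) (l : List (κ × ℕ)) : List (κ × ℕ) := l.map fun a => (a.1, σ a.2)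

theorem flat_map (σ : ℕ → ℕ) : (Γ : Wires κ) → (Γ.map σ).flat = mapList σ Γ.flat
  | leaf _ => rfl
  | unit => rfl
  | tensor Γ Λ => by simp [map, flat, flat_map σ Γ, flat_map σ Λ]

end Wires

variable {C : Type u} [Category.{v} C] [MonoidalCategory C] (ob : κ → C)

/-- Renaming does not change the object. -/
def renameIso (σ : ℕ → ℕ) : (Γ : Wires κ) → ((Γ.map σ).obj ob ≅ Γ.obj ob)
  | .leaf _ => Iso.refl _
  | .unit => Iso.refl _
  | .tensor Γ Λ => renameIso σ Γ ⊗ᵢ renameIso σ Λ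

theorem map_eq_self {σ : ℕ → ℕ} {Γ : Wires κ} (h : ∀ a ∈ Γ.flat, σ a.2 = a.2) :
    Γ.map σ = Γ := by
  induction Γ with
  | leaf a => simp [Wires.map, h a (by simp [flat])]
  | unit => rfl
  | tensor Γ Λ h1 h2 =>
    rw [Wires.map, h1 fun a ha => h a (by simp [flat, ha]), h2 fun a ha => h a (by simp [flat, ha])]

theorem renameIso_eq_eqToHom {σ : ℕ → ℕ} {Γ : Wires κ} (h : Γ.map σ = Γ) :
    (renameIso ob σ Γ).hom = eqToHom (by rw [h]) := by
  induction Γ with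
  | leaf a => rfl
  | unit => rfl
  | tensor Γ Λ h1 h2 =>
    have key : ∀ {X X' Y Y' : C} (e : X = X') (e' : Y = Y') (e'' : X ⊗ Y = X' ⊗ Y'),
        (eqToHom e ⊗ₘ eqToHom e') = eqToHom e'' := by
      rintro _ _ _ _ rfl rfl _
      simp
    simp only [Wires.map, Wires.tensor.injEq] at h
    rw [renameIso, tensorIso_hom, h1 h.1, h2 h.2]
    exact key _ _ _

/-- A morphism with named inputs and outputs. -/
structure Box where
  ins : Wires κ
  outs : Wires κ
  hom : ins.obj ob ⟶ outs.obj ob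

/-- Rename the inputs and outputs of a box. -/
def Box.map (σ : ℕ → ℕ) (b : Box ob) : Box ob where
  ins := b.ins.map σ
  outs := b.outs.map σ
  hom := (renameIso ob σ b.ins).hom ≫ b.hom ≫ (renameIso ob σ b.outs).inv

/-- A syntax of operations, with the lists of their input and output wires. -/
class Signature (κ : outParam Type) (Op : Type) where
  ins : Op → List (κ × ℕ)
  outs : Op → List (κ × ℕ)
  /-- If the operation only renames a wire, its sort, its old name and its new name. -/
  wire : Op → Option (κ × ℕ × ℕ)
  map : (ℕ → ℕ) → Op → Op

/-- An interpretation of the operations as morphisms of a monoidal category. -/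
structure Model (Op : Type) [Signature κ Op] where
  box : Op → Box ob
  ins_flat (s : Op) : (box s).ins.flat = Signature.ins s
  outs_flat (s : Op) : (box s).outs.flat = Signature.outs s
  box_map (σ : ℕ → ℕ) (s : Op) : box (Signature.map σ s) = (box s).map ob σ
  box_wire {s : Op} {k : κ} {x y : ℕ} (h : Signature.wire s = some (k, x, y)) :
    box s = ⟨.leaf (k, x), .leaf (k, y), 𝟙 (ob k)⟩

variable {ob} {Op : Type} [Signature κ Op] [SymmetricCategory C] (M : Model ob Op)

/-- `Denotes M Γ P Γ' φ`: the program `P`, run on the wires `Γ`, ends with the wires `Γ'`, and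
`φ` is the morphism that it computes. -/
inductive Denotes : (Γ : Wires κ) → List Op → (Γ' : Wires κ) → (Γ.obj ob ⟶ Γ'.obj ob) → Prop
  | nil {Γ Γ' φ} : Coh ob Γ Γ' φ → Denotes Γ [] Γ' φ
  | cons {Γ Γ' P} (s : Op) (r : Wires κ) {φ : Γ.obj ob ⟶ (M.box s).ins.obj ob ⊗ r.obj ob}
      {ψ : (M.box s).outs.obj ob ⊗ r.obj ob ⟶ Γ'.obj ob} : Coh ob Γ (.tensor (M.box s).ins r) φ →
      Denotes (.tensor (M.box s).outs r) P Γ' ψ →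
      Denotes Γ (s :: P) Γ' (φ ≫ (M.box s).hom ▷ r.obj ob ≫ ψ)

variable {M}

/-- The symmetry of the first two of three factors. -/
def exchangeHom (X Y Z : C) : X ⊗ (Y ⊗ Z) ⟶ Y ⊗ (X ⊗ Z) :=
  (α_ X Y Z).inv ≫ (β_ X Y).hom ▷ Z ≫ (α_ Y X Z).hom

namespace Coh

theorem ofList_append : (l l' : List (κ × ℕ)) →
    ∃ φ, Coh ob (tensor (ofList l) (ofList l')) (ofList (l ++ l')) φ
  | [], l' => ⟨_, .left_hom _⟩
  | a :: l, l' => by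
    obtain ⟨φ, h⟩ := ofList_append l l'
    exact ⟨_, (Coh.assoc_hom _ _ _).comp (.whiskerLeft _ h)⟩

theorem to_ofList : (Γ : Wires κ) → ∃ φ, Coh ob Γ (ofList Γ.flat) φ
  | .leaf _ => ⟨_, .right_inv _⟩
  | .unit => ⟨_, .id _⟩
  | .tensor Γ Λ => by
    obtain ⟨φ, h⟩ := to_ofList Γ
    obtain ⟨ψ, h'⟩ := to_ofList Λ
    obtain ⟨τ, h''⟩ := ofList_append (ob := ob) Γ.flat Λ.flat
    exact ⟨_, ((h.whiskerRight _).comp (h'.whiskerLeft _)).comp h''⟩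

theorem exchange (x y z : Wires κ) : Coh ob (tensor x (tensor y z)) (tensor y (tensor x z))
    (exchangeHom (x.obj ob) (y.obj ob) (z.obj ob)) :=
  (Coh.assoc_inv _ _ _).comp (((Coh.braid _ _).whiskerRight _).comp (.assoc_hom _ _ _))

theorem of_list_perm {l l' : List (κ × ℕ)} (h : l.Perm l') :
    ∃ φ, Coh ob (ofList l) (ofList l') φ := by
  induction h with
  | nil => exact ⟨_, .id _⟩
  | cons a _ ih => obtain ⟨φ, h⟩ := ih; exact ⟨_, h.whiskerLeft (.leaf a)⟩
  | swap a b l => exact ⟨_, exchange (.leaf b) (.leaf a) (ofList l)⟩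
  | trans _ _ h1 h2 =>
    obtain ⟨φ, h1⟩ := h1
    obtain ⟨ψ, h2⟩ := h2
    exact ⟨_, h1.comp h2⟩

theorem of_perm {Γ Γ' : Wires κ} (h : Γ.flat.Perm Γ'.flat) : ∃ φ, Coh ob Γ Γ' φ := by
  obtain ⟨φ, h1⟩ := to_ofList (ob := ob) Γ
  obtain ⟨ψ, h2⟩ := of_list_perm (ob := ob) h
  obtain ⟨τ, h3⟩ := to_ofList (ob := ob) Γ'
  obtain ⟨τ', h4, -⟩ := h3.exists_inv
  exact ⟨_, h1.comp (h2.comp h4)⟩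

theorem of_eq {Γ Γ' : Wires κ} {φ ψ} (h : Coh ob Γ Γ' φ) (e : ψ = φ) : Coh ob Γ Γ' ψ := e ▸ h

theorem rename (σ : ℕ → ℕ) {Γ Γ' : Wires κ} {φ} (h : Coh ob Γ Γ' φ) :
    Coh ob (Γ.map σ) (Γ'.map σ) ((renameIso ob σ Γ).hom ≫ φ ≫ (renameIso ob σ Γ').inv) := by
  induction h with
  | id => exact (Coh.id _).of_eq (by simp)
  | comp _ _ h1 h2 => exact (h1.comp h2).of_eq (by simp)
  | whiskerLeft x _ h =>
    refine (h.whiskerLeft (x.map σ)).of_eq ?_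
    dsimp only [obj, renameIso, Wires.map]
    simp [MonoidalCategory.tensorHom_def]
    simp [← whisker_exchange_assoc]
  | whiskerRight x _ h =>
    refine (h.whiskerRight (x.map σ)).of_eq ?_
    dsimp only [obj, renameIso, Wires.map]
    simp [MonoidalCategory.tensorHom_def']
    simp [whisker_exchange_assoc]
  | assoc_hom x y z =>
    refine (Coh.assoc_hom (x.map σ) (y.map σ) (z.map σ)).of_eq ?_
    dsimp only [obj, renameIso, Wires.map]
    simp
  | assoc_inv x y z =>
    refine (Coh.assoc_inv (x.map σ) (y.map σ) (z.map σ)).of_eq ?_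
    dsimp only [obj, renameIso, Wires.map]
    simp
  | left_hom x =>
    refine (Coh.left_hom (x.map σ)).of_eq ?_
    dsimp only [obj, renameIso, Wires.map]
    simp
  | left_inv x =>
    refine (Coh.left_inv (x.map σ)).of_eq ?_
    dsimp only [obj, renameIso, Wires.map]
    simp
  | right_hom x =>
    refine (Coh.right_hom (x.map σ)).of_eq ?_
    dsimp only [obj, renameIso, Wires.map]
    simp
  | right_inv x =>
    refine (Coh.right_inv (x.map σ)).of_eq ?_
    dsimp only [obj, renameIso, Wires.map]
    simp
  | braid x y =>
    refine (Coh.braid (x.map σ) (y.map σ)).of_eq ?_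
    dsimp only [obj, renameIso, Wires.map]
    simp

end Coh

section Exchange

variable (X Y : C) {X' Y' : C} (Z : C)

theorem exchangeHom_naturality_fst (f : X ⟶ X') :
    f ▷ (Y ⊗ Z) ≫ exchangeHom X' Y Z = exchangeHom X Y Z ≫ Y ◁ f ▷ Z := by
  rw [exchangeHom, associator_inv_naturality_left_assoc, ← comp_whiskerRight_assoc,
    BraidedCategory.braiding_naturality_left]
  simp [exchangeHom]

theorem exchangeHom_naturality_snd (g : Y ⟶ Y') :
    exchangeHom X Y Z ≫ g ▷ (X ⊗ Z) = X ◁ g ▷ Z ≫ exchangeHom X Y' Z := by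
  rw [exchangeHom, exchangeHom, associator_inv_naturality_middle_assoc,
    ← comp_whiskerRight_assoc, BraidedCategory.braiding_naturality_right]
  simp

theorem exchangeHom_exchangeHom : exchangeHom X Y Z ≫ exchangeHom Y X Z = 𝟙 _ := by
  simp [exchangeHom, ← comp_whiskerRight_assoc]

-- The interchange law for two operations on disjoint wires, together with the permutations around
-- them. It is why independent operations may be reordered.
variable {X Y Z} in
theorem exchangeHom_slide {W V R U : C} (φ : W ⟶ X ⊗ V) (f : X ⟶ X') (g : Y ⟶ Y')
    (τ : V ⟶ Y ⊗ R) (κ : X' ⊗ R ⟶ U) (ψ : Y' ⊗ U ⟶ Z) :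
    φ ≫ f ▷ V ≫ (X' ◁ τ ≫ exchangeHom X' Y R ≫ Y ◁ κ) ≫ g ▷ U ≫ ψ =
      (φ ≫ X ◁ τ ≫ exchangeHom X Y R) ≫ g ▷ (X ⊗ R) ≫ exchangeHom Y' X R ≫ f ▷ (Y' ⊗ R) ≫
        (exchangeHom X' Y' R ≫ Y' ◁ κ) ≫ ψ := by
  have h1 : f ▷ V ≫ X' ◁ τ = X ◁ τ ≫ f ▷ (Y ⊗ R) := (whisker_exchange _ _).symm
  have h2 : Y ◁ κ ≫ g ▷ U = g ▷ (X' ⊗ R) ≫ Y' ◁ κ := whisker_exchange _ _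
  simp only [Category.assoc]
  rw [reassoc_of% h1, reassoc_of% h2, reassoc_of% (@exchangeHom_naturality_fst C _ _ _),
    reassoc_of% (@exchangeHom_naturality_snd C _ _ _),
    reassoc_of% (@exchangeHom_exchangeHom C _ _ _),
    reassoc_of% (@exchangeHom_naturality_fst C _ _ _),
    ← reassoc_of% (@exchangeHom_naturality_snd C _ _ _), whisker_exchange_assoc]

end Exchange

namespace Denotes

theorem of_eq {Γ Γ' : Wires κ} {P : List Op} {φ ψ} (h : Denotes M Γ P Γ' φ) (e : ψ = φ) :
    Denotes M Γ P Γ' ψ := e ▸ h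

theorem coh_comp {Γ Γ' Γ'' : Wires κ} {P : List Op} {φ ψ} (h : Coh ob Γ Γ' φ)
    (h' : Denotes M Γ' P Γ'' ψ) : Denotes M Γ P Γ'' (φ ≫ ψ) := by
  cases h' with
  | nil h' => exact .nil (h.comp h')
  | cons s r h1 h2 => exact (Denotes.cons s r (h.comp h1) h2).of_eq (Category.assoc _ _ _).symm

theorem comp {Γ Γ' Γ'' : Wires κ} {P Q : List Op} {φ ψ} (h : Denotes M Γ P Γ' φ)
    (h' : Denotes M Γ' Q Γ'' ψ) : Denotes M Γ (P ++ Q) Γ'' (φ ≫ ψ) := by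
  induction h with
  | nil h => exact coh_comp h h'
  | cons s r h1 h2 ih =>
    exact (Denotes.cons s r h1 (ih h')).of_eq (by dsimp only [obj]; simp)

theorem op (s : Op) : Denotes M (M.box s).ins [s] (M.box s).outs (M.box s).hom :=
  (Denotes.cons s .unit (.right_inv _) (.nil (.right_hom _))).of_eq (by dsimp only [obj]; simp)

theorem whiskerRight {Γ Γ' : Wires κ} {P : List Op} {φ} (x : Wires κ) (h : Denotes M Γ P Γ' φ) :
    Denotes M (tensor Γ x) P (tensor Γ' x) (φ ▷ x.obj ob) := by
  induction h with
  | nil h => exact .nil (h.whiskerRight _)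
  | cons s r h1 h2 ih =>
    exact (Denotes.cons s (.tensor r x) ((h1.whiskerRight x).comp (.assoc_hom _ _ _))
      (coh_comp (.assoc_inv _ _ _) ih)).of_eq (by dsimp only [obj]; simp)

/-- `Denotes.cons` keeps the idle wires on the right; conjugating by the braiding moves them to the
left. -/
theorem whiskerLeft {Γ Γ' : Wires κ} {P : List Op} {φ} (x : Wires κ) (h : Denotes M Γ P Γ' φ) :
    Denotes M (tensor x Γ) P (tensor x Γ') (x.obj ob ◁ φ) := by
  have := coh_comp (.braid _ _) ((h.whiskerRight x).comp (.nil (.braid _ _)))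
  rw [List.append_nil] at this
  exact this.of_eq (by dsimp only [obj]; simp)

theorem rename (σ : ℕ → ℕ) {Γ Γ' : Wires κ} {P : List Op} {φ} (h : Denotes M Γ P Γ' φ) :
    Denotes M (Γ.map σ) (P.map (Signature.map σ)) (Γ'.map σ)
      ((renameIso ob σ Γ).hom ≫ φ ≫ (renameIso ob σ Γ').inv) := by
  induction h with
  | nil h => exact .nil (h.rename σ)
  | cons s r h1 h2 ih =>
    -- The types of the adjacent morphisms depend on the box, so `box_map` is applied through a
    -- variable `b`.
    have key : ∀ {b : Box ob} (_ : M.box (Signature.map σ s) = b) {Γ Γ' : Wires κ} {P φ ψ},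
        Coh ob Γ (.tensor b.ins (r.map σ)) φ → Denotes M (.tensor b.outs (r.map σ)) P Γ' ψ →
        Denotes M Γ (Signature.map σ s :: P) Γ' (φ ≫ b.hom ▷ (r.map σ).obj ob ≫ ψ) := by
      rintro _ rfl _ _ _ _ _ h h'
      exact .cons _ _ h h'
    refine (key (M.box_map σ s) (h1.rename σ) ih).of_eq ?_
    dsimp only [obj, renameIso, Wires.map, Box.map]
    simp [MonoidalCategory.tensorHom_def, ← whisker_exchange_assoc]

/-- Names do not affect objects, so `ψ` itself survives the renaming, provided all other wires at
both ends are fixed by `σ`. This lets an identity operation be deleted by renaming what follows it;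
`rename_snd` renames what precedes it. -/
theorem rename_fst {k : κ} {x y : ℕ} {R Γ' : Wires κ} {P : List Op}
    {ψ : ob k ⊗ R.obj ob ⟶ Γ'.obj ob} (h : Denotes M (tensor (.leaf (k, y)) R) P Γ' ψ)
    {σ : ℕ → ℕ} (hy : σ y = x) (hR : ∀ a ∈ R.flat, σ a.2 = a.2)
    (hΓ : ∀ a ∈ Γ'.flat, σ a.2 = a.2) :
    Denotes M (tensor (.leaf (k, x)) R) (P.map (Signature.map σ)) Γ' ψ := by
  subst hy
  have key : ∀ {R1 R2 : Wires κ} (_ : R1 = R) (_ : R2 = Γ') {a b}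
      (_ : Denotes M (tensor (.leaf (k, σ y)) R1) (P.map (Signature.map σ)) R2
        ((𝟙 (ob k) ⊗ₘ a) ≫ ψ ≫ b)) (e e') (_ : a = eqToHom e) (_ : b = eqToHom e'),
      Denotes M (tensor (.leaf (k, σ y)) R) (P.map (Signature.map σ)) Γ' ψ := by
    rintro _ _ rfl rfl a b h _ _ rfl rfl
    refine h.of_eq ?_
    dsimp only [obj]
    simp
  refine key (map_eq_self hR) (map_eq_self hΓ) (h.rename σ) (by rw [map_eq_self hR])
    (by rw [map_eq_self hΓ]) (renameIso_eq_eqToHom ob (map_eq_self hR)) ?_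
  rw [← cancel_epi (renameIso ob σ Γ').hom, Iso.hom_inv_id,
    renameIso_eq_eqToHom ob (map_eq_self hΓ)]
  simp

theorem rename_snd {k : κ} {x y : ℕ} {R Γ : Wires κ} {P : List Op}
    {ψ : Γ.obj ob ⟶ ob k ⊗ R.obj ob} (h : Denotes M Γ P (tensor (.leaf (k, x)) R) ψ)
    {σ : ℕ → ℕ} (hy : σ x = y) (hR : ∀ a ∈ R.flat, σ a.2 = a.2)
    (hΓ : ∀ a ∈ Γ.flat, σ a.2 = a.2) :
    Denotes M Γ (P.map (Signature.map σ)) (tensor (.leaf (k, y)) R) ψ := by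
  subst hy
  have key : ∀ {R1 R2 : Wires κ} (_ : R1 = R) (_ : R2 = Γ) {a b}
      (_ : Denotes M R2 (P.map (Signature.map σ)) (tensor (.leaf (k, σ x)) R1)
        (b ≫ ψ ≫ (𝟙 (ob k) ⊗ₘ a))) (e e') (_ : a = eqToHom e) (_ : b = eqToHom e'),
      Denotes M Γ (P.map (Signature.map σ)) (tensor (.leaf (k, σ x)) R) ψ := by
    rintro _ _ rfl rfl a b h _ _ rfl rfl
    refine h.of_eq ?_
    dsimp only [obj]
    simp
  refine key (map_eq_self hR) (map_eq_self hΓ) (h.rename σ) (by rw [map_eq_self hR])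
    (by rw [map_eq_self hΓ]) ?_ (renameIso_eq_eqToHom ob (map_eq_self hΓ))
  rw [← cancel_epi (renameIso ob σ R).hom, Iso.hom_inv_id,
    renameIso_eq_eqToHom ob (map_eq_self hR)]
  simp

/-- The wires that an operation needs are available when its turn comes. -/
theorem ins_subset {Γ Γ' : Wires κ} {P Q : List Op} {s : Op} {φ}
    (h : Denotes M Γ (P ++ s :: Q) Γ' φ) :
    Signature.ins s ⊆ Γ.flat ++ P.flatMap Signature.outs := by
  induction P generalizing Γ with
  | nil =>
    cases h with
    | cons _ r h1 h2 =>
      intro x hx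
      have := h1.flat_perm.symm.subset
      simp only [flat, M.ins_flat] at this
      simpa using this (by simp [hx])
  | cons t P ih =>
    cases h with
    | cons _ r h1 h2 =>
      intro x hx
      have h3 := ih h2 hx
      have := h1.flat_perm.symm.subset
      simp only [flat, M.ins_flat, M.outs_flat] at this h3
      simp only [List.mem_append, List.flatMap_cons] at h3 ⊢
      rcases h3 with (h3 | h3) | h3
      · tauto
      · exact .inl (this (by simp [h3]))
      · tauto

end Denotes

/-- All wires that occur in the program `P`, run on the wires `Γ`, have different names. -/
def SSA (Γ : List (κ × ℕ)) (P : List Op) : Prop := (Γ ++ P.flatMap Signature.outs).Nodup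

namespace Denotes

/-- An operation whose inputs are available can be done first. -/
theorem move_front {Γ Γ' : Wires κ} {P Q : List Op} {s : Op} {φ}
    (h : Denotes M Γ (P ++ s :: Q) Γ' φ) (hs : Signature.ins s ⊆ Γ.flat)
    (hn : SSA Γ.flat (P ++ s :: Q)) : Denotes M Γ (s :: (P ++ Q)) Γ' φ := by
  induction P generalizing Γ φ with
  | nil => exact h
  | cons t P ih =>
    cases h with
    | cons _ r h1 h2 =>
    rename_i φ ψ
    have p1 := h1.flat_perm
    simp only [flat, M.ins_flat] at p1
    simp only [SSA, List.cons_append, List.flatMap_cons] at hn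
    have hd : ∀ x ∈ Γ.flat, x ∉ Signature.outs t ++ (P ++ s :: Q).flatMap Signature.outs :=
      fun x h h' => (List.nodup_append.1 hn).2.2 x h x h' rfl
    have hn2 : SSA (Signature.outs t ++ r.flat) (P ++ s :: Q) := by
      have := ((p1.append_right _).nodup_iff).1 hn
      rw [List.append_assoc] at this
      rw [SSA, List.append_assoc]
      refine ((List.perm_append_comm_assoc _ _ _).nodup_iff).1 (List.nodup_append.1 this).2.1
    have sub : Signature.ins s ⊆ Signature.outs t ++ r.flat := by
      intro x hx
      have := ins_subset h2 hx
      simp only [flat, M.outs_flat] at this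
      rcases List.mem_append.1 this with h | h
      · exact h
      · exact absurd (by simp [h]) (hd x (hs hx))
    have ih' := ih h2 (by simpa [flat, M.outs_flat] using sub)
      (by simpa [flat, M.outs_flat] using hn2)
    cases ih' with
    | cons _ r2 c2 d2 =>
    have p2 := c2.flat_perm
    simp only [flat, M.ins_flat, M.outs_flat] at p2
    have n2 : (Signature.outs t ++ r.flat).Nodup := (List.nodup_append.1 hn2).1
    -- The outputs of `t` are new names while the inputs of `s` already occur in `Γ`; hence `s` uses
    -- none of the outputs of `t`.
    have sub' : Signature.ins s ⊆ r.flat := by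
      intro x hx
      rcases List.mem_append.1 (sub hx) with h | h
      · exact absurd (by simp [h]) (hd x (hs hx))
      · exact h
    have ns : (Signature.ins s).Nodup := (List.nodup_append.1 ((p2.nodup_iff).1 n2)).1
    obtain ⟨l, hl⟩ : ∃ l, r.flat.Perm (Signature.ins s ++ l) := by
      obtain ⟨l', h, h'⟩ := List.subperm_iff.1 (ns.subperm sub')
      obtain ⟨l, hl⟩ := h'.exists_perm_append
      exact ⟨l, h.symm.trans hl⟩
    obtain ⟨τ, hτ⟩ := Coh.of_perm (ob := ob) (Γ := r) (Γ' := tensor (M.box s).ins (ofList l))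
      (by simpa [flat, M.ins_flat] using hl)
    obtain ⟨k, hk⟩ := Coh.of_perm (ob := ob) (Γ := tensor (M.box t).outs (ofList l)) (Γ' := r2) (by
      simp only [flat, M.outs_flat, flat_ofList]
      refine (List.perm_append_left_iff (Signature.ins s)).1 ?_
      exact (List.perm_append_comm_assoc _ _ _).trans ((hl.symm.append_left _).trans p2))
    -- By coherence the permutation between `t` and `s` may be taken in the form that
    -- `exchangeHom_slide` requires.
    have e := Coh.unique (by simpa [flat, M.outs_flat] using n2) c2
      ((hτ.whiskerLeft _).comp ((Coh.exchange _ _ _).comp (hk.whiskerLeft _)))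
    subst e
    exact (Denotes.cons s _ (h1.comp ((hτ.whiskerLeft _).comp (Coh.exchange _ _ _)))
      (Denotes.cons t _ (Coh.exchange _ _ _)
        (coh_comp ((Coh.exchange _ _ _).comp (hk.whiskerLeft _)) d2))).of_eq
      (exchangeHom_slide _ _ _ _ _ _)

/-- A program denotes at most one morphism, and the order of its operations does not matter. -/
theorem unique {Γ Γ' : Wires κ} {P Q : List Op} {φ ψ} (hn : SSA Γ.flat P) (hPQ : P.Perm Q)
    (h : Denotes M Γ P Γ' φ) (h' : Denotes M Γ Q Γ' ψ) : φ = ψ := by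
  induction P generalizing Γ Q with
  | nil =>
    obtain rfl := List.nil_perm.1 hPQ
    cases h with
    | nil h =>
    cases h' with
    | nil h' => exact Coh.unique (by simpa [SSA] using hn) h h'
  | cons s P ih =>
    -- The first operation `s` of one program occurs somewhere in the other. Its inputs are
    -- available on `Γ`, so it can be brought to the front there, and the tails are compared by
    -- induction.
    obtain ⟨Q1, Q2, rfl⟩ := List.append_of_mem (hPQ.subset List.mem_cons_self)
    have hQ : (s :: P).Perm (s :: (Q1 ++ Q2)) := hPQ.trans List.perm_middle
    cases h with
    | cons _ r h1 h2 =>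
    rename_i π ψ'
    have p1 := h1.flat_perm
    simp only [flat, M.ins_flat] at p1
    have hs : Signature.ins s ⊆ Γ.flat := fun x hx => p1.symm.subset (by simp [hx])
    have hn' : SSA Γ.flat (Q1 ++ s :: Q2) :=
      (((hPQ.flatMap_right Signature.outs).append_left _).nodup_iff).1 hn
    have h3 := move_front h' hs hn'
    cases h3 with
    | cons _ r' h1' h2' =>
    have p1' := h1'.flat_perm
    simp only [flat, M.ins_flat] at p1'
    have pr : r.flat.Perm r'.flat :=
      (List.perm_append_left_iff (Signature.ins s)).1 (p1.symm.trans p1')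
    obtain ⟨τ, hτ⟩ := Coh.of_perm (ob := ob) pr
    have e := Coh.unique (List.nodup_append.1 hn).1 (h1.comp (hτ.whiskerLeft _)) h1'
    subst e
    have hn2 : SSA (flat (tensor (M.box s).outs r)) P := by
      simp only [SSA, List.flatMap_cons] at hn
      simp only [flat, M.outs_flat, SSA]
      have := ((p1.append_right _).nodup_iff).1 hn
      rw [List.append_assoc] at this
      rw [List.append_assoc]
      exact ((List.perm_append_comm_assoc _ _ _).nodup_iff).1 (List.nodup_append.1 this).2.1
    have e2 := ih hn2 hQ.cons_inv h2 (coh_comp (hτ.whiskerLeft _) h2')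
    subst e2
    dsimp only [obj]
    rw [Category.assoc, whisker_exchange_assoc]

end Denotes

end StringDiagram

/-! ### Rewriting of programs and its soundness -/

namespace StringDiagram
open Wires

section Rewriting

/-- A rewriting rule between two programs with the same inputs and outputs. -/
structure Rule (κ Op : Type) where
  dom : List (κ × ℕ)
  lhs : List Op
  rhs : List Op
  cod : List (κ × ℕ)

variable {κ : Type} {Op : Type} [Signature κ Op]

/-- The reversed rule. -/
def Rule.symm (r : Rule κ Op) : Rule κ Op where
  dom := r.dom
  lhs := r.rhs
  rhs := r.lhs
  cod := r.cod

/-- The substitution of names given by a list. -/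
def subst (l : List ℕ) (n : ℕ) : ℕ := l.getD n n

variable [DecidableEq κ] [DecidableEq Op]

/-- The wires that remain after running a program, if each operation finds its inputs. -/
def run : List (κ × ℕ) → List Op → Option (List (κ × ℕ))
  | Γ, [] => some Γ
  | Γ, s :: P =>
    bif Γ.isPerm (Signature.ins s ++ Γ.diff (Signature.ins s)) then
      run (Signature.outs s ++ Γ.diff (Signature.ins s)) P
    else none

/-- Split a program into the operations that can be run on the wires `Γ` and the others. -/
def split : List (κ × ℕ) → List Op → List Op × List Op
  | _, [] => ([], [])
  | Γ, s :: P =>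
    bif (Signature.ins s).all Γ.contains then
      let q := split (Signature.outs s ++ Γ.diff (Signature.ins s)) P
      (s :: q.1, q.2)
    else
      let q := split Γ P
      (q.1, s :: q.2)

/-- Whether all names are different. -/
def distinct : List (κ × ℕ) → Bool
  | [] => true
  | a :: l => !l.contains a && distinct l

/-- Whether running `P` on `Γ` ends with `Γ'`. -/
def runsTo (Γ : List (κ × ℕ)) (P : List Op) (Γ' : List (κ × ℕ)) : Bool :=
  match run Γ P with
  | some l => l.isPerm Γ'
  | none => false

/-- Apply a rule with the given names to the program `P` with inputs `Γ` and outputs `Γ'`. -/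
def applyRule (Γ Γ' : List (κ × ℕ)) (P : List Op) (r : Rule κ Op) (σ : List ℕ) :
    Option (List Op) :=
  let L := r.lhs.map (Signature.map (subst σ))
  -- Outside the occurrence of the left hand side, whatever can run without it goes before it and
  -- the rest after it.
  let q := split Γ (P.diff L)
  match run Γ q.1 with
  | none => none
  | some l =>
    let R := l.diff (mapList (subst σ) r.dom)
    bif P.isPerm (q.1 ++ (L ++ q.2)) && distinct (Γ ++ P.flatMap Signature.outs) &&
        l.isPerm (mapList (subst σ) r.dom ++ R) &&
        runsTo (mapList (subst σ) r.cod ++ R) q.2 Γ' then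
      some (q.1 ++ (r.rhs.map (Signature.map (subst σ)) ++ q.2))
    else none

/-- Remove the first renaming of a wire from a program with inputs `Γ` and outputs `Γ'`. -/
def absorb (Γ Γ' : List (κ × ℕ)) (pre : List Op) : List Op → List Op
  | [] => pre
  | s :: post =>
    match Signature.wire s with
    | none => absorb Γ Γ' (pre ++ [s]) post
    | some (k, x, y) =>
      match run Γ pre with
      | none => pre ++ s :: post
      | some l =>
        let R := l.erase (k, x)
        bif l.isPerm ((k, x) :: R) && runsTo ((k, y) :: R) post Γ' &&
            distinct (Γ ++ (pre ++ s :: post).flatMap Signature.outs) then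
          -- The two names are identified downstream if `y` is not a name at the end of the program,
          -- and otherwise upstream if `x` is not a name at its beginning; names on the interface
          -- must stay.
          bif R.all (fun a => a.2 != y) && Γ'.all (fun a => a.2 != y) then
            pre ++ post.map (Signature.map fun n => bif n == y then x else n)
          else bif R.all (fun a => a.2 != x) && Γ.all (fun a => a.2 != x) then
            pre.map (Signature.map fun n => bif n == x then y else n) ++ post
          else pre ++ s :: post
        else pre ++ s :: post

/-- Apply a list of rules. -/
def applyRules (Γ Γ' : List (κ × ℕ)) : List Op → List (Rule κ Op × List ℕ) → Option (List Op)
  | P, [] => some P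
  | P, s :: l =>
    match applyRule Γ Γ' P s.1 s.2 with
    | some Q => applyRules Γ Γ' (absorb Γ Γ' [] Q) l
    | none => none

/-- Whether the given steps lead from the left hand side of a rule to its right hand side. -/
def Rule.check (r : Rule κ Op) (l : List (Rule κ Op × List ℕ)) : Bool :=
  match applyRules r.dom r.cod r.lhs l with
  | some P => P.isPerm r.rhs && distinct (r.dom ++ P.flatMap Signature.outs) &&
      runsTo r.dom r.lhs r.cod && runsTo r.dom r.rhs r.cod
  | none => false

theorem nodup_of_distinct {l : List (κ × ℕ)} (h : distinct l = true) : l.Nodup := by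
  induction l with
  | nil => exact List.nodup_nil
  | cons a l ih =>
    simp only [distinct, Bool.and_eq_true, Bool.not_eq_true', List.contains_eq_mem,
      decide_eq_false_iff_not] at h
    exact List.nodup_cons.2 ⟨h.1, ih h.2⟩

variable {C : Type u} [Category.{v} C] [MonoidalCategory C] [SymmetricCategory C] {ob : κ → C}
  (M : Model ob Op)

/-- The two sides of a rule denote the same morphism. -/
def Rule.Holds (r : Rule κ Op) : Prop :=
  ∃ φ, Denotes M (ofList r.dom) r.lhs (ofList r.cod) φ ∧
    Denotes M (ofList r.dom) r.rhs (ofList r.cod) φ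

variable {M}

omit [DecidableEq κ] [DecidableEq Op] in
@[simp]
theorem Rule.holds_symm {r : Rule κ Op} : r.symm.Holds M ↔ r.Holds M :=
  ⟨fun ⟨φ, h, h'⟩ => ⟨φ, h', h⟩, fun ⟨φ, h, h'⟩ => ⟨φ, h', h⟩⟩

-- A successful run on names suffices to produce a morphism, since each permutation of wires met on
-- the way is realized by a coherence isomorphism.
omit [DecidableEq Op] in
theorem exists_denotes_of_run {Γ : Wires κ} {P : List Op} {l : List (κ × ℕ)}
    (h : run Γ.flat P = some l) : ∃ φ, Denotes M Γ P (ofList l) φ := by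
  induction P generalizing Γ with
  | nil =>
    simp only [run, Option.some.injEq] at h
    obtain ⟨φ, h⟩ := Coh.of_perm (ob := ob) (Γ := Γ) (Γ' := ofList l) (by simp [h])
    exact ⟨φ, .nil h⟩
  | cons s P ih =>
    simp only [run] at h
    cases hp : Γ.flat.isPerm (Signature.ins s ++ Γ.flat.diff (Signature.ins s)) with
    | false => simp [hp] at h
    | true =>
      rw [hp, cond_true] at h
      obtain ⟨φ, hφ⟩ := Coh.of_perm (ob := ob) (Γ := Γ)
        (Γ' := tensor (M.box s).ins (ofList (Γ.flat.diff (Signature.ins s))))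
        (by simpa [flat, M.ins_flat] using List.isPerm_iff.1 hp)
      obtain ⟨ψ, hψ⟩ := ih (Γ := tensor (M.box s).outs (ofList (Γ.flat.diff (Signature.ins s))))
        (by simpa [flat, M.outs_flat] using h)
      exact ⟨_, .cons s _ hφ hψ⟩

omit [DecidableEq Op] in
theorem exists_denotes_of_runsTo {Γ Γ' : Wires κ} {P : List Op}
    (h : runsTo Γ.flat P Γ'.flat = true) : ∃ φ, Denotes M Γ P Γ' φ := by
  unfold runsTo at h
  split at h
  · rename_i l hl
    obtain ⟨φ, hφ⟩ := exists_denotes_of_run (M := M) hl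
    obtain ⟨ψ, hψ⟩ := Coh.of_perm (ob := ob) (Γ := ofList l) (Γ' := Γ')
      (by simpa using List.isPerm_iff.1 h)
    have := hφ.comp (.nil hψ)
    rw [List.append_nil] at this
    exact ⟨_, this⟩
  · simp at h

/-- Soundness of one step. By `Denotes.unique`, `P` computes the same morphism as its rearrangement
with the left hand side contiguous; there the rule, renamed and whiskered with the idle wires,
replaces one side by the other. -/
theorem Denotes.applyRule {Γ Γ' : Wires κ} {P Q : List Op} {φ} {r : Rule κ Op} {σ : List ℕ}
    (h : Denotes M Γ P Γ' φ) (hr : r.Holds M)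
    (hQ : StringDiagram.applyRule Γ.flat Γ'.flat P r σ = some Q) : Denotes M Γ Q Γ' φ := by
  unfold StringDiagram.applyRule at hQ
  extract_lets L q at hQ
  split at hQ
  · simp at hQ
  · rename_i l hl
    extract_lets R at hQ
    rw [cond_eq_ite] at hQ
    split_ifs at hQ with hc
    simp only [Bool.and_eq_true] at hc
    obtain ⟨⟨⟨h1, h2⟩, h3⟩, h4⟩ := hc
    simp only [Option.some.injEq] at hQ
    subst hQ
    obtain ⟨ψ, d1, d2⟩ := hr
    replace d1 := (d1.rename (subst σ)).whiskerRight (ofList R)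
    replace d2 := (d2.rename (subst σ)).whiskerRight (ofList R)
    obtain ⟨φ1, e1⟩ := exists_denotes_of_run (M := M) hl
    obtain ⟨φ2, e2⟩ := Coh.of_perm (ob := ob) (Γ := ofList l)
      (Γ' := tensor ((ofList r.dom).map (subst σ)) (ofList R))
      (by simpa [flat, flat_map] using List.isPerm_iff.1 h3)
    obtain ⟨φ3, e3⟩ := exists_denotes_of_runsTo (M := M) (P := q.2) (Γ' := Γ')
      (Γ := tensor ((ofList r.cod).map (subst σ)) (ofList R))
      (by simpa [flat, flat_map] using h4)
    have t1 := e1.comp ((d1.comp e3).coh_comp e2)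
    have t2 := e1.comp ((d2.comp e3).coh_comp e2)
    rw [Denotes.unique (nodup_of_distinct h2) (List.isPerm_iff.1 h1) h t1]
    exact t2

omit [DecidableEq Op] in
theorem Denotes.absorb {Γ Γ' : Wires κ} {pre P : List Op} {φ}
    (h : Denotes M Γ (pre ++ P) Γ' φ) :
    Denotes M Γ (StringDiagram.absorb Γ.flat Γ'.flat pre P) Γ' φ := by
  induction P generalizing pre with
  | nil => simpa [StringDiagram.absorb] using h
  | cons s post ih =>
    unfold StringDiagram.absorb
    split
    · exact ih (by simpa using h)
    · rename_i k x y hs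
      split
      · exact h
      · rename_i l hl
        extract_lets R
        rw [cond_eq_ite, cond_eq_ite, cond_eq_ite]
        split_ifs with hc h1 h2
        rotate_left 2
        · exact h
        · exact h
        all_goals
          simp only [Bool.and_eq_true] at hc
          obtain ⟨⟨c1, c2⟩, c3⟩ := hc
          obtain ⟨φ1, e1⟩ := exists_denotes_of_run (M := M) hl
          obtain ⟨φ2, e2⟩ := Coh.of_perm (ob := ob) (Γ := ofList l)
            (Γ' := tensor (.leaf (k, x)) (ofList R))
            (by simpa [flat] using List.isPerm_iff.1 c1)
          obtain ⟨φ3, e3⟩ := exists_denotes_of_runsTo (M := M) (P := post) (Γ' := Γ')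
            (Γ := tensor (.leaf (k, y)) (ofList R)) (by simpa [flat] using c2)
          have e12 := e1.comp (.nil e2)
          rw [List.append_nil] at e12
          have hw : Denotes M (tensor (.leaf (k, x)) (ofList R)) [s]
              (tensor (.leaf (k, y)) (ofList R)) (𝟙 (ob k ⊗ (ofList R).obj ob)) := by
            have key : ∀ b : Box ob, M.box s = b → Denotes M b.ins [s] b.outs b.hom := by
              rintro _ rfl
              exact Denotes.op s
            exact ((key _ (M.box_wire hs)).whiskerRight (ofList R)).of_eq
              (id_whiskerRight _ _).symm
          have t := e12.comp (hw.comp e3)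
          have e := Denotes.unique (nodup_of_distinct c3) (.refl _) h t
          subst e
        · simp only [Bool.and_eq_true, List.all_eq_true, bne_iff_ne] at h1
          have := e3.rename_fst (x := x) (σ := fun n => bif n == y then x else n) (by simp)
            (fun a ha => by
              have := h1.1 a (by simpa using ha)
              simp only [beq_eq_false_iff_ne.2 this, cond_false])
            (fun a ha => by simp only [beq_eq_false_iff_ne.2 (h1.2 a ha), cond_false])
          exact (e12.comp this).of_eq (congrArg _ (Category.id_comp _))
        · simp only [Bool.and_eq_true, List.all_eq_true, bne_iff_ne] at h2
          have := e12.rename_snd (y := y) (σ := fun n => bif n == x then y else n) (by simp)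
            (fun a ha => by
              have := h2.1 a (by simpa using ha)
              simp only [beq_eq_false_iff_ne.2 this, cond_false])
            (fun a ha => by simp only [beq_eq_false_iff_ne.2 (h2.2 a ha), cond_false])
          exact (this.comp e3).of_eq (congrArg _ (Category.id_comp _))

theorem Denotes.applyRules {Γ Γ' : Wires κ} {P Q : List Op} {φ} {l : List (Rule κ Op × List ℕ)}
    (h : Denotes M Γ P Γ' φ) (hl : ∀ s ∈ l, s.1.Holds M)
    (hQ : StringDiagram.applyRules Γ.flat Γ'.flat P l = some Q) : Denotes M Γ Q Γ' φ := by
  induction l generalizing P with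
  | nil =>
    simp only [StringDiagram.applyRules, Option.some.injEq] at hQ
    exact hQ ▸ h
  | cons s l ih =>
    simp only [StringDiagram.applyRules] at hQ
    split at hQ
    · rename_i hs
      exact ih ((h.applyRule (hl s (by simp)) hs).absorb (pre := []))
        (fun t ht => hl t (by simp [ht])) hQ
    · simp at hQ

/-- A rule that can be derived from rules that hold. -/
theorem Rule.Holds.of_check {r : Rule κ Op} (l : List (Rule κ Op × List ℕ))
    (h : r.check l = true) (hl : ∀ s ∈ l, s.1.Holds M) : r.Holds M := by
  unfold Rule.check at h
  split at h
  · rename_i P hP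
    simp only [Bool.and_eq_true] at h
    obtain ⟨⟨⟨h1, h2⟩, h3⟩, h4⟩ := h
    obtain ⟨φ, hφ⟩ := exists_denotes_of_runsTo (M := M) (P := r.lhs) (Γ := ofList r.dom)
      (Γ' := ofList r.cod) (by simpa using h3)
    obtain ⟨ψ, hψ⟩ := exists_denotes_of_runsTo (M := M) (P := r.rhs) (Γ := ofList r.dom)
      (Γ' := ofList r.cod) (by simpa using h4)
    have := Denotes.unique (by simpa [SSA] using nodup_of_distinct h2) (List.isPerm_iff.1 h1)
      (hφ.applyRules hl (by simpa using hP)) hψ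
    exact ⟨φ, hφ, this ▸ hψ⟩
  · simp at h

end Rewriting

/-! ### Reification of morphisms as programs -/

section Reify

variable {κ : Type} {C : Type u} [Category.{v} C] [MonoidalCategory C] (ob : κ → C)

/-- An object of `C`, presented as a tensor product of named wires. -/
structure Named (X : C) where
  wires : Wires κ
  obj_eq : wires.obj ob = X

namespace Named

variable {ob}

def leaf (s : κ) (n : ℕ) : Named ob (ob s) := ⟨.leaf (s, n), rfl⟩

def unit : Named ob (𝟙_ C) := ⟨.unit, rfl⟩

def tensor {X Y : C} (x : Named ob X) (y : Named ob Y) : Named ob (X ⊗ Y) :=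
  ⟨.tensor x.wires y.wires, by rw [obj, x.obj_eq, y.obj_eq]⟩

end Named

variable {ob} {Op : Type} [Signature κ Op] [SymmetricCategory C] (M : Model ob Op)

/-- `Reify M φ ns x P ms y`: the morphism `φ` with inputs `x` is computed by the program `P`, with
outputs `y`; the names of the wires created by `P` are taken from the list `ns`, which leaves the
list `ms`. -/
class Reify {X Y : C} (φ : X ⟶ Y) (ns : List ℕ) (x : Named ob X) (P : outParam (List Op))
    (ms : outParam (List ℕ)) (y : outParam (Named ob Y)) : Prop where
  denotes : Denotes M x.wires P y.wires (eqToHom x.obj_eq ≫ φ ≫ eqToHom y.obj_eq.symm)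

namespace Reify

variable {M} {X Y Z X' Y' : C} {ns ms ks : List ℕ} {P Q : List Op}

instance id (x : Named ob X) : Reify M (𝟙 X) ns x [] ns x where
  denotes := by obtain ⟨x, rfl⟩ := x; exact .nil ((Coh.id _).of_eq (by simp))

instance comp {φ : X ⟶ Y} {ψ : Y ⟶ Z} {x : Named ob X} {y : Named ob Y} {z : Named ob Z}
    [h : Reify M φ ns x P ms y] [h' : Reify M ψ ms y Q ks z] :
    Reify M (φ ≫ ψ) ns x (P ++ Q) ks z where
  denotes := (h.denotes.comp h'.denotes).of_eq (by simp)

instance whiskerLeft (W : C) {φ : X ⟶ Y} {w : Named ob W} {x : Named ob X} {y : Named ob Y}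
    [h : Reify M φ ns x P ms y] : Reify M (W ◁ φ) ns (w.tensor x) P ms (w.tensor y) where
  denotes := by
    obtain ⟨w, rfl⟩ := w; obtain ⟨x, rfl⟩ := x; obtain ⟨y, rfl⟩ := y
    exact ((h.denotes.of_eq (by simp : φ = _)).whiskerLeft w).of_eq
      ((Category.id_comp _).trans (Category.comp_id _))

instance whiskerRight (W : C) {φ : X ⟶ Y} {w : Named ob W} {x : Named ob X} {y : Named ob Y}
    [h : Reify M φ ns x P ms y] : Reify M (φ ▷ W) ns (x.tensor w) P ms (y.tensor w) where
  denotes := by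
    obtain ⟨w, rfl⟩ := w; obtain ⟨x, rfl⟩ := x; obtain ⟨y, rfl⟩ := y
    exact ((h.denotes.of_eq (by simp : φ = _)).whiskerRight w).of_eq
      ((Category.id_comp _).trans (Category.comp_id _))

instance tensorHom {φ : X ⟶ Y} {ψ : X' ⟶ Y'} {x : Named ob X} {y : Named ob Y}
    {x' : Named ob X'} {y' : Named ob Y'}
    [h : Reify M φ ns x P ms y] [h' : Reify M ψ ms x' Q ks y'] :
    Reify M (φ ⊗ₘ ψ) ns (x.tensor x') (P ++ Q) ks (y.tensor y') where
  denotes := by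
    rw [MonoidalCategory.tensorHom_def]
    exact (Reify.comp (h := Reify.whiskerRight _ (h := h))
      (h' := Reify.whiskerLeft _ (h := h'))).denotes

instance assoc_hom (x : Named ob X) (y : Named ob Y) (z : Named ob Z) :
    Reify M (α_ X Y Z).hom ns ((x.tensor y).tensor z) [] ns (x.tensor (y.tensor z)) where
  denotes := by
    obtain ⟨x, rfl⟩ := x; obtain ⟨y, rfl⟩ := y; obtain ⟨z, rfl⟩ := z
    exact .nil ((Coh.assoc_hom x y z).of_eq
      ((Category.id_comp _).trans (Category.comp_id _)))

instance assoc_inv (x : Named ob X) (y : Named ob Y) (z : Named ob Z) :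
    Reify M (α_ X Y Z).inv ns (x.tensor (y.tensor z)) [] ns ((x.tensor y).tensor z) where
  denotes := by
    obtain ⟨x, rfl⟩ := x; obtain ⟨y, rfl⟩ := y; obtain ⟨z, rfl⟩ := z
    exact .nil ((Coh.assoc_inv x y z).of_eq
      ((Category.id_comp _).trans (Category.comp_id _)))

instance left_hom (x : Named ob X) : Reify M (λ_ X).hom ns (Named.unit.tensor x) [] ns x where
  denotes := by obtain ⟨x, rfl⟩ := x; exact .nil ((Coh.left_hom x).of_eq
      ((Category.id_comp _).trans (Category.comp_id _)))

instance left_inv (x : Named ob X) : Reify M (λ_ X).inv ns x [] ns (Named.unit.tensor x) where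
  denotes := by obtain ⟨x, rfl⟩ := x; exact .nil ((Coh.left_inv x).of_eq
      ((Category.id_comp _).trans (Category.comp_id _)))

instance right_hom (x : Named ob X) : Reify M (ρ_ X).hom ns (x.tensor Named.unit) [] ns x where
  denotes := by obtain ⟨x, rfl⟩ := x; exact .nil ((Coh.right_hom x).of_eq
      ((Category.id_comp _).trans (Category.comp_id _)))

instance right_inv (x : Named ob X) : Reify M (ρ_ X).inv ns x [] ns (x.tensor Named.unit) where
  denotes := by obtain ⟨x, rfl⟩ := x; exact .nil ((Coh.right_inv x).of_eq
      ((Category.id_comp _).trans (Category.comp_id _)))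

instance braid (x : Named ob X) (y : Named ob Y) :
    Reify M (β_ X Y).hom ns (x.tensor y) [] ns (y.tensor x) where
  denotes := by
    obtain ⟨x, rfl⟩ := x; obtain ⟨y, rfl⟩ := y
    exact .nil ((Coh.braid x y).of_eq
      ((Category.id_comp _).trans (Category.comp_id _)))

end Reify

variable {M}

/-- An equality of morphisms gives a rule. -/
theorem Rule.holds_of_eq {X Y : C} {φ ψ : X ⟶ Y} (e : φ = ψ) (ns ns' : List ℕ) (x : Named ob X)
    {P Q : List Op} {ms ms' : List ℕ} {y y' : Named ob Y} [h : Reify M φ ns x P ms y]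
    [h' : Reify M ψ ns' x Q ms' y'] {r : Rule κ Op} (hy : y = y')
    (hr : r = ⟨x.wires.flat, P, Q, y.wires.flat⟩) : r.Holds M := by
  subst e hy hr
  have key : ∀ {P φ}, Denotes M x.wires P y.wires φ → ∀ {c d},
      Coh ob (ofList x.wires.flat) x.wires c → Coh ob y.wires (ofList y.wires.flat) d →
      Denotes M (ofList x.wires.flat) P (ofList y.wires.flat) (c ≫ φ ≫ d) := by
    intro P φ h c d hc hd
    have := (h.comp (.nil hd)).coh_comp hc
    rwa [List.append_nil] at this
  obtain ⟨c, hc⟩ := Coh.of_perm (ob := ob) (Γ := ofList x.wires.flat) (Γ' := x.wires) (by simp)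
  obtain ⟨d, hd⟩ := Coh.of_perm (ob := ob) (Γ := y.wires) (Γ' := ofList y.wires.flat) (by simp)
  exact ⟨_, key h.denotes hc hd, key h'.denotes hc hd⟩

/-- A rule gives an equality of morphisms. -/
theorem Rule.Holds.eq {r : Rule κ Op} (hr : r.Holds M) {X Y : C} {φ ψ : X ⟶ Y}
    (ns ns' : List ℕ) (x : Named ob X) {P Q : List Op} {ms ms' : List ℕ} {y y' : Named ob Y}
    [h : Reify M φ ns x P ms y] [h' : Reify M ψ ns' x Q ms' y'] (hy : y = y')
    (e : r = ⟨x.wires.flat, P, Q, y.wires.flat⟩) (hP : SSA r.dom r.lhs) (hQ : SSA r.dom r.rhs) :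
    φ = ψ := by
  subst hy e
  obtain ⟨χ, d1, d2⟩ := hr
  obtain ⟨c, hc⟩ := Coh.of_perm (ob := ob) (Γ := x.wires) (Γ' := ofList x.wires.flat) (by simp)
  obtain ⟨d, hd⟩ := Coh.of_perm (ob := ob) (Γ := ofList y.wires.flat) (Γ' := y.wires) (by simp)
  have e1 := (d1.comp (.nil hd)).coh_comp hc
  have e2 := (d2.comp (.nil hd)).coh_comp hc
  rw [List.append_nil] at e1 e2
  -- Distinct names allow each program only one morphism, so both sides equal `c ≫ χ ≫ d` up to the
  -- identifications of objects, which cancel.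
  have := (Denotes.unique hP (.refl _) h.denotes e1).trans
    (Denotes.unique hQ (.refl _) h'.denotes e2).symm
  rwa [cancel_epi, cancel_mono] at this

end Reify

end StringDiagram

namespace WeakCrossed
open StringDiagram

/-! ### The signature of crossed products by weak Hopf algebras -/

/-- The sorts of wires: `H`, `A` and `E`. -/
inductive Srt | h | a | e
  deriving DecidableEq

/-- The operations; the arguments are the names of the input wires and then of the output wires. -/
inductive Op
  | mul (x y z : ℕ)
  | one (x : ℕ)
  | comul (x y z : ℕ)
  | counit (x : ℕ)
  | anti (x y : ℕ)
  | piL (x y : ℕ)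
  | piR (x y : ℕ)
  | mulA (a b c : ℕ)
  | oneA (a : ℕ)
  | act (x a b : ℕ)
  | unitAct (x a : ℕ)
  | coc (x y a : ℕ)
  | inv (x y a : ℕ)
  | incl (e a x : ℕ)
  | proj (a x e : ℕ)
  | prod (x y z : ℕ)
  | emb (a x : ℕ)
  | gam (x y : ℕ)
  | wire (s : Srt) (x y : ℕ)
  deriving DecidableEq

instance : Signature Srt Op where
  ins
    | .mul x y _ => [(.h, x), (.h, y)]
    | .one _ => []
    | .comul x _ _ => [(.h, x)]
    | .counit x => [(.h, x)]
    | .anti x _ => [(.h, x)]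
    | .piL x _ => [(.h, x)]
    | .piR x _ => [(.h, x)]
    | .mulA a b _ => [(.a, a), (.a, b)]
    | .oneA _ => []
    | .act x a _ => [(.h, x), (.a, a)]
    | .unitAct x _ => [(.h, x)]
    | .coc x y _ => [(.h, x), (.h, y)]
    | .inv x y _ => [(.h, x), (.h, y)]
    | .incl e _ _ => [(.e, e)]
    | .proj a x _ => [(.a, a), (.h, x)]
    | .prod x y _ => [(.e, x), (.e, y)]
    | .emb a _ => [(.a, a)]
    | .gam x _ => [(.h, x)]
    | .wire s x _ => [(s, x)]
  outs
    | .mul _ _ z => [(.h, z)]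
    | .one x => [(.h, x)]
    | .comul _ y z => [(.h, y), (.h, z)]
    | .counit _ => []
    | .anti _ y => [(.h, y)]
    | .piL _ y => [(.h, y)]
    | .piR _ y => [(.h, y)]
    | .mulA _ _ c => [(.a, c)]
    | .oneA a => [(.a, a)]
    | .act _ _ b => [(.a, b)]
    | .unitAct _ a => [(.a, a)]
    | .coc _ _ a => [(.a, a)]
    | .inv _ _ a => [(.a, a)]
    | .incl _ a x => [(.a, a), (.h, x)]
    | .proj _ _ e => [(.e, e)]
    | .prod _ _ z => [(.e, z)]
    | .emb _ x => [(.e, x)]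
    | .gam _ y => [(.e, y)]
    | .wire s _ y => [(s, y)]
  wire
    | .wire s x y => some (s, x, y)
    | _ => none
  map σ
    | .mul x y z => .mul (σ x) (σ y) (σ z)
    | .one x => .one (σ x)
    | .comul x y z => .comul (σ x) (σ y) (σ z)
    | .counit x => .counit (σ x)
    | .anti x y => .anti (σ x) (σ y)
    | .piL x y => .piL (σ x) (σ y)
    | .piR x y => .piR (σ x) (σ y)
    | .mulA a b c => .mulA (σ a) (σ b) (σ c)
    | .oneA a => .oneA (σ a)
    | .act x a b => .act (σ x) (σ a) (σ b)
    | .unitAct x a => .unitAct (σ x) (σ a)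
    | .coc x y a => .coc (σ x) (σ y) (σ a)
    | .inv x y a => .inv (σ x) (σ y) (σ a)
    | .incl e a x => .incl (σ e) (σ a) (σ x)
    | .proj a x e => .proj (σ a) (σ x) (σ e)
    | .prod x y z => .prod (σ x) (σ y) (σ z)
    | .emb a x => .emb (σ a) (σ x)
    | .gam x y => .gam (σ x) (σ y)
    | .wire s x y => .wire s (σ x) (σ y)

variable {C : Type u} [Category.{v} C] [MonoidalCategory C] [SymmetricCategory C]

/-- The morphisms from which a crossed product `E` of `A` by `H` is formed. -/
structure CrossedData (H A : C) where
  S : H ⟶ H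
  ρ : H ⊗ A ⟶ A
  f : H ⊗ H ⟶ A
  g : H ⊗ H ⟶ A
  E : C
  incl : E ⟶ A ⊗ H
  proj : A ⊗ H ⟶ E

variable {H A : C}

namespace CrossedData

/-- The object that a sort stands for. -/
def ob (D : CrossedData H A) : Srt → C
  | .h => H
  | .a => A
  | .e => D.E

variable (D : CrossedData H A)

/-- A wire of sort `H`. -/
def hw (n : ℕ) : Named D.ob H := Named.leaf Srt.h n

/-- A wire of sort `A`. -/
def aw (n : ℕ) : Named D.ob A := Named.leaf Srt.a n

/-- A wire of sort `E`. -/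
def ew (n : ℕ) : Named D.ob D.E := Named.leaf Srt.e n

/-- A box with given inputs and outputs. -/
def mkBox {X Y : C} (x : Named D.ob X) (y : Named D.ob Y) (φ : X ⟶ Y) : Box D.ob where
  ins := x.wires
  outs := y.wires
  hom := eqToHom x.obj_eq ≫ φ ≫ eqToHom y.obj_eq.symm

variable [MonObj H] [ComonObj H] [MonObj A]

/-- The product of the crossed product. -/
def mulHom : D.E ⊗ D.E ⟶ D.E :=
  (D.incl ⊗ₘ D.incl) ≫ mulTensor (chi D.ρ) (calF D.f) ≫ D.proj

/-- The morphism from `A` to the crossed product. -/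
def embHom : A ⟶ D.E := ((ρ_ A).inv ≫ A ◁ nu D.ρ ⊗≫ μ[A] ▷ H) ≫ D.proj

/-- The morphism from `H` to the crossed product. -/
def gamHom : H ⟶ D.E := (λ_ H).inv ≫ η[A] ▷ H ≫ D.proj

/-- The interpretation of the operations. -/
def box : Op → Box D.ob
  | .mul x y z => D.mkBox ((D.hw x).tensor (D.hw y)) (D.hw z) μ[H]
  | .one x => D.mkBox .unit (D.hw x) η[H]
  | .comul x y z => D.mkBox (D.hw x) ((D.hw y).tensor (D.hw z)) Δ[H]
  | .counit x => D.mkBox (D.hw x) .unit ε[H]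
  | .anti x y => D.mkBox (D.hw x) (D.hw y) D.S
  | .piL x y => D.mkBox (D.hw x) (D.hw y) (PiL H)
  | .piR x y => D.mkBox (D.hw x) (D.hw y) (PiR H)
  | .mulA a b c => D.mkBox ((D.aw a).tensor (D.aw b)) (D.aw c) μ[A]
  | .oneA a => D.mkBox .unit (D.aw a) η[A]
  | .act x a b => D.mkBox ((D.hw x).tensor (D.aw a)) (D.aw b) D.ρ
  | .unitAct x a => D.mkBox (D.hw x) (D.aw a) (u1 D.ρ)
  | .coc x y a => D.mkBox ((D.hw x).tensor (D.hw y)) (D.aw a) D.f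
  | .inv x y a => D.mkBox ((D.hw x).tensor (D.hw y)) (D.aw a) D.g
  | .incl e a x => D.mkBox (D.ew e) ((D.aw a).tensor (D.hw x)) D.incl
  | .proj a x e => D.mkBox ((D.aw a).tensor (D.hw x)) (D.ew e) D.proj
  | .prod x y z => D.mkBox ((D.ew x).tensor (D.ew y)) (D.ew z) D.mulHom
  | .emb a x => D.mkBox (D.aw a) (D.ew x) D.embHom
  | .gam x y => D.mkBox (D.hw x) (D.ew y) D.gamHom
  | .wire s x y => ⟨.leaf (s, x), .leaf (s, y), 𝟙 (D.ob s)⟩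

/-- The model of the signature given by a crossed product. -/
def model : Model D.ob Op where
  box := D.box
  ins_flat s := by cases s <;> rfl
  outs_flat s := by cases s <;> rfl
  box_map σ s := by
    cases s <;>
      simp [Signature.map, box, mkBox, Box.map, hw, aw, ew, Named.leaf, Named.tensor, Named.unit,
        renameIso, Wires.map, Wires.obj] <;>
      (congr 1; exact Category.id_comp _)
  box_wire {s} k x y h := by
    cases s <;> simp only [Signature.wire, Option.some.injEq, Prod.mk.injEq, reduceCtorEq] at h
    obtain ⟨rfl, rfl, rfl⟩ := h
    rfl

theorem reify_box {X Y : C} {φ : X ⟶ Y} {x : Named D.ob X} {y : Named D.ob Y} (s : Op)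
    (ns : List ℕ) (h : D.box s = D.mkBox x y φ) : Reify D.model φ ns x [s] ns y where
  denotes := by
    have := Denotes.op (M := D.model) s
    rw [show D.model.box s = _ from h] at this
    exact this

variable (x y a b e : ℕ) (ns : List ℕ)

instance reify_mul (z : ℕ) : Reify D.model μ[H] (z :: ns) ((D.hw x).tensor (D.hw y))
    [.mul x y z] ns (D.hw z) := ⟨(D.reify_box (.mul x y z) ns rfl).denotes⟩

instance reify_one : Reify D.model η[H] (x :: ns) .unit [.one x] ns (D.hw x) :=
  ⟨(D.reify_box (.one x) ns rfl).denotes⟩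

instance reify_comul (z : ℕ) : Reify D.model Δ[H] (y :: z :: ns) (D.hw x) [.comul x y z] ns
    ((D.hw y).tensor (D.hw z)) := ⟨(D.reify_box (.comul x y z) ns rfl).denotes⟩

instance reify_counit : Reify D.model ε[H] ns (D.hw x) [.counit x] ns .unit :=
  ⟨(D.reify_box (.counit x) ns rfl).denotes⟩

instance reify_anti : Reify D.model D.S (y :: ns) (D.hw x) [.anti x y] ns (D.hw y) :=
  ⟨(D.reify_box (.anti x y) ns rfl).denotes⟩

instance reify_piL : Reify D.model (PiL H) (y :: ns) (D.hw x) [.piL x y] ns (D.hw y) :=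
  ⟨(D.reify_box (.piL x y) ns rfl).denotes⟩

instance reify_piR : Reify D.model (PiR H) (y :: ns) (D.hw x) [.piR x y] ns (D.hw y) :=
  ⟨(D.reify_box (.piR x y) ns rfl).denotes⟩

instance reify_mulA (c : ℕ) : Reify D.model μ[A] (c :: ns) ((D.aw a).tensor (D.aw b))
    [.mulA a b c] ns (D.aw c) := ⟨(D.reify_box (.mulA a b c) ns rfl).denotes⟩

instance reify_oneA : Reify D.model η[A] (a :: ns) .unit [.oneA a] ns (D.aw a) :=
  ⟨(D.reify_box (.oneA a) ns rfl).denotes⟩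

instance reify_act : Reify D.model D.ρ (b :: ns) ((D.hw x).tensor (D.aw a)) [.act x a b] ns
    (D.aw b) := ⟨(D.reify_box (.act x a b) ns rfl).denotes⟩

instance reify_unitAct : Reify D.model (u1 D.ρ) (a :: ns) (D.hw x) [.unitAct x a] ns (D.aw a) :=
  ⟨(D.reify_box (.unitAct x a) ns rfl).denotes⟩

instance reify_coc : Reify D.model D.f (a :: ns) ((D.hw x).tensor (D.hw y)) [.coc x y a] ns
    (D.aw a) := ⟨(D.reify_box (.coc x y a) ns rfl).denotes⟩

instance reify_inv : Reify D.model D.g (a :: ns) ((D.hw x).tensor (D.hw y)) [.inv x y a] ns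
    (D.aw a) := ⟨(D.reify_box (.inv x y a) ns rfl).denotes⟩

instance reify_incl : Reify D.model D.incl (a :: x :: ns) (D.ew e) [.incl e a x] ns
    ((D.aw a).tensor (D.hw x)) := ⟨(D.reify_box (.incl e a x) ns rfl).denotes⟩

instance reify_proj : Reify D.model D.proj (e :: ns) ((D.aw a).tensor (D.hw x)) [.proj a x e] ns
    (D.ew e) := ⟨(D.reify_box (.proj a x e) ns rfl).denotes⟩

instance reify_prod (z : ℕ) : Reify D.model D.mulHom (z :: ns) ((D.ew x).tensor (D.ew y))
    [.prod x y z] ns (D.ew z) := ⟨(D.reify_box (.prod x y z) ns rfl).denotes⟩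

instance reify_emb : Reify D.model D.embHom (x :: ns) (D.aw a) [.emb a x] ns (D.ew x) :=
  ⟨(D.reify_box (.emb a x) ns rfl).denotes⟩

instance reify_gam : Reify D.model D.gamHom (y :: ns) (D.hw x) [.gam x y] ns (D.ew y) :=
  ⟨(D.reify_box (.gam x y) ns rfl).denotes⟩

/-- The identity, as an operation that renames a wire. -/
def wireHom (X : C) : X ⟶ X := 𝟙 X

instance reify_wire_h : Reify D.model (wireHom H) (y :: ns) (D.hw x) [.wire .h x y] ns (D.hw y) :=
  ⟨(D.reify_box (.wire .h x y) ns (by simp [box, mkBox, wireHom]; rfl)).denotes⟩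

instance reify_wire_a : Reify D.model (wireHom A) (y :: ns) (D.aw x) [.wire .a x y] ns (D.aw y) :=
  ⟨(D.reify_box (.wire .a x y) ns (by simp [box, mkBox, wireHom]; rfl)).denotes⟩

instance reify_wire_e :
    Reify D.model (wireHom D.E) (y :: ns) (D.ew x) [.wire .e x y] ns (D.ew y) :=
  ⟨(D.reify_box (.wire .e x y) ns (by simp [box, mkBox, wireHom]; rfl)).denotes⟩

/-- The assumptions on a crossed product with invertible cocycle. -/
class Valid : Prop where
  weak : IsWeakBialgebra H
  antipode : IsAntipode D.S
  module : IsWeakModuleAlgebra D.ρ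
  crossed : IsUnitaryCrossedProduct D.ρ D.f
  regular : conv μ[A] D.f (u2 D.ρ) = D.f
  inverse : IsRegularInverse (u2 D.ρ) D.f D.g
  proj_incl : D.proj ≫ D.incl = nabla (chi D.ρ)
  incl_proj : D.incl ≫ D.proj = 𝟙 D.E

end CrossedData

end WeakCrossed

namespace WeakCrossed
open StringDiagram

/-! ### The axioms as rewriting rules -/

section Rules
open Op

def mul_assoc : Rule Srt Op :=
  ⟨[(.h, 0), (.h, 1), (.h, 2)], [mul 0 1 3, mul 3 2 4], [mul 1 2 5, mul 0 5 4], [(.h, 4)]⟩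

def one_mul : Rule Srt Op :=
  ⟨[(.h, 0)], [one 1, mul 1 0 2], [wire .h 0 2], [(.h, 2)]⟩

def mul_one : Rule Srt Op :=
  ⟨[(.h, 0)], [one 1, mul 0 1 2], [wire .h 0 2], [(.h, 2)]⟩

def comul_assoc : Rule Srt Op :=
  ⟨[(.h, 0)], [comul 0 1 2, comul 1 3 4], [comul 0 3 5, comul 5 4 2], [(.h, 3), (.h, 4), (.h, 2)]⟩

def counit_comul : Rule Srt Op :=
  ⟨[(.h, 0)], [comul 0 1 2, counit 1], [wire .h 0 2], [(.h, 2)]⟩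

def comul_counit : Rule Srt Op :=
  ⟨[(.h, 0)], [comul 0 1 2, counit 2], [wire .h 0 1], [(.h, 1)]⟩

def mulA_assoc : Rule Srt Op :=
  ⟨[(.a, 0), (.a, 1), (.a, 2)], [mulA 0 1 3, mulA 3 2 4], [mulA 1 2 5, mulA 0 5 4], [(.a, 4)]⟩

def oneA_mul : Rule Srt Op :=
  ⟨[(.a, 0)], [oneA 1, mulA 1 0 2], [wire .a 0 2], [(.a, 2)]⟩

/-- `Δ(xy) = x₁y₁ ⊗ x₂y₂` -/
def mul_comul : Rule Srt Op :=
  ⟨[(.h, 0), (.h, 1)], [mul 0 1 2, comul 2 3 4], [comul 0 5 6, comul 1 7 8, mul 5 7 3, mul 6 8 4],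
  [(.h, 3), (.h, 4)]⟩

/-- `ε(xyz) = ε(xy₁)ε(y₂z)` -/
def counit_mul_mul : Rule Srt Op :=
  ⟨[(.h, 0), (.h, 1), (.h, 2)], [mul 0 1 3, mul 3 2 4, counit 4], [comul 1 5 6, mul 0 5 7,
  counit 7, mul 6 2 8, counit 8], []⟩

/-- `ε(xyz) = ε(xy₂)ε(y₁z)` -/
def counit_mul_mul_cop : Rule Srt Op :=
  ⟨[(.h, 0), (.h, 1), (.h, 2)], [mul 0 1 3, mul 3 2 4, counit 4], [comul 1 5 6, mul 0 6 7,
  counit 7, mul 5 2 8, counit 8], []⟩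

/-- `1₁ ⊗ 1₂ ⊗ 1₃ = (Δ(1) ⊗ 1)(1 ⊗ Δ(1))` -/
def comul_comul_one : Rule Srt Op :=
  ⟨[], [one 0, comul 0 1 2, comul 1 3 4], [one 5, comul 5 3 6, one 7, comul 7 8 2, mul 6 8 4],
  [(.h, 3), (.h, 4), (.h, 2)]⟩

/-- `1₁ ⊗ 1₂ ⊗ 1₃ = (1 ⊗ Δ(1))(Δ(1) ⊗ 1)` -/
def comul_comul_one_op : Rule Srt Op :=
  ⟨[], [one 0, comul 0 1 2, comul 1 3 4], [one 5, comul 5 3 6, one 7, comul 7 8 2, mul 8 6 4],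
  [(.h, 3), (.h, 4), (.h, 2)]⟩

/-- `Π^L(h) = ε(1₁h)1₂` -/
def piL_def : Rule Srt Op :=
  ⟨[(.h, 0)], [piL 0 1], [one 2, comul 2 3 1, mul 3 0 4, counit 4], [(.h, 1)]⟩

/-- `Π^R(h) = 1₁ε(h1₂)` -/
def piR_def : Rule Srt Op :=
  ⟨[(.h, 0)], [piR 0 1], [one 2, comul 2 1 3, mul 0 3 4, counit 4], [(.h, 1)]⟩

/-- `h₁S(h₂) = Π^L(h)` -/
def id_anti : Rule Srt Op :=
  ⟨[(.h, 0)], [comul 0 1 2, anti 2 3, mul 1 3 4], [piL 0 4], [(.h, 4)]⟩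

/-- `S(h₁)h₂ = Π^R(h)` -/
def anti_id : Rule Srt Op :=
  ⟨[(.h, 0)], [comul 0 1 2, anti 1 3, mul 3 2 4], [piR 0 4], [(.h, 4)]⟩

/-- `S(h₁)h₂S(h₃) = S(h)` -/
def anti_id_anti : Rule Srt Op :=
  ⟨[(.h, 0)], [comul 0 1 2, comul 1 3 4, anti 3 5, anti 2 6, mul 5 4 7, mul 7 6 8], [anti 0 8],
  [(.h, 8)]⟩

/-- `u₁(h) = h·1` -/
def unitAct_def : Rule Srt Op :=
  ⟨[(.h, 0)], [unitAct 0 1], [oneA 2, act 0 2 1], [(.a, 1)]⟩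

/-- `h·(ab) = (h₁·a)(h₂·b)` -/
def act_mul : Rule Srt Op :=
  ⟨[(.h, 0), (.a, 1), (.a, 2)], [mulA 1 2 3, act 0 3 4], [comul 0 5 6, act 5 1 7, act 6 2 8,
  mulA 7 8 4], [(.a, 4)]⟩

/-- `u₁(hk) = h·u₁(k)` -/
def unitAct_mul : Rule Srt Op :=
  ⟨[(.h, 0), (.h, 1)], [mul 0 1 2, unitAct 2 3], [unitAct 1 4, act 0 4 3], [(.a, 3)]⟩

/-- `Π^L(h)·a = u₁(h)a` -/
def piL_act : Rule Srt Op :=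
  ⟨[(.h, 0), (.a, 1)], [piL 0 2, act 2 1 3], [unitAct 0 4, mulA 4 1 3], [(.a, 3)]⟩

/-- `f(h₁, k₁)(h₂k₂·a) = (h₁·(k₁·a))f(h₂, k₂)` -/
def twisted : Rule Srt Op :=
  ⟨[(.h, 0), (.h, 1), (.a, 2)], [comul 0 3 4, comul 1 5 6, coc 3 5 7, mul 4 6 8, act 8 2 9,
  mulA 7 9 10], [comul 1 11 12, act 11 2 13, comul 0 14 15, act 14 13 16, coc 15 12 17,
  mulA 16 17 10], [(.a, 10)]⟩

/-- `(h₁·f(k₁, l₁))f(h₂, k₂l₂) = f(h₁, k₁)f(h₂k₂, l)` -/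
def cocycle : Rule Srt Op :=
  ⟨[(.h, 0), (.h, 1), (.h, 2)], [comul 1 3 4, comul 2 5 6, coc 3 5 7, mul 4 6 8, comul 0 9 10,
  act 9 7 11, coc 10 8 12, mulA 11 12 13], [comul 0 14 15, comul 1 16 17, coc 14 16 18,
  mul 15 17 19, coc 19 2 20, mulA 18 20 13], [(.a, 13)]⟩

/-- In the three preunit rules ν is written out as 1(1₁·1) ⊗ 1₂. The extra unit of `A` comes from
evaluating ∇ at η ⊗ η and is removed later by `oneA_mul`. -/
def preunit_left : Rule Srt Op :=
  ⟨[(.h, 0)], [comul 0 1 2, oneA 3, one 4, oneA 5, comul 4 6 7, act 6 5 8, mulA 3 8 9, act 1 9 10,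
  coc 2 7 11, mulA 10 11 12], [unitAct 0 12], [(.a, 12)]⟩

def preunit_right : Rule Srt Op :=
  ⟨[(.h, 0)], [oneA 1, one 2, oneA 3, comul 2 4 5, act 4 3 6, mulA 1 6 7, coc 5 0 8, mulA 7 8 9],
  [unitAct 0 9], [(.a, 9)]⟩

def preunit_comm : Rule Srt Op :=
  ⟨[(.a, 0)], [oneA 1, one 2, oneA 3, comul 2 4 5, act 4 3 6, mulA 1 6 7, comul 5 8 9, act 8 0 10,
  mulA 7 10 11], [oneA 12, one 13, oneA 14, comul 13 15 9, act 15 14 16, mulA 12 16 17,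
  mulA 0 17 11], [(.a, 11), (.h, 9)]⟩

/-- `f(h₁, k₁)g(h₂, k₂) = u₁(hk)` -/
def coc_mul_inv : Rule Srt Op :=
  ⟨[(.h, 0), (.h, 1)], [comul 0 2 3, comul 1 4 5, coc 2 4 6, inv 3 5 7, mulA 6 7 8], [mul 0 1 9,
  unitAct 9 8], [(.a, 8)]⟩

/-- `g(h₁, k₁)f(h₂, k₂) = u₁(hk)` -/
def inv_mul_coc : Rule Srt Op :=
  ⟨[(.h, 0), (.h, 1)], [comul 0 2 3, comul 1 4 5, inv 2 4 6, coc 3 5 7, mulA 6 7 8], [mul 0 1 9,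
  unitAct 9 8], [(.a, 8)]⟩

/-- `g(h₁, k₁)u₁(h₂k₂) = g(h, k)` -/
def inv_mul_unit : Rule Srt Op :=
  ⟨[(.h, 0), (.h, 1)], [comul 0 2 3, comul 1 4 5, inv 2 4 6, mul 3 5 7, unitAct 7 8, mulA 6 8 9],
  [inv 0 1 9], [(.a, 9)]⟩

/-- `f(h₁, k₁)u₁(h₂k₂) = f(h, k)` -/
def coc_mul_unit : Rule Srt Op :=
  ⟨[(.h, 0), (.h, 1)], [comul 0 2 3, comul 1 4 5, coc 2 4 6, mul 3 5 7, unitAct 7 8, mulA 6 8 9],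
  [coc 0 1 9], [(.a, 9)]⟩

def proj_incl : Rule Srt Op :=
  ⟨[(.a, 0), (.h, 1)], [proj 0 1 2, incl 2 3 4], [oneA 5, comul 1 6 4, act 6 5 7, mulA 0 7 3],
  [(.a, 3), (.h, 4)]⟩

def incl_proj : Rule Srt Op :=
  ⟨[(.e, 0)], [incl 0 1 2, proj 1 2 3], [wire .e 0 3], [(.e, 3)]⟩

def prod_def : Rule Srt Op :=
  ⟨[(.e, 0), (.e, 1)], [prod 0 1 2], [incl 0 3 4, incl 1 5 6, comul 4 7 8, act 7 5 9, mulA 3 9 10,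
  comul 8 11 12, comul 6 13 14, coc 11 13 15, mul 12 14 16, mulA 10 15 17, proj 17 16 2],
  [(.e, 2)]⟩

def emb_def : Rule Srt Op :=
  ⟨[(.a, 0)], [emb 0 1], [oneA 2, one 3, oneA 4, comul 3 5 6, act 5 4 7, mulA 2 7 8, mulA 0 8 9,
  proj 9 6 1], [(.e, 1)]⟩

def gam_def : Rule Srt Op :=
  ⟨[(.h, 0)], [gam 0 1], [oneA 2, proj 2 0 1], [(.e, 1)]⟩

end Rules

namespace CrossedData

variable {C : Type u} [Category.{v} C] [MonoidalCategory C] [SymmetricCategory C] {H A : C}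
  [MonObj H] [ComonObj H] [MonObj A] {D : CrossedData H A}

@[simp] theorem holds_mul_assoc : mul_assoc.Holds D.model := by
  have e := MonObj.mul_assoc H
  exact Rule.holds_of_eq e [3, 4] [5, 4] (((D.hw 0).tensor (D.hw 1)).tensor (D.hw 2)) rfl rfl

@[simp] theorem holds_one_mul : one_mul.Holds D.model := by
  have e : η[H] ▷ H ≫ μ[H] = (λ_ H).hom ≫ wireHom H := by simp [wireHom]
  exact Rule.holds_of_eq e [1, 2] [2] (Named.unit.tensor (D.hw 0)) rfl rfl

@[simp] theorem holds_mul_one : mul_one.Holds D.model := by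
  have e : H ◁ η[H] ≫ μ[H] = (ρ_ H).hom ≫ wireHom H := by simp [wireHom]
  exact Rule.holds_of_eq e [1, 2] [2] ((D.hw 0).tensor Named.unit) rfl rfl

@[simp] theorem holds_comul_assoc : comul_assoc.Holds D.model := by
  have e := (ComonObj.comul_assoc H).symm
  exact Rule.holds_of_eq e [1, 2, 3, 4] [3, 5, 4, 2] (D.hw 0) rfl rfl

@[simp] theorem holds_counit_comul : counit_comul.Holds D.model := by
  have e : Δ[H] ≫ ε[H] ▷ H = wireHom H ≫ (λ_ H).inv := by simp [wireHom]
  exact Rule.holds_of_eq e [1, 2] [2] (D.hw 0) rfl rfl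

@[simp] theorem holds_comul_counit : comul_counit.Holds D.model := by
  have e : Δ[H] ≫ H ◁ ε[H] = wireHom H ≫ (ρ_ H).inv := by simp [wireHom]
  exact Rule.holds_of_eq e [1, 2] [1] (D.hw 0) rfl rfl

@[simp] theorem holds_mulA_assoc : mulA_assoc.Holds D.model := by
  have e := MonObj.mul_assoc A
  exact Rule.holds_of_eq e [3, 4] [5, 4] (((D.aw 0).tensor (D.aw 1)).tensor (D.aw 2)) rfl rfl

@[simp] theorem holds_oneA_mul : oneA_mul.Holds D.model := by
  have e : η[A] ▷ A ≫ μ[A] = (λ_ A).hom ≫ wireHom A := by simp [wireHom]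
  exact Rule.holds_of_eq e [1, 2] [2] (Named.unit.tensor (D.aw 0)) rfl rfl

@[simp] theorem holds_piL_def : piL_def.Holds D.model := by
  -- Only the right hand copy is unfolded, so that the left hand side of the rule remains the single
  -- operation `piL`.
  have e : PiL H = PiL H := rfl
  conv at e =>
    rhs
    simp [PiL, monoidalComp, MonoidalCoherence.iso]
  exact Rule.holds_of_eq e [1] [2, 3, 1, 4] (D.hw 0) rfl rfl

@[simp] theorem holds_piR_def : piR_def.Holds D.model := by
  have e : PiR H = PiR H := rfl
  conv at e =>
    rhs
    simp [PiR, monoidalComp, MonoidalCoherence.iso]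
  exact Rule.holds_of_eq e [1] [2, 1, 3, 4] (D.hw 0) rfl rfl

@[simp] theorem holds_unitAct_def : unitAct_def.Holds D.model := by
  have e : u1 D.ρ = (ρ_ H).inv ≫ H ◁ η[A] ≫ D.ρ := rfl
  exact Rule.holds_of_eq e [1] [2, 1] (D.hw 0) rfl rfl

@[simp] theorem holds_prod_def : prod_def.Holds D.model := by
  have e : D.mulHom = D.mulHom := rfl
  conv at e =>
    rhs
    simp [mulHom, mulTensor, calF, chi, Comon.tensorObj_comul, tensorμ, monoidalComp,
      MonoidalCoherence.iso]
  exact Rule.holds_of_eq e [2]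
    [3, 4, 5, 6, 7, 8, 9, 10, 11, 12, 13, 14, 15, 16, 17, 2] ((D.ew 0).tensor (D.ew 1)) rfl rfl

@[simp] theorem holds_emb_def : emb_def.Holds D.model := by
  have e : D.embHom = D.embHom := rfl
  conv at e =>
    rhs
    simp [embHom, nu, nabla, chi, monoidalComp, MonoidalCoherence.iso]
  exact Rule.holds_of_eq e [1] [2, 3, 4, 5, 6, 7, 8, 9, 1] (D.aw 0) rfl rfl

@[simp] theorem holds_gam_def : gam_def.Holds D.model := by
  have e : D.gamHom = (λ_ H).inv ≫ η[A] ▷ H ≫ D.proj := rfl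
  exact Rule.holds_of_eq e [1] [2, 1] (D.hw 0) rfl rfl

variable [hD : D.Valid]

@[simp] theorem holds_mul_comul : mul_comul.Holds D.model := by
  have e := hD.weak.mul_comul
  simp only [tensorμ] at e
  exact Rule.holds_of_eq e [2, 3, 4] [5, 6, 7, 8, 3, 4] ((D.hw 0).tensor (D.hw 1)) rfl rfl

@[simp] theorem holds_counit_mul_mul : counit_mul_mul.Holds D.model := by
  have e := hD.weak.counit_mul_mul
  simp only [monoidalComp, MonoidalCoherence.iso] at e
  -- Associativity is excluded to preserve the bracketing (xy)z in the left hand side of the rule.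
  simp [-MonObj.mul_assoc, -MonObj.mul_assoc_assoc] at e
  exact Rule.holds_of_eq e [3, 4] [5, 6, 7, 8] (((D.hw 0).tensor (D.hw 1)).tensor (D.hw 2)) rfl rfl

@[simp] theorem holds_counit_mul_mul_cop : counit_mul_mul_cop.Holds D.model := by
  have e := hD.weak.counit_mul_mul_cop
  simp only [monoidalComp, MonoidalCoherence.iso] at e
  simp [-MonObj.mul_assoc, -MonObj.mul_assoc_assoc] at e
  exact Rule.holds_of_eq e [3, 4] [5, 6, 7, 8] (((D.hw 0).tensor (D.hw 1)).tensor (D.hw 2)) rfl rfl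

@[simp] theorem holds_comul_comul_one : comul_comul_one.Holds D.model := by
  have e := hD.weak.comul_comul_one
  simp [monoidalComp, MonoidalCoherence.iso] at e
  exact Rule.holds_of_eq e [0, 1, 2, 3, 4] [5, 3, 6, 7, 8, 2, 4] Named.unit rfl rfl

@[simp] theorem holds_comul_comul_one_op : comul_comul_one_op.Holds D.model := by
  have e := hD.weak.comul_comul_one_op
  simp [monoidalComp, MonoidalCoherence.iso] at e
  exact Rule.holds_of_eq e [0, 1, 2, 3, 4] [5, 3, 6, 7, 8, 2, 4] Named.unit rfl rfl

@[simp] theorem holds_id_anti : id_anti.Holds D.model := by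
  have e := hD.antipode.id_conv
  exact Rule.holds_of_eq e [1, 2, 3, 4] [4] (D.hw 0) rfl rfl

@[simp] theorem holds_anti_id : anti_id.Holds D.model := by
  have e := hD.antipode.conv_id
  exact Rule.holds_of_eq e [1, 2, 3, 4] [4] (D.hw 0) rfl rfl

@[simp] theorem holds_anti_id_anti : anti_id_anti.Holds D.model := by
  have e := hD.antipode.conv_id_conv
  exact Rule.holds_of_eq e [1, 2, 3, 4, 5, 6, 7, 8] [8] (D.hw 0) rfl rfl

@[simp] theorem holds_act_mul : act_mul.Holds D.model := by
  have e := hD.module.act_mul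
  simp only [tensorμ] at e
  exact Rule.holds_of_eq e [3, 4]
    [5, 6, 7, 8, 4] ((D.hw 0).tensor ((D.aw 1).tensor (D.aw 2))) rfl rfl

@[simp] theorem holds_unitAct_mul : unitAct_mul.Holds D.model := by
  have e := hD.module.mul_act_one
  simp only [u2] at e
  exact Rule.holds_of_eq e [2, 3] [4, 3] ((D.hw 0).tensor (D.hw 1)) rfl rfl

@[simp] theorem holds_piL_act : piL_act.Holds D.model := by
  have e := hD.module.piL_act
  exact Rule.holds_of_eq e [2, 3] [4, 3] ((D.hw 0).tensor (D.aw 1)) rfl rfl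

@[simp] theorem holds_twisted : twisted.Holds D.model := by
  have e := hD.crossed.twisted_module
  simp [calF, chi, Comon.tensorObj_comul, tensorμ, monoidalComp, MonoidalCoherence.iso] at e
  exact Rule.holds_of_eq e [3, 4, 5, 6, 7, 8, 9, 10]
    [11, 12, 13, 14, 15, 16, 17, 10] (((D.hw 0).tensor (D.hw 1)).tensor (D.aw 2)) rfl rfl

@[simp] theorem holds_cocycle : cocycle.Holds D.model := by
  have e := hD.crossed.cocycle
  simp [calF, chi, Comon.tensorObj_comul, tensorμ, monoidalComp, MonoidalCoherence.iso] at e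
  exact Rule.holds_of_eq e [3, 4, 5, 6, 7, 8, 9, 10, 11, 12, 13]
    [14, 15, 16, 17, 18, 19, 20, 13] (((D.hw 0).tensor (D.hw 1)).tensor (D.hw 2)) rfl rfl

@[simp] theorem holds_preunit_left : preunit_left.Holds D.model := by
  have e := hD.crossed.preunit_left.symm
  simp [nu, nabla, chi, tensorμ, monoidalComp, MonoidalCoherence.iso] at e
  exact Rule.holds_of_eq e [1, 2, 3, 4, 5, 6, 7, 8, 9, 10, 11, 12] [12] (D.hw 0) rfl rfl

@[simp] theorem holds_preunit_right : preunit_right.Holds D.model := by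
  have e := hD.crossed.preunit_right.symm
  simp [nu, nabla, chi, monoidalComp, MonoidalCoherence.iso] at e
  exact Rule.holds_of_eq e [1, 2, 3, 4, 5, 6, 7, 8, 9] [9] (D.hw 0) rfl rfl

@[simp] theorem holds_preunit_comm : preunit_comm.Holds D.model := by
  have e := hD.crossed.preunit_comm
  simp [nu, nabla, chi, monoidalComp, MonoidalCoherence.iso] at e
  exact Rule.holds_of_eq e [1, 2, 3, 4, 5, 6, 7, 8, 9, 10, 11]
    [12, 13, 14, 15, 9, 16, 17, 11] (D.aw 0) rfl rfl

@[simp] theorem holds_coc_mul_inv : coc_mul_inv.Holds D.model := by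
  have e := hD.inverse.mul_inv
  simp [conv, u2, Comon.tensorObj_comul, tensorμ] at e
  exact Rule.holds_of_eq e [2, 3, 4, 5, 6, 7, 8] [9, 8] ((D.hw 0).tensor (D.hw 1)) rfl rfl

@[simp] theorem holds_inv_mul_coc : inv_mul_coc.Holds D.model := by
  have e := hD.inverse.inv_mul
  simp [conv, u2, Comon.tensorObj_comul, tensorμ] at e
  exact Rule.holds_of_eq e [2, 3, 4, 5, 6, 7, 8] [9, 8] ((D.hw 0).tensor (D.hw 1)) rfl rfl

@[simp] theorem holds_inv_mul_unit : inv_mul_unit.Holds D.model := by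
  have e := hD.inverse.inv_mul_one
  simp [conv, u2, Comon.tensorObj_comul, tensorμ] at e
  exact Rule.holds_of_eq e [2, 3, 4, 5, 6, 7, 8, 9] [9] ((D.hw 0).tensor (D.hw 1)) rfl rfl

@[simp] theorem holds_coc_mul_unit : coc_mul_unit.Holds D.model := by
  have e := hD.regular
  simp [conv, u2, Comon.tensorObj_comul, tensorμ] at e
  exact Rule.holds_of_eq e [2, 3, 4, 5, 6, 7, 8, 9] [9] ((D.hw 0).tensor (D.hw 1)) rfl rfl

@[simp] theorem holds_proj_incl : proj_incl.Holds D.model := by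
  have e := hD.proj_incl
  simp [nabla, chi, monoidalComp, MonoidalCoherence.iso] at e
  exact Rule.holds_of_eq e [2, 3, 4] [5, 6, 4, 7, 3] ((D.aw 0).tensor (D.hw 1)) rfl rfl

@[simp] theorem holds_incl_proj : incl_proj.Holds D.model := by
  have e : D.incl ≫ D.proj = wireHom D.E := hD.incl_proj
  exact Rule.holds_of_eq e [1, 2, 3] [3] (D.ew 0) rfl rfl

end CrossedData

end WeakCrossed

namespace WeakCrossed
open StringDiagram

/-! ### Derived rules -/

section Rules
open Op

/-- `Δ(1)Δ(h) = Δ(h)` -/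
def comul_eq : Rule Srt Op :=
  ⟨[(.h, 0)], [one 1, comul 1 2 3, comul 0 4 5, mul 2 4 6, mul 3 5 7], [comul 0 6 7], [(.h, 6),
  (.h, 7)]⟩

/-- `Δ(h)Δ(1) = Δ(h)` -/
def comul_eq_right : Rule Srt Op :=
  ⟨[(.h, 0)], [one 1, comul 1 2 3, comul 0 4 5, mul 4 2 6, mul 5 3 7], [comul 0 6 7], [(.h, 6),
  (.h, 7)]⟩

/-- `Δ(Π^L(h)) = 1₁Π^L(h) ⊗ 1₂` -/
def comul_piL : Rule Srt Op :=
  ⟨[(.h, 0)], [piL 0 1, comul 1 2 3], [one 4, comul 4 5 3, piL 0 6, mul 5 6 2], [(.h, 2),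
  (.h, 3)]⟩

/-- `Δ(Π^L(h)) = Π^L(h)1₁ ⊗ 1₂` -/
def comul_piL_right : Rule Srt Op :=
  ⟨[(.h, 0)], [piL 0 1, comul 1 2 3], [one 4, comul 4 5 3, piL 0 6, mul 6 5 2], [(.h, 2),
  (.h, 3)]⟩

/-- `Δ(Π^R(h)) = 1₁ ⊗ Π^R(h)1₂` -/
def comul_piR : Rule Srt Op :=
  ⟨[(.h, 0)], [piR 0 1, comul 1 2 3], [one 4, comul 4 2 5, piR 0 6, mul 6 5 3], [(.h, 2),
  (.h, 3)]⟩

/-- `Δ(Π^R(h)) = 1₁ ⊗ 1₂Π^R(h)` -/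
def comul_piR_right : Rule Srt Op :=
  ⟨[(.h, 0)], [piR 0 1, comul 1 2 3], [one 4, comul 4 2 5, piR 0 6, mul 5 6 3], [(.h, 2),
  (.h, 3)]⟩

/-- `Π^R(1₁) ⊗ 1₂ = 1₁ ⊗ 1₂` -/
def piR_one : Rule Srt Op :=
  ⟨[], [one 0, comul 0 1 2, piR 1 3], [one 4, comul 4 3 2], [(.h, 3), (.h, 2)]⟩

/-- `1₁ ⊗ Π^L(1₂) = 1₁ ⊗ 1₂` -/
def one_piL : Rule Srt Op :=
  ⟨[], [one 0, comul 0 1 2, piL 2 3], [one 4, comul 4 1 3], [(.h, 1), (.h, 3)]⟩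

/-- `h₁ ⊗ Π^L(h₂) = 1₁h ⊗ 1₂` -/
def piL_snd : Rule Srt Op :=
  ⟨[(.h, 0)], [comul 0 1 2, piL 2 3], [one 2, comul 2 4 3, mul 4 0 1], [(.h, 1), (.h, 3)]⟩

/-- `Π^R(h₁) ⊗ h₂ = 1₁ ⊗ h1₂` -/
def piR_fst : Rule Srt Op :=
  ⟨[(.h, 0)], [comul 0 1 2, piR 1 3], [one 1, comul 1 3 4, mul 0 4 2], [(.h, 3), (.h, 2)]⟩

/-- `Π^R(h₁) ⊗ Π^L(h₂) = Π^R(h₂) ⊗ Π^L(h₁)` -/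
def piR_piL_comm : Rule Srt Op :=
  ⟨[(.h, 0)], [comul 0 1 2, piR 1 3, piL 2 4], [comul 0 1 2, piL 1 4, piR 2 3], [(.h, 3),
  (.h, 4)]⟩

/-- `Π^L(h₁)h₂ = h` -/
def piL_mul : Rule Srt Op :=
  ⟨[(.h, 0)], [comul 0 1 2, piL 1 3, mul 3 2 4], [wire .h 0 4], [(.h, 4)]⟩

/-- `h₁Π^R(h₂) = h` -/
def mul_piR : Rule Srt Op :=
  ⟨[(.h, 0)], [comul 0 1 2, piR 2 3, mul 1 3 4], [wire .h 0 4], [(.h, 4)]⟩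

/-- `Δ(xΠ^L(y)) = x₁Π^L(y) ⊗ x₂` -/
def comul_mul_piL : Rule Srt Op :=
  ⟨[(.h, 0), (.h, 1)], [piL 1 2, mul 0 2 3, comul 3 4 5], [piL 1 6, comul 0 2 5, mul 2 6 4],
  [(.h, 4), (.h, 5)]⟩

/-- `Δ(Π^L(x)y) = Π^L(x)y₁ ⊗ y₂` -/
def comul_piL_mul : Rule Srt Op :=
  ⟨[(.h, 0), (.h, 1)], [piL 0 2, mul 2 1 3, comul 3 4 5], [piL 0 6, comul 1 2 5, mul 6 2 4],
  [(.h, 4), (.h, 5)]⟩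

/-- `Δ(xΠ^R(y)) = x₁ ⊗ x₂Π^R(y)` -/
def comul_mul_piR : Rule Srt Op :=
  ⟨[(.h, 0), (.h, 1)], [piR 1 2, mul 0 2 3, comul 3 4 5], [piR 1 6, comul 0 4 2, mul 2 6 5],
  [(.h, 4), (.h, 5)]⟩

/-- `Δ(Π^R(x)y) = y₁ ⊗ Π^R(x)y₂` -/
def comul_piR_mul : Rule Srt Op :=
  ⟨[(.h, 0), (.h, 1)], [piR 0 2, mul 2 1 3, comul 3 4 5], [piR 0 6, comul 1 4 2, mul 6 2 5],
  [(.h, 4), (.h, 5)]⟩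

/-- `S(h₁)Π^L(h₂) = S(h)` -/
def anti_piL : Rule Srt Op :=
  ⟨[(.h, 0)], [comul 0 1 2, anti 1 3, piL 2 4, mul 3 4 5], [anti 0 5], [(.h, 5)]⟩

/-- `Π^R(h₁)S(h₂) = S(h)` -/
def piR_anti : Rule Srt Op :=
  ⟨[(.h, 0)], [comul 0 1 2, piR 1 3, anti 2 4, mul 3 4 5], [anti 0 5], [(.h, 5)]⟩

/-- `S(h₁)h₂S(h₃) = S(h)` -/
def anti_id_anti2 : Rule Srt Op :=
  ⟨[(.h, 0)], [comul 0 1 2, comul 2 3 4, anti 1 5, mul 5 3 6, anti 4 7, mul 6 7 8], [anti 0 8],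
  [(.h, 8)]⟩

/-- `Δ(h₁)(S(h₃) ⊗ S(h₂)) = Δ(Π^L(h))` -/
def comul_conv : Rule Srt Op :=
  ⟨[(.h, 0)], [comul 0 1 2, comul 1 3 4, comul 2 5 6, anti 6 7, anti 5 8, mul 3 7 9, mul 4 8 10],
  [piL 0 2, comul 2 9 10], [(.h, 9), (.h, 10)]⟩

/-- `(S(h₂) ⊗ S(h₁))Δ(h₃) = Δ(Π^R(h))` -/
def conv_comul : Rule Srt Op :=
  ⟨[(.h, 0)], [comul 0 1 2, comul 2 3 4, comul 1 5 6, anti 6 7, anti 5 8, mul 7 3 9, mul 8 4 10],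
  [piR 0 4, comul 4 9 10], [(.h, 9), (.h, 10)]⟩

/-- `(S(h₂) ⊗ S(h₁))Δ(h₃)(S(h₅) ⊗ S(h₄)) = S(h₂) ⊗ S(h₁)` -/
def conv_conv : Rule Srt Op :=
  ⟨[(.h, 0)], [comul 0 1 2, comul 2 3 4, comul 3 5 6, comul 1 7 8, anti 8 9, anti 7 10,
  comul 4 11 12, anti 12 13, anti 11 14, mul 5 13 15, mul 9 15 16, mul 6 14 17, mul 10 17 18],
  [comul 0 2 1, anti 1 16, anti 2 18], [(.h, 16), (.h, 18)]⟩

/-- `Δ(S(h)) = S(h₂) ⊗ S(h₁)` -/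
def comul_anti : Rule Srt Op :=
  ⟨[(.h, 0)], [anti 0 1, comul 1 2 3], [comul 0 4 5, anti 5 2, anti 4 3], [(.h, 2), (.h, 3)]⟩

/-- `u₁(h₁)(h₂·a) = h·a` -/
def unitAct_mul_act : Rule Srt Op :=
  ⟨[(.h, 0), (.a, 1)], [comul 0 2 3, unitAct 2 4, act 3 1 5, mulA 4 5 6], [act 0 1 6], [(.a, 6)]⟩

/-- `u₁(h₁)u₁(h₂) = u₁(h)` -/
def unitAct_mul_self : Rule Srt Op :=
  ⟨[(.h, 0)], [comul 0 1 2, unitAct 1 3, unitAct 2 4, mulA 3 4 5], [unitAct 0 5], [(.a, 5)]⟩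

/-- `u₁(h₁)u₁(h₂k) = u₁(hk)` -/
def unitAct_mul_unitAct_mul : Rule Srt Op :=
  ⟨[(.h, 0), (.h, 1)], [comul 0 2 3, unitAct 2 4, mul 3 1 5, unitAct 5 6, mulA 4 6 7], [mul 0 1 2,
  unitAct 2 7], [(.a, 7)]⟩

/-- `u₁(h₁k₁)f(h₂, k₂) = f(h, k)` -/
def unit_mul_coc : Rule Srt Op :=
  ⟨[(.h, 0), (.h, 1)], [comul 0 2 3, comul 1 4 5, mul 2 4 6, unitAct 6 7, coc 3 5 8, mulA 7 8 9],
  [coc 0 1 9], [(.a, 9)]⟩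

/-- `u₁(h₁k₁)g(h₂, k₂) = g(h, k)` -/
def unit_mul_inv : Rule Srt Op :=
  ⟨[(.h, 0), (.h, 1)], [comul 0 2 3, comul 1 4 5, mul 2 4 6, unitAct 6 7, inv 3 5 8, mulA 7 8 9],
  [inv 0 1 9], [(.a, 9)]⟩

/-- `u₁(h₁)f(h₂, k) = f(h, k)` -/
def unitAct_mul_coc : Rule Srt Op :=
  ⟨[(.h, 0), (.h, 1)], [comul 0 2 3, unitAct 2 4, coc 3 1 5, mulA 4 5 6], [coc 0 1 6], [(.a, 6)]⟩

/-- `f(xΠ^R(z), y) = f(x, Π^R(z)y)` -/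
def coc_piR : Rule Srt Op :=
  ⟨[(.h, 0), (.h, 1), (.h, 2)], [piR 1 3, mul 0 3 4, coc 4 2 5], [piR 1 6, mul 6 2 7, coc 0 7 5],
  [(.a, 5)]⟩

/-- `f(xΠ^L(z), y) = f(x, Π^L(z)y)` -/
def coc_piL : Rule Srt Op :=
  ⟨[(.h, 0), (.h, 1), (.h, 2)], [piL 1 3, mul 0 3 4, coc 4 2 5], [piL 1 6, mul 6 2 7, coc 0 7 5],
  [(.a, 5)]⟩

/-- `g(xΠ^R(z), y) = g(x, Π^R(z)y)` -/
def inv_piR : Rule Srt Op :=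
  ⟨[(.h, 0), (.h, 1), (.h, 2)], [piR 1 3, mul 0 3 4, inv 4 2 5], [piR 1 6, mul 6 2 7, inv 0 7 5],
  [(.a, 5)]⟩

/-- `g(xΠ^L(z), y) = g(x, Π^L(z)y)` -/
def inv_piL : Rule Srt Op :=
  ⟨[(.h, 0), (.h, 1), (.h, 2)], [piL 1 3, mul 0 3 4, inv 4 2 5], [piL 1 6, mul 6 2 7, inv 0 7 5],
  [(.a, 5)]⟩

/-- `u₁(h) = f(h, 1)` -/
def coc_one : Rule Srt Op :=
  ⟨[(.h, 0)], [unitAct 0 1], [one 2, coc 0 2 1], [(.a, 1)]⟩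

/-- `u₁(h) = f(1, h)` -/
def one_coc : Rule Srt Op :=
  ⟨[(.h, 0)], [unitAct 0 1], [one 2, coc 2 0 1], [(.a, 1)]⟩

/-- `u₁(xΠ^R(y)) = f(x, Π^R(y))` -/
def coc_piR_snd : Rule Srt Op :=
  ⟨[(.h, 0), (.h, 1)], [piR 1 2, mul 0 2 3, unitAct 3 4], [piR 1 5, coc 0 5 4], [(.a, 4)]⟩

/-- `u₁(Π^L(x)y) = f(Π^L(x), y)` -/
def piL_coc : Rule Srt Op :=
  ⟨[(.h, 0), (.h, 1)], [piL 0 2, mul 2 1 3, unitAct 3 4], [piL 0 5, coc 5 1 4], [(.a, 4)]⟩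

/-- `u₁(Π^R(x)y) = f(Π^R(x), y)` -/
def piR_coc : Rule Srt Op :=
  ⟨[(.h, 0), (.h, 1)], [piR 0 2, mul 2 1 3, unitAct 3 4], [piR 0 5, coc 5 1 4], [(.a, 4)]⟩

/-- `g(1, h) = u₁(h)` -/
def one_inv : Rule Srt Op :=
  ⟨[(.h, 0)], [one 1, inv 1 0 2], [unitAct 0 2], [(.a, 2)]⟩

/-- `u₁(Π^R(x)y) = g(Π^R(x), y)` -/
def piR_inv : Rule Srt Op :=
  ⟨[(.h, 0), (.h, 1)], [piR 0 2, mul 2 1 3, unitAct 3 4], [piR 0 5, inv 5 1 4], [(.a, 4)]⟩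

/-- `g(c₁, y) ⊗ c₂ = u₁(c₁y) ⊗ c₂ for c = Π^L(x)` -/
def inv_comul_piL : Rule Srt Op :=
  ⟨[(.h, 0), (.h, 1)], [piL 0 2, comul 2 3 4, inv 3 1 5], [piL 0 6, comul 6 3 4, mul 3 1 7,
  unitAct 7 5], [(.a, 5), (.h, 4)]⟩

def preunit_comm_left : Rule Srt Op :=
  ⟨[(.a, 0)], [oneA 1, one 2, oneA 3, comul 2 4 5, act 4 3 6, mulA 1 6 7, comul 5 8 9, act 8 0 10,
  mulA 7 10 11], [one 2, comul 2 1 9, act 1 0 11], [(.a, 11), (.h, 9)]⟩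

/-- `1₁·a ⊗ 1₂ = a u₁(1₁) ⊗ 1₂` -/
def act_comul_one : Rule Srt Op :=
  ⟨[(.a, 0)], [one 1, comul 1 2 3, act 2 0 4], [one 5, comul 5 6 3, unitAct 6 7, mulA 0 7 4],
  [(.a, 4), (.h, 3)]⟩

/-- `f(h₁, k₁l₁)g(h₂k₂, l₂) = (h₁·g(k₁, l))f(h₂, k₂)` -/
def act_inv_mul_coc : Rule Srt Op :=
  ⟨[(.h, 0), (.h, 1), (.h, 2)], [comul 0 3 4, comul 1 5 6, comul 2 7 8, mul 5 7 9, coc 3 9 10,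
  mul 4 6 11, inv 11 8 12, mulA 10 12 13], [comul 0 5 14, comul 1 9 8, coc 14 8 15, inv 9 2 7,
  act 5 7 6, mulA 6 15 13], [(.a, 13)]⟩

/-- `p(a u₁(h₁) ⊗ h₂) = p(a ⊗ h)` -/
def proj_nabla : Rule Srt Op :=
  ⟨[(.a, 0), (.h, 1)], [comul 1 2 3, unitAct 2 4, mulA 0 4 5, proj 5 3 6], [proj 0 1 6],
  [(.e, 6)]⟩

def proj_oneA_nabla : Rule Srt Op :=
  ⟨[(.h, 0)], [comul 0 1 2, oneA 3, unitAct 1 4, mulA 3 4 5, proj 5 2 6], [comul 0 1 2,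
  unitAct 1 4, proj 4 2 6], [(.e, 6)]⟩

/-- `p(u₁(h₁) ⊗ h₂) = γ(h)` -/
def comul_proj_unitAct : Rule Srt Op :=
  ⟨[(.h, 0)], [comul 0 1 2, unitAct 1 3, proj 3 2 4], [gam 0 4], [(.e, 4)]⟩

/-- `p(a ⊗ h)p(b ⊗ k) = p(a(h₁·b)f(h₂, k₁) ⊗ h₃k₂)` -/
def proj_mul_proj : Rule Srt Op :=
  ⟨[(.a, 0), (.h, 1), (.a, 2), (.h, 3)], [proj 0 1 4, proj 2 3 5, prod 4 5 6], [comul 1 7 8,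
  act 7 2 9, comul 3 10 11, comul 8 12 13, mul 13 11 14, coc 12 10 5, mulA 9 5 4, mulA 0 4 15,
  proj 15 14 6], [(.e, 6)]⟩

/-- `j(a)γ(h) = p(a ⊗ h)` -/
def emb_mul_gam : Rule Srt Op :=
  ⟨[(.a, 0), (.h, 1)], [emb 0 2, gam 1 3, prod 2 3 4], [proj 0 1 4], [(.e, 4)]⟩

/-- `p(a ⊗ h)γ(k) = p(a f(h₁, k₁) ⊗ h₂k₂)` -/
def proj_mul_gam : Rule Srt Op :=
  ⟨[(.a, 0), (.h, 1), (.h, 2)], [proj 0 1 3, gam 2 4, prod 3 4 5], [comul 2 6 7, comul 1 8 9,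
  mul 9 7 10, coc 8 6 3, mulA 0 3 11, proj 11 10 5], [(.e, 5)]⟩

/-- `γ(h)p(a ⊗ k) = p((h₁·a)f(h₂, k₁) ⊗ h₃k₂)` -/
def gam_mul_proj : Rule Srt Op :=
  ⟨[(.h, 0), (.a, 1), (.h, 2)], [gam 0 3, proj 1 2 4, prod 3 4 5], [comul 0 6 7, act 6 1 8,
  comul 2 9 10, comul 7 11 12, mul 12 10 13, coc 11 9 4, mulA 8 4 3, proj 3 13 5], [(.e, 5)]⟩

/-- `γ⁻¹(h) = p(g(S(h₁)₁, h₂) ⊗ S(h₁)₂)` -/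
def gammaInv_eq : Rule Srt Op :=
  ⟨[(.h, 0)], [comul 0 1 2, anti 1 3, comul 3 4 5, inv 4 2 6, emb 6 7, gam 5 8, prod 7 8 9],
  [comul 0 1 2, anti 1 3, comul 3 4 5, inv 4 2 6, proj 6 5 9], [(.e, 9)]⟩

/-- `γ⁻¹(h₁)γ(h₂) = γ(Π^R(h))` -/
def gammaInv_mul_gamma : Rule Srt Op :=
  ⟨[(.h, 0)], [comul 0 1 2, comul 1 3 4, anti 3 5, comul 5 6 7, inv 6 4 8, emb 8 9, gam 7 10,
  prod 9 10 11, gam 2 12, prod 11 12 13], [piR 0 1, gam 1 13], [(.e, 13)]⟩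

/-- `γ(h₁)γ⁻¹(h₂) = γ(Π^L(h))` -/
def gamma_mul_gammaInv : Rule Srt Op :=
  ⟨[(.h, 0)], [comul 0 1 2, gam 1 3, comul 2 4 5, anti 4 6, comul 6 7 8, inv 7 5 9, emb 9 10,
  gam 8 11, prod 10 11 12, prod 3 12 13], [piL 0 4, gam 4 13], [(.e, 13)]⟩

end Rules

namespace CrossedData

variable {C : Type u} [Category.{v} C] [MonoidalCategory C] [SymmetricCategory C] {H A : C}
  [MonObj H] [ComonObj H] [MonObj A] {D : CrossedData H A} [hD : D.Valid]

/-! ### Weak Hopf algebra identities -/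

@[simp] theorem holds_comul_eq : comul_eq.Holds D.model :=
  .of_check
    -- Each pair is one step: a rule and the names that its wires 0, 1, 2, … take in the current
    -- program. Wires past the end of the list keep their own number.
    [(mul_comul.symm, [1, 0, 8, 6, 7, 2, 3, 4, 5]), (one_mul, [0, 1, 8])]
    (by decide +kernel) (by simp)

@[simp] theorem holds_comul_eq_right : comul_eq_right.Holds D.model :=
  .of_check
    [(mul_comul.symm, [0, 1, 8, 6, 7, 4, 5, 2, 3]), (mul_one, [0, 1, 8])]
    (by decide +kernel) (by simp)

-- Comultiplying 1₂ in Π^L(h) = ε(1₁h)1₂ produces the iterated coproduct of 1. The unit axiom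
-- factors it into two copies of Δ(1), and its two forms decide on which side Π^L(h) appears.
@[simp] theorem holds_comul_piL : comul_piL.Holds D.model :=
  .of_check
    [(piL_def, [0, 1, 7, 8, 9]), (comul_assoc.symm, [7, 10, 3, 8, 2, 1]), (comul_comul_one_op, [7,
    10, 3, 8, 2, 1, 6, 4, 5]), (piL_def.symm, [0, 6, 1, 8, 9])]
    (by decide +kernel) (by simp)

@[simp] theorem holds_comul_piL_right : comul_piL_right.Holds D.model :=
  .of_check
    [(piL_def, [0, 1, 7, 8, 9]), (comul_assoc.symm, [7, 10, 3, 8, 2, 1]), (comul_comul_one, [7,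
    10, 3, 8, 2, 1, 6, 4, 5]), (piL_def.symm, [0, 6, 1, 8, 9])]
    (by decide +kernel) (by simp)

@[simp] theorem holds_comul_piR : comul_piR.Holds D.model :=
  .of_check
    [(piR_def, [0, 1, 7, 8, 9]), (comul_comul_one_op, [7, 1, 8, 2, 3, 4, 5, 10, 6]),
    (piR_def.symm, [0, 6, 10, 8, 9])]
    (by decide +kernel) (by simp)

@[simp] theorem holds_comul_piR_right : comul_piR_right.Holds D.model :=
  .of_check
    [(piR_def, [0, 1, 7, 8, 9]), (comul_comul_one, [7, 1, 8, 2, 3, 4, 5, 10, 6]),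
    (piR_def.symm, [0, 6, 10, 8, 9])]
    (by decide +kernel) (by simp)

-- By the unit axiom 1′₁ ⊗ 1₁1′₂ ⊗ 1₂ is the iterated coproduct of 1, and ε removes its middle
-- factor.
@[simp] theorem holds_piR_one : piR_one.Holds D.model :=
  .of_check
    [(piR_def, [1, 3, 5, 6, 7]), (comul_comul_one_op.symm, [4, 8, 2, 3, 7, 5, 6, 0, 1]),
    (comul_assoc, [4, 8, 2, 3, 7, 0]), (counit_comul, [0, 7])]
    (by decide +kernel) (by simp)

@[simp] theorem holds_one_piL : one_piL.Holds D.model :=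
  .of_check
    [(piL_def, [2, 3, 5, 6, 7]), (comul_comul_one_op.symm, [4, 8, 3, 1, 7, 0, 2, 5, 6]),
    (comul_assoc, [4, 8, 3, 1, 7, 0]), (counit_comul, [0, 7, 3])]
    (by decide +kernel) (by simp)

-- After Δ(h) = Δ(1)Δ(h), the unit axiom absorbs the Δ(1) inside Π^L(1₂h₂), giving 1₁h₁ε(1₂h₂) ⊗ 1₃;
-- the counit then acts on the second factor of Δ(1₁h).
@[simp] theorem holds_piL_snd : piL_snd.Holds D.model :=
  .of_check
    [(comul_eq.symm, [0, 5, 6, 7, 8, 9, 1, 2]), (piL_def, [2, 3, 10, 11, 12]),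
    (mul_assoc.symm, [11, 7, 9, 13, 12, 2]), (comul_comul_one_op.symm, [2, 4, 3, 6, 13, 5, 7, 10,
    11]), (mul_comul.symm, [4, 0, 5, 1, 12, 6, 13, 8, 9]), (comul_counit, [5, 1, 12])]
    (by decide +kernel) (by simp)

@[simp] theorem holds_piR_fst : piR_fst.Holds D.model :=
  .of_check
    [(comul_eq_right.symm, [0, 4, 5, 6, 7, 8, 1, 2]), (piR_def, [1, 3, 9, 10, 11]),
    (mul_assoc, [7, 5, 10, 1, 11, 12]), (comul_comul_one_op.symm, [1, 13, 6, 3, 12, 9, 10, 4, 5]),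
    (comul_assoc, [1, 13, 6, 3, 12, 4]), (mul_comul.symm, [0, 4, 5, 11, 2, 7, 8, 12, 6]),
    (counit_comul, [5, 11])]
    (by decide +kernel) (by simp)

-- Both sides equal ε(1′₁h1₂)1₁ ⊗ 1′₂, by the two expansions of ε(xyz).
@[simp] theorem holds_piR_piL_comm : piR_piL_comm.Holds D.model :=
  .of_check
    [(piR_def, [1, 3, 5, 6, 7]), (piL_def, [2, 4, 8, 9, 10]), (counit_mul_mul_cop.symm, [9, 0, 6,
    11, 12, 1, 2, 10, 7]), (counit_mul_mul, [9, 0, 6, 11, 12, 1, 2, 7, 10]), (piL_def.symm, [1, 4,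
    8, 9, 7]), (piR_def.symm, [2, 3, 5, 6, 10])]
    (by decide +kernel) (by simp)

@[simp] theorem holds_piL_mul : piL_mul.Holds D.model :=
  .of_check
    [(piL_def, [1, 3, 5, 6, 7]), (mul_comul.symm, [5, 0, 8, 7, 4, 6, 3, 1, 2]), (one_mul, [0, 5,
    8]), (counit_comul, [0, 7, 4])]
    (by decide +kernel) (by simp)

@[simp] theorem holds_mul_piR : mul_piR.Holds D.model :=
  .of_check
    [(piR_def, [2, 3, 5, 6, 7]), (mul_comul.symm, [0, 5, 8, 4, 7, 1, 2, 3, 6]), (mul_one, [0, 5,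
    8]), (comul_counit, [0, 4, 7])]
    (by decide +kernel) (by simp)

-- Δ(Π^L(y)) differs from Δ(1) only by Π^L(y) in one factor, and Δ(x) absorbs Δ(1). This rule and
-- the three after it let Π^L and Π^R pass between the two arguments of f and of g.
@[simp] theorem holds_comul_mul_piL : comul_mul_piL.Holds D.model :=
  .of_check
    [(mul_comul, [0, 2, 3, 4, 5, 7, 8, 9, 10]), (comul_piL, [1, 2, 9, 10, 3, 11]),
    (mul_assoc.symm, [7, 11, 6, 2, 4, 9]), (comul_eq_right, [0, 3, 11, 10, 7, 8, 2, 5])]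
    (by decide +kernel) (by simp)

@[simp] theorem holds_comul_piL_mul : comul_piL_mul.Holds D.model :=
  .of_check
    [(mul_comul, [2, 1, 3, 4, 5, 7, 8, 9, 10]), (comul_piL_right, [0, 2, 7, 8, 3, 11]),
    (mul_assoc, [6, 11, 9, 7, 4, 2]), (comul_eq, [1, 3, 11, 8, 9, 10, 2, 5])]
    (by decide +kernel) (by simp)

@[simp] theorem holds_comul_mul_piR : comul_mul_piR.Holds D.model :=
  .of_check
    [(mul_comul, [0, 2, 3, 4, 5, 7, 8, 9, 10]), (comul_piR_right, [1, 2, 9, 10, 3, 11]),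
    (mul_assoc.symm, [8, 11, 6, 2, 5, 10]), (comul_eq_right, [0, 3, 9, 11, 7, 8, 4, 2])]
    (by decide +kernel) (by simp)

@[simp] theorem holds_comul_piR_mul : comul_piR_mul.Holds D.model :=
  .of_check
    [(mul_comul, [2, 1, 3, 4, 5, 7, 8, 9, 10]), (comul_piR, [0, 2, 7, 8, 3, 11]), (mul_assoc, [6,
    11, 10, 8, 5, 2]), (comul_eq, [1, 3, 7, 11, 9, 10, 4, 2])]
    (by decide +kernel) (by simp)

@[simp] theorem holds_anti_piL : anti_piL.Holds D.model :=
  .of_check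
    [(id_anti.symm, [2, 6, 7, 8]), (mul_assoc.symm, [3, 6, 8, 9, 5, 4]), (comul_assoc.symm, [0, 4,
    7, 1, 6, 2]), (anti_id_anti, [0, 4, 7, 1, 6, 3, 8, 9, 5])]
    (by decide +kernel) (by simp)

@[simp] theorem holds_piR_anti : piR_anti.Holds D.model :=
  .of_check
    [(anti_id.symm, [1, 6, 7, 8, 3]), (anti_id_anti, [0, 1, 2, 6, 7, 8, 4, 3, 5])]
    (by decide +kernel) (by simp)

@[simp] theorem holds_anti_id_anti2 : anti_id_anti2.Holds D.model :=
  .of_check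
    [(comul_assoc.symm, [0, 9, 4, 1, 3, 2]), (anti_id_anti, [0, 9, 4, 1, 3, 5, 7, 6])]
    (by decide +kernel) (by simp)

-- h₁S(h₄) ⊗ h₂S(h₃) = h₁S(h₃) ⊗ Π^L(h₂) = 1₁h₁S(h₂) ⊗ 1₂ = 1₁Π^L(h) ⊗ 1₂, the middle equality being
-- `piL_snd`.
@[simp] theorem holds_comul_conv : comul_conv.Holds D.model :=
  .of_check
    [(comul_assoc, [0, 1, 2, 3, 4, 11]), (comul_assoc.symm, [11, 1, 6, 4, 5, 2]), (id_anti, [1, 4,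
    5, 8, 10]), (comul_assoc.symm, [0, 2, 6, 3, 1, 11]), (piL_snd, [2, 3, 1, 10]), (mul_assoc, [4,
    2, 7, 3, 9]), (id_anti, [0, 2, 6, 7, 5]), (comul_piL.symm, [0, 2, 9, 10, 1, 4, 5])]
    (by decide +kernel) (by simp)

@[simp] theorem holds_conv_comul : conv_comul.Holds D.model :=
  .of_check
    [(comul_assoc, [0, 1, 2, 5, 6, 11]), (comul_assoc.symm, [11, 1, 4, 6, 3, 2]), (anti_id, [1, 6,
    3, 7, 9]), (piR_fst, [11, 1, 4, 9, 2]), (mul_assoc.symm, [8, 11, 2, 3, 10, 4]), (anti_id, [0,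
    5, 11, 8, 3]), (comul_piR.symm, [0, 4, 9, 10, 1, 2, 3])]
    (by decide +kernel) (by simp)

-- The inner products collapse to Π^R(h₂)S(h₄) ⊗ S(h₁)Π^L(h₃). Exchanging Π^R with Π^L by
-- `piR_piL_comm` places each beside the antipode that absorbs it.
@[simp] theorem holds_conv_conv : conv_conv.Holds D.model :=
  .of_check
    [(comul_assoc, [0, 1, 2, 7, 8, 19]), (comul_assoc, [2, 3, 4, 5, 6, 1]), (comul_assoc.symm, [1,
    3, 12, 6, 11, 4]), (id_anti, [3, 6, 11, 14, 17]), (mul_assoc.symm, [9, 5, 13, 4, 16, 15]),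
    (comul_assoc.symm, [19, 6, 1, 8, 5, 2]), (anti_id, [6, 8, 5, 9]), (comul_assoc.symm, [19, 2,
    12, 6, 3, 1]), (piR_piL_comm, [2, 6, 3, 4, 17]), (comul_assoc, [19, 2, 12, 6, 3, 1]),
    (piR_anti, [1, 3, 12, 4, 13, 16]), (comul_assoc.symm, [0, 2, 1, 7, 6, 19]), (anti_piL, [2, 7,
    6, 10, 17, 18])]
    (by decide +kernel) (by simp)

-- Uniqueness of weak inverses under convolution of maps from H to H ⊗ H. For X = Δ∘S and Y = (S ⊗
-- S)∘c∘Δ one has X * Δ = Y * Δ = Δ∘Π^R, Δ * X = Δ * Y = Δ∘Π^L, X * Δ * X = X and Y * Δ * Y = Y;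
-- hence X = Y * Δ * X = Y * Δ * Y = Y.
@[simp] theorem holds_comul_anti : comul_anti.Holds D.model :=
  .of_check
    [(anti_id_anti2.symm, [0, 6, 7, 8, 9, 10, 11, 12, 1]), (mul_assoc, [10, 8, 12, 11, 1, 13]),
    (mul_comul, [10, 13, 1, 2, 3, 11, 14, 4, 15]), (mul_comul, [8, 12, 13, 4, 15, 1, 16, 17, 18]),
    (mul_assoc.symm, [11, 1, 17, 13, 2, 4]), (mul_assoc.symm, [14, 16, 18, 4, 3, 15]),
    (mul_comul.symm, [10, 8, 15, 13, 4, 11, 14, 1, 16]), (comul_assoc.symm, [0, 1, 9, 6, 8, 7]),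
    (anti_id, [1, 6, 8, 10, 15]), (conv_comul.symm, [1, 6, 7, 8, 15, 10, 11, 14, 16, 13, 4]),
    (mul_assoc, [14, 8, 17, 13, 2, 19]), (mul_assoc, [16, 15, 18, 4, 3, 13]), (comul_assoc, [0, 1,
    9, 6, 7, 4]), (comul_assoc, [0, 6, 4, 10, 11, 1]), (mul_comul.symm, [7, 12, 6, 19, 13, 8, 15,
    17, 18]), (id_anti, [4, 7, 9, 12, 6]), (comul_conv.symm, [4, 7, 6, 8, 9, 12, 15, 17, 18, 19,
    13]), (comul_assoc.symm, [0, 5, 4, 10, 11, 1]), (conv_conv, [0, 5, 4, 7, 6, 8, 9, 10, 11, 14,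
    16, 12, 15, 17, 18, 19, 2, 13, 3])]
    (by decide +kernel) (by simp)

/-! ### The weak action, the cocycle and its inverse -/

@[simp] theorem holds_unitAct_mul_act : unitAct_mul_act.Holds D.model :=
  .of_check
    [(unitAct_def, [2, 4, 7]), (act_mul.symm, [0, 7, 1, 8, 6, 2, 3, 4, 5]), (oneA_mul, [1, 7, 8])]
    (by decide +kernel) (by simp)

@[simp] theorem holds_unitAct_mul_self : unitAct_mul_self.Holds D.model :=
  .of_check
    [(unitAct_def, [2, 4, 6]), (unitAct_mul_act, [0, 6, 1, 2, 3, 4, 5]), (unitAct_def.symm, [0, 5,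
    6])]
    (by decide +kernel) (by simp)

@[simp] theorem holds_unitAct_mul_unitAct_mul : unitAct_mul_unitAct_mul.Holds D.model :=
  .of_check
    [(unitAct_mul, [3, 1, 5, 6, 8]), (unitAct_mul_act, [0, 8, 2, 3, 4, 6, 7]),
    (unitAct_mul.symm, [0, 1, 2, 7, 8])]
    (by decide +kernel) (by simp)

-- u₂ * f = (f * g) * f = f * (g * f) = f * u₂ = f.
@[simp] theorem holds_unit_mul_coc : unit_mul_coc.Holds D.model :=
  .of_check
    [(coc_mul_inv.symm, [2, 4, 10, 11, 12, 13, 14, 15, 7, 6]), (comul_assoc, [1, 4, 5, 12, 13,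
    6]), (comul_assoc, [0, 2, 3, 10, 11, 4]), (mulA_assoc, [14, 15, 8, 7, 9, 2]),
    (inv_mul_coc, [4, 6, 11, 3, 13, 5, 15, 8, 2, 7]), (coc_mul_unit, [0, 1, 10, 4, 12, 6, 14, 7,
    2])]
    (by decide +kernel) (by simp)

@[simp] theorem holds_unit_mul_inv : unit_mul_inv.Holds D.model :=
  .of_check
    [(inv_mul_coc.symm, [2, 4, 10, 11, 12, 13, 14, 15, 7, 6]), (comul_assoc, [1, 4, 5, 12, 13,
    6]), (comul_assoc, [0, 2, 3, 10, 11, 4]), (mulA_assoc, [14, 15, 8, 7, 9, 2]),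
    (coc_mul_inv, [4, 6, 11, 3, 13, 5, 15, 8, 2, 7]), (inv_mul_unit, [0, 1, 10, 4, 12, 6, 14, 7,
    2])]
    (by decide +kernel) (by simp)

@[simp] theorem holds_unitAct_mul_coc : unitAct_mul_coc.Holds D.model :=
  .of_check
    [(unit_mul_coc.symm, [3, 1, 7, 8, 9, 10, 11, 12, 13, 5]), (comul_assoc.symm, [0, 14, 8, 2, 7,
    3]), (mulA_assoc.symm, [4, 12, 13, 3, 6]), (unitAct_mul_unitAct_mul, [14, 9, 2, 7, 4, 11, 12,
    3]), (unit_mul_coc, [0, 1, 14, 8, 9, 10, 2, 3, 13, 6])]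
    (by decide +kernel) (by simp)

-- Write f = f * u₂. Comultiplication leaves Π^R(z) in the second tensor factor, hence only inside
-- u₂, which sees nothing but the product of its arguments. For Π^L the first factor matters, so f =
-- u₂ * f is used instead.
@[simp] theorem holds_coc_piR : coc_piR.Holds D.model :=
  .of_check
    [(coc_mul_unit.symm, [4, 2, 8, 7, 9, 6, 10, 11, 12, 5]), (comul_mul_piR, [0, 1, 3, 4, 8, 7,
    13]), (mul_assoc, [3, 13, 6, 7, 11, 4]), (comul_piR_mul.symm, [1, 2, 6, 7, 9, 4, 13]),
    (coc_mul_unit, [0, 7, 8, 3, 9, 4, 10, 11, 12, 5])]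
    (by decide +kernel) (by simp)

@[simp] theorem holds_coc_piL : coc_piL.Holds D.model :=
  .of_check
    [(unit_mul_coc.symm, [4, 2, 7, 8, 6, 9, 10, 11, 12, 5]), (comul_mul_piL, [0, 1, 3, 4, 7, 8,
    13]), (mul_assoc, [3, 13, 6, 7, 10, 4]), (comul_piL_mul.symm, [1, 2, 6, 7, 4, 9, 13]),
    (unit_mul_coc, [0, 7, 3, 8, 4, 9, 10, 11, 12, 5])]
    (by decide +kernel) (by simp)

@[simp] theorem holds_inv_piR : inv_piR.Holds D.model :=
  .of_check
    [(inv_mul_unit.symm, [4, 2, 8, 7, 9, 6, 10, 11, 12, 5]), (comul_mul_piR, [0, 1, 3, 4, 8, 7,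
    13]), (mul_assoc, [3, 13, 6, 7, 11, 4]), (comul_piR_mul.symm, [1, 2, 6, 7, 9, 4, 13]),
    (inv_mul_unit, [0, 7, 8, 3, 9, 4, 10, 11, 12, 5])]
    (by decide +kernel) (by simp)

@[simp] theorem holds_inv_piL : inv_piL.Holds D.model :=
  .of_check
    [(unit_mul_inv.symm, [4, 2, 7, 8, 6, 9, 10, 11, 12, 5]), (comul_mul_piL, [0, 1, 3, 4, 7, 8,
    13]), (mul_assoc, [3, 13, 6, 7, 10, 4]), (comul_piL_mul.symm, [1, 2, 6, 7, 4, 9, 13]),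
    (unit_mul_inv, [0, 7, 3, 8, 4, 9, 10, 11, 12, 5])]
    (by decide +kernel) (by simp)

-- The left preunit condition reads u₁(h) = u₁(h₁1₁)f(h₂, 1₂), and the right side is (u₂ * f)(h, 1).
@[simp] theorem holds_coc_one : coc_one.Holds D.model :=
  .of_check
    [(preunit_left.symm, [0, 3, 4, 5, 2, 6, 7, 8, 9, 10, 11, 12, 1]), (oneA_mul, [9, 5, 10]),
    (unitAct_def.symm, [7, 9, 6]), (unitAct_mul.symm, [3, 7, 5, 11, 9]), (unit_mul_coc, [0, 2, 3,
    4, 7, 8, 5, 11, 12, 1])]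
    (by decide +kernel) (by simp)

@[simp] theorem holds_one_coc : one_coc.Holds D.model :=
  .of_check
    [(preunit_right.symm, [0, 3, 2, 4, 5, 6, 7, 8, 9, 1]), (mulA_assoc, [3, 7, 9, 8, 1, 10]),
    (oneA_mul, [10, 3, 1]), (unitAct_def.symm, [5, 7, 4]), (unitAct_mul_coc, [2, 0, 5, 6, 7, 9,
    1])]
    (by decide +kernel) (by simp)

@[simp] theorem holds_coc_piR_snd : coc_piR_snd.Holds D.model :=
  .of_check
    [(coc_one, [3, 4, 6]), (coc_piR, [0, 1, 6, 2, 3, 4, 5]), (mul_one, [5, 6, 7])]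
    (by decide +kernel) (by simp)

@[simp] theorem holds_piL_coc : piL_coc.Holds D.model :=
  .of_check
    [(one_coc, [3, 4, 6]), (coc_piL.symm, [6, 0, 1, 5, 7, 4, 2, 3]), (one_mul, [5, 6, 7])]
    (by decide +kernel) (by simp)

@[simp] theorem holds_piR_coc : piR_coc.Holds D.model :=
  .of_check
    [(one_coc, [3, 4, 6]), (coc_piR.symm, [6, 0, 1, 5, 7, 4, 2, 3]), (one_mul, [5, 6, 7])]
    (by decide +kernel) (by simp)

-- In g(1, h) = g(1₁, h₁)u₁(1₂h₂) the factor 1₂ equals Π^L(1₂), so u₁(1₂h₂) = f(1₂, h₂) and g * f =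
-- u₂ applies.
@[simp] theorem holds_one_inv : one_inv.Holds D.model :=
  .of_check
    [(inv_mul_unit.symm, [1, 0, 3, 4, 5, 6, 7, 8, 9, 2]), (one_piL.symm, [10, 3, 11, 4, 1]),
    (piL_coc, [11, 6, 4, 8, 9, 1]), (one_piL, [10, 3, 11, 1]), (inv_mul_coc, [4, 0, 3, 1, 5, 6, 7,
    9, 2, 8]), (one_mul, [0, 4, 8])]
    (by decide +kernel) (by simp)

@[simp] theorem holds_piR_inv : piR_inv.Holds D.model :=
  .of_check
    [(one_inv.symm, [3, 6, 4]), (inv_piR.symm, [6, 0, 1, 5, 7, 4, 2, 3]), (one_mul, [5, 6, 7])]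
    (by decide +kernel) (by simp)

-- Here c₁ ⊗ c₂ = 1₁Π^L(x) ⊗ 1₂. Moving Π^L(x) into the second argument of g leaves 1₁ = Π^R(1₁) in
-- the first, where g is u₁ of the product.
@[simp] theorem holds_inv_comul_piL : inv_comul_piL.Holds D.model :=
  .of_check
    [(comul_piL, [0, 2, 3, 4, 8, 9]), (inv_piL, [9, 0, 1, 6, 3, 5, 2, 10]), (piR_one.symm, [3, 6,
    4, 9, 8]), (piR_inv.symm, [6, 10, 8, 7, 5, 9]), (piR_one, [3, 6, 4, 8, 9]),
    (mul_assoc.symm, [8, 2, 1, 3, 7, 10]), (comul_piL.symm, [0, 6, 3, 4, 9, 8, 2])]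
    (by decide +kernel) (by simp)

@[simp] theorem holds_preunit_comm_left : preunit_comm_left.Holds D.model :=
  .of_check
    [(mulA_assoc, [1, 6, 10, 7, 11, 12]), (oneA_mul, [12, 1, 11]), (unitAct_def.symm, [4, 6, 3]),
    (comul_assoc.symm, [2, 1, 9, 4, 8]), (unitAct_mul_act, [1, 0, 4, 8, 6, 10, 11])]
    (by decide +kernel) (by simp)

-- This is the commutation of ν with `A`, simplified: u₁(1₁)(1₂·a) ⊗ 1₃ contracts to 1₁·a ⊗ 1₂.
@[simp] theorem holds_act_comul_one : act_comul_one.Holds D.model :=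
  .of_check
    [(preunit_comm_left.symm, [0, 2, 1, 8, 9, 10, 11, 12, 13, 3, 14, 4]), (preunit_comm, [0, 2, 1,
    8, 9, 10, 11, 12, 13, 3, 14, 4, 15, 5, 16, 6, 7]), (oneA_mul, [7, 15, 17]),
    (unitAct_def.symm, [6, 7, 16])]
    (by decide +kernel) (by simp)

-- Insert u₁(h₁k₁l₁) = h₁·(g(k₁, l₁)f(k₂, l₂)) before f and distribute the action. The cocycle
-- condition then gives (h₁·g(k₁, l₁))f(h₂, k₂)f(h₃k₃, l₂)g(h₄k₄, l₃), whose last two factors are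
-- h₃k₃·u₁(l₂). The twisted module condition carries this past f as h₂·u₁(k₂l₂), which g * u₂ = g
-- absorbs.
@[simp] theorem holds_act_inv_mul_coc : act_inv_mul_coc.Holds D.model :=
  .of_check
    [(unit_mul_coc.symm, [3, 9, 16, 17, 18, 19, 20, 14, 21, 10]), (comul_assoc, [0, 3, 4, 16, 17,
    15]), (mulA_assoc, [14, 21, 12, 10, 13, 3]), (mul_comul, [5, 7, 9, 18, 19, 10, 22, 23, 24]),
    (comul_assoc, [1, 5, 6, 10, 22, 9]), (comul_assoc, [2, 7, 8, 23, 24]), (unitAct_mul, [16, 18,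
    20, 14, 7]), (inv_mul_coc.symm, [10, 23, 20, 25, 26, 27, 28, 29, 7, 18]), (comul_assoc, [2,
    23, 5, 26, 27, 18]), (comul_assoc, [1, 10, 9, 20, 25, 23]), (act_mul, [16, 28, 29, 7, 14, 10,
    30, 31, 32]), (comul_assoc, [0, 16, 15, 10, 30, 7]), (mulA_assoc, [31, 32, 3, 14, 13, 16]),
    (comul_assoc.symm, [18, 14, 8, 27, 24]), (comul_assoc.symm, [23, 5, 6, 25, 22, 9]),
    (comul_assoc.symm, [7, 9, 4, 30, 17, 15]), (mulA_assoc.symm, [32, 21, 12, 15, 16, 3]),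
    (cocycle, [9, 5, 14, 25, 22, 27, 24, 29, 19, 30, 17, 32, 21, 15, 3, 33, 34, 35, 36, 37, 38]),
    (comul_assoc, [23, 5, 6, 34, 35, 17]), (comul_assoc, [7, 9, 4, 3, 33]), (mulA_assoc, [36, 38,
    12, 15, 16, 9]), (mul_comul.symm, [5, 17, 19, 37, 11, 33, 4, 35, 6]), (coc_mul_inv, [19, 18,
    37, 11, 14, 8, 38, 12, 9, 4]), (unitAct_mul, [19, 18, 4, 9, 6]), (twisted, [7, 23, 6, 3, 5,
    34, 17, 36, 19, 9, 16, 4, 8, 11, 12, 14, 21, 15]), (unitAct_mul.symm, [4, 18, 3, 11, 6]),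
    (comul_assoc.symm, [0, 5, 14, 10, 12, 7]), (mulA_assoc.symm, [31, 21, 15, 6, 13, 16]),
    (act_mul.symm, [5, 28, 11, 7, 6, 10, 12, 31, 21]), (comul_assoc.symm, [1, 9, 8, 20, 4, 23]),
    (inv_mul_unit, [9, 2, 20, 4, 26, 18, 28, 3, 11, 7])]
    (by decide +kernel) (by simp)

/-! ### The product of E and the convolution products of γ and γ⁻¹ -/

@[simp] theorem holds_proj_nabla : proj_nabla.Holds D.model :=
  .of_check
    [(unitAct_def, [2, 4, 7]), (proj_incl.symm, [0, 1, 8, 5, 3, 7, 2, 4]), (incl_proj, [8, 5, 3,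
    6])]
    (by decide +kernel) (by simp)

omit hD in
@[simp] theorem holds_proj_oneA_nabla : proj_oneA_nabla.Holds D.model :=
  .of_check
    [(oneA_mul, [4, 3, 5])]
    (by decide +kernel) (by simp)

@[simp] theorem holds_comul_proj_unitAct : comul_proj_unitAct.Holds D.model :=
  .of_check
    [(proj_oneA_nabla.symm, [0, 1, 2, 5, 3, 6, 4]), (proj_nabla, [5, 0, 1, 2, 3, 6, 4]),
    (gam_def.symm, [0, 4, 5])]
    (by decide +kernel) (by simp)

-- The idempotents in front of the two factors only insert u₁(h₁) and u₁(k₁); the action absorbs the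
-- first, and u₂ * f = f absorbs the second.
@[simp] theorem holds_proj_mul_proj : proj_mul_proj.Holds D.model :=
  .of_check
    [(prod_def, [4, 5, 6, 16, 7, 8, 12, 17, 18, 9, 19, 20, 13, 21, 11, 22, 14, 15]),
    (mulA_assoc, [16, 9, 22, 19, 15, 10]), (proj_incl, [0, 1, 4, 16, 7, 19, 23, 24]),
    (mulA_assoc, [0, 24, 10, 16, 15, 4]), (proj_incl, [2, 3, 5, 8, 12, 16, 25, 26]),
    (unitAct_def.symm, [23, 24, 19]), (unitAct_def.symm, [25, 26, 16]), (comul_assoc.symm, [1, 5,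
    18, 23, 17, 7]), (mulA_assoc.symm, [24, 9, 22, 16, 4, 10]), (unitAct_mul_act, [5, 8, 23, 17,
    24, 9, 16]), (act_mul, [5, 2, 26, 8, 16, 7, 17, 9, 19]), (comul_assoc, [1, 5, 18, 7, 17, 8]),
    (mulA_assoc, [9, 19, 22, 16]), (unitAct_mul.symm, [17, 25, 16, 19, 26]),
    (comul_assoc.symm, [3, 10, 11, 25, 21, 12]), (comul_assoc.symm, [8, 12, 13, 17, 20, 18]),
    (unit_mul_coc, [12, 10, 17, 20, 25, 21, 16, 19, 22, 5])]
    (by decide +kernel) (by simp)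

-- The product is p(a f(1₁, h₁) ⊗ 1₂h₂). As 1₁ = Π^R(1₁), the value of f is u₁(1₁h₁); then Δ(1)Δ(h)
-- = Δ(h), and p absorbs u₁(h₁).
@[simp] theorem holds_emb_mul_gam : emb_mul_gam.Holds D.model :=
  .of_check
    [(emb_def, [0, 2, 5, 6, 7, 8, 9, 10, 11, 12]), (oneA_mul, [10, 5, 11]), (gam_def, [1, 3, 5]),
    (unitAct_def.symm, [8, 10, 7]), (proj_nabla, [0, 6, 8, 9, 10, 12, 2]), (proj_mul_proj, [0, 6,
    5, 1, 2, 3, 4]), (unitAct_def.symm, [7, 9, 5]), (comul_assoc.symm, [6, 5, 13, 7, 12, 8]),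
    (unitAct_mul_coc, [5, 10, 7, 12, 9, 3, 2]), (piR_one.symm, [3, 7, 13, 5, 6]),
    (piR_coc.symm, [7, 10, 6, 8, 2]), (piR_one, [3, 7, 13, 6, 5]), (comul_eq, [1, 5, 6, 13, 10,
    11, 8, 14]), (proj_nabla, [0, 1, 8, 14, 2, 15, 4])]
    (by decide +kernel) (by simp)

@[simp] theorem holds_proj_mul_gam : proj_mul_gam.Holds D.model :=
  .of_check
    [(gam_def, [2, 4, 8]), (proj_mul_proj, [0, 1, 8, 2, 3, 4, 5, 12, 13, 14, 6, 7, 15, 9, 10,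
    11]), (unitAct_def.symm, [12, 14, 8]), (comul_assoc.symm, [1, 8, 9, 12, 15, 13]),
    (unitAct_mul_coc, [8, 6, 12, 15, 14, 4, 3])]
    (by decide +kernel) (by simp)

@[simp] theorem holds_gam_mul_proj : gam_mul_proj.Holds D.model :=
  .of_check
    [(gam_def, [0, 3, 14]), (proj_mul_proj, [14, 0, 1, 2, 3, 4, 5, 6, 7, 8, 9, 10, 11, 12, 13]),
    (oneA_mul, [3, 14, 15])]
    (by decide +kernel) (by simp)

@[simp] theorem holds_gammaInv_eq : gammaInv_eq.Holds D.model :=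
  .of_check
    [(emb_mul_gam, [6, 5, 7, 8, 9])]
    (by decide +kernel) (by simp)

@[simp] theorem holds_gammaInv_mul_gamma : gammaInv_mul_gamma.Holds D.model :=
  .of_check
    [(gammaInv_eq, [1, 3, 4, 5, 6, 7, 8, 9, 10, 11]), (comul_assoc, [0, 1, 2, 3, 4, 9]),
    (proj_mul_gam, [8, 7, 2, 11, 12, 13, 1, 10, 14, 15, 16, 17]), (comul_assoc.symm, [9, 12, 10,
    4, 1, 2]), (comul_assoc.symm, [5, 2, 15, 6, 14, 7]), (inv_mul_coc, [2, 12, 6, 14, 4, 1, 8, 11,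
    17, 7]), (mul_comul.symm, [5, 9, 1, 7, 16, 2, 15, 12, 10]), (anti_id, [0, 3, 9, 5, 1]),
    (comul_proj_unitAct, [1, 7, 16, 17, 13])]
    (by decide +kernel) (by simp)

-- In the A ⊗ H part, `act_inv_mul_coc` and `comul_anti` lead to f(h₁, Π^R(h₃))g(c₁, h₄) ⊗ c₂ with c
-- = Π^L(h₂). This becomes u₁(h₁)u₁(1₁h₂) ⊗ 1₂, then u₁(h)u₁(1₁) ⊗ 1₂ = Π^L(h)·u₁(1₁) ⊗ 1₂ =
-- u₁(Π^L(h)₁) ⊗ Π^L(h)₂.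
@[simp] theorem holds_gamma_mul_gammaInv : gamma_mul_gammaInv.Holds D.model :=
  .of_check
    [(gammaInv_eq, [2, 4, 5, 6, 7, 8, 9, 10, 11, 12]), (gam_mul_proj, [1, 9, 8, 3, 12, 13, 10, 11,
    14, 15, 16, 17, 18, 19]), (comul_assoc.symm, [6, 20, 16, 7, 15, 8]), (comul_assoc.symm, [1, 8,
    18, 10, 17, 11]), (comul_assoc, [0, 1, 2, 8, 18, 11]), (act_inv_mul_coc.symm, [8, 20, 5, 1,
    21, 10, 14, 9, 15, 7, 22, 23, 24, 3, 17, 12]), (comul_assoc, [0, 8, 11, 1, 21, 12]),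
    (comul_assoc, [6, 20, 16, 10, 14, 8]), (comul_assoc.symm, [12, 17, 2, 21, 18, 11]),
    (mul_comul.symm, [17, 8, 11, 23, 19, 21, 18, 14, 16]), (comul_anti, [4, 6, 10, 8, 14, 16]),
    (comul_assoc, [2, 4, 5, 14, 16, 6]), (comul_assoc.symm, [12, 4, 6, 17, 14, 2]), (id_anti, [4,
    17, 14, 8, 11]), (comul_assoc.symm, [6, 2, 15, 16, 9]), (anti_id, [2, 16, 9, 10, 7]),
    (coc_piR_snd.symm, [1, 2, 5, 8, 22, 7]), (inv_comul_piL, [4, 15, 11, 23, 19, 24, 7, 9]),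
    (comul_assoc.symm, [12, 10, 15, 4, 2, 6]), (piR_piL_comm.symm, [10, 4, 2, 5, 7]),
    (comul_assoc, [12, 10, 15, 4, 2, 6]), (comul_assoc.symm, [0, 10, 6, 1, 4, 12]), (mul_piR, [10,
    1, 4, 5, 8]), (comul_piL, [2, 7, 23, 19, 1, 4, 5]), (mul_assoc, [4, 5, 15, 23, 9, 7]),
    (piL_mul, [6, 2, 15, 5, 7]), (unitAct_mul, [4, 6, 9, 24, 2]), (act_comul_one, [2, 1, 4, 19,
    24, 5, 7, 8]), (mulA_assoc.symm, [22, 2, 8, 1, 3, 24]), (unitAct_mul_self, [0, 10, 6, 22, 2,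
    1]), (piL_act.symm, [0, 8, 2, 3, 1]), (unitAct_mul.symm, [2, 7, 1, 3, 8]),
    (comul_piL_right.symm, [0, 4, 1, 19, 5, 7, 2]), (comul_proj_unitAct, [4, 1, 19, 3, 13])]
    (by decide +kernel) (by simp)

end CrossedData

end WeakCrossed

/-! ### From rules back to morphisms -/

namespace WeakCrossed
open StringDiagram

namespace CrossedData

variable {C : Type u} [Category.{v} C] [MonoidalCategory C] [SymmetricCategory C] {H A : C}
  [MonObj H] [ComonObj H] [MonObj A] (D : CrossedData H A) [hD : D.Valid]

/-- The morphism `γ⁻¹`. -/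
def gammaInvHom : H ⟶ D.E := mapQ D.S D.g ≫ (D.embHom ⊗ₘ D.gamHom) ≫ D.mulHom

theorem conv_gammaInv_mul_gamma :
    conv D.mulHom D.gammaInvHom D.gamHom =
      PiR H ≫ D.gamHom := by
  -- Convolution and implicit coherence are unfolded down to the morphisms that reification
  -- recognizes.
  simp [gammaInvHom, mapQ, conv, monoidalComp, MonoidalCoherence.iso]
  exact holds_gammaInv_mul_gamma.eq
    [1, 2, 3, 4, 5, 6, 7, 8, 9, 10, 11, 12, 13]
    [1, 13] (D.hw 0) rfl rfl (by unfold SSA; decide) (by unfold SSA; decide)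

theorem conv_gamma_mul_gammaInv :
    conv D.mulHom D.gamHom D.gammaInvHom =
      PiL H ≫ D.gamHom := by
  simp [gammaInvHom, mapQ, conv, monoidalComp, MonoidalCoherence.iso]
  exact holds_gamma_mul_gammaInv.eq
    [1, 2, 3, 4, 5, 6, 7, 8, 9, 10, 11, 12, 13]
    [4, 13] (D.hw 0) rfl rfl (by unfold SSA; decide) (by unfold SSA; decide)

end CrossedData

end WeakCrossed

theorem mainTheorem7 {C : Type u} [Category.{v} C] [MonoidalCategory C] [SymmetricCategory C]
    {H A : C} [MonObj H] [ComonObj H] [MonObj A]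
    (hH : WeakCrossed.IsWeakBialgebra H)
    (S : H ⟶ H) (hS : WeakCrossed.IsAntipode S)
    (ρ : H ⊗ A ⟶ A) (hρ : WeakCrossed.IsWeakModuleAlgebra ρ)
    (f : H ⊗ H ⟶ A) (hf : WeakCrossed.IsUnitaryCrossedProduct ρ f)
    (hinv : WeakCrossed.IsInvertibleCocycle ρ f)
    (E : WeakCrossed.Splitting (WeakCrossed.nabla (WeakCrossed.chi ρ))) :
    WeakCrossed.conv (WeakCrossed.mulE E (WeakCrossed.calF f))
        (WeakCrossed.gammaInv E S f hinv) (WeakCrossed.gammaMap E) =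
      WeakCrossed.PiR H ≫ WeakCrossed.gammaMap E ∧
    WeakCrossed.conv (WeakCrossed.mulE E (WeakCrossed.calF f))
        (WeakCrossed.gammaMap E) (WeakCrossed.gammaInv E S f hinv) =
      WeakCrossed.PiL H ≫ WeakCrossed.gammaMap E := by
  let D : WeakCrossed.CrossedData H A :=
    ⟨S, ρ, f, WeakCrossed.regularInverse (WeakCrossed.u2 ρ) f hinv, E.obj, E.incl, E.proj⟩
  have : D.Valid :=
    ⟨hH, hS, hρ, hf, hinv.1, hinv.inverse_spec hH hρ, E.proj_incl, E.incl_proj⟩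
  -- For this `D` the maps `mulHom`, `gamHom` and `gammaInvHom` are by definition `mulE`, `gammaMap`
  -- and `gammaInv`.
  exact ⟨D.conv_gammaInv_mul_gamma, D.conv_gamma_mul_gammaInv⟩
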